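/- Let $1\le d\le 5$, let $Q=\mathbb{R}^{d-1}/\mathbb{Z}^{d-1}$ and $S=Q\times\mathbb{R}$, with points $x=(x',z)$. Let $G(s)=\frac{(1-s^2)^2}{4}$, let $v_c(x',z)=\tanh\left(\frac{z-c}{\sqrt2}\right)$ for $c\in\mathbb{R}$, and set $$\mathcal{E}(u)=\int_S \tfrac12|\nabla u|^2+G(u)\,\mathrm{d}x-m_0,\qquad m_0=\int_{-1}^1\sqrt{2G(s)}\,\mathrm{d}s,\qquad D(u)=\int_S|\nabla(\Delta u-G'(u))|^2\,\mathrm{d}x,$$ where derivatives are weak derivatives. There exist universal constants $\overline\delta>0$ and $0<C<\infty$ with the following property. Let $u:S\to\mathbb{R}$ and $c\in\mathbb{R}$ be such that $v_c$ is an $L^2$-closest kink to $u$, i.e. $\|u-v_c\|_{L^2(S)}\le\|u-v_{c'}\|_{L^2(S)}$ for all $c'\in\mathbb{R}$, and put $f_c=u-v_c$. If $f_c\in H^3(S)$ and $\|f_c\|_{L^\infty(S)}\le\overline\delta$, then $$\frac1C\int_S f_c^2+|\nabla f_c|^2\,\mathrm{d}x\ \le\ \mathcal{E}(u)\ \le\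 C\int_S f_c^2+|\nabla f_c|^2\,\mathrm{d}x$$ and $$\frac1C\int_S|\nabla f_c|^2+|\nabla^2f_c|^2+|\nabla^3f_c|^2\,\mathrm{d}x\ \le\ D(u)\ \le\ C\int_S|\nabla f_c|^2+|\nabla^2f_c|^2+|\nabla^3f_c|^2\,\mathrm{d}x .$$ -/

import Mathlib

open MeasureTheory
open scoped ContDiff ENNReal NNReal

noncomputable section

/-- The strip `S = Q × ℝ` of dimension `d = n + 1`, where `Q = (ℝ/ℤ)ⁿ`; a point is `x = (x', z)`.
It carries the product of the Lebesgue measures (so `Q` has measure one). -/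
abbrev Strip (n : ℕ) : Type := (Fin n → UnitAddCircle) × ℝ

namespace Strip

variable {n : ℕ}

/-- The covering homomorphism `ℝᵈ → S`, `d = n + 1`; the last coordinate is the variable `z`. -/
def cover (y : Fin (n + 1) → ℝ) : Strip n :=
  (fun i => ((y i.castSucc : ℝ) : UnitAddCircle), y (Fin.last n))

/-- The classical partial derivative of a function on the strip. -/
def pderiv (i : Fin (n + 1)) (φ : Strip n → ℝ) (x : Strip n) : ℝ :=
  deriv (fun t : ℝ => φ (x + cover (Pi.single i t))) 0

/-- Test functions: `φ ∈ C_c^∞(S)`. -/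
structure IsTest (φ : Strip n → ℝ) : Prop where
  smooth : ContDiff ℝ ∞ (fun y : Fin (n + 1) → ℝ => φ (cover y))
  compact : HasCompactSupport φ

/-- `g` is the weak (distributional) partial derivative `∂ᵢ f`. -/
structure HasWeakDeriv (i : Fin (n + 1)) (f g : Strip n → ℝ) : Prop where
  locInt : LocallyIntegrable f volume
  locInt_deriv : LocallyIntegrable g volume
  byParts : ∀ φ : Strip n → ℝ, IsTest φ →
    ∫ x, f x * pderiv i φ x = - ∫ x, g x * φ x

/-- `f` has a locally integrable weak partial derivative in the direction `i`. -/
def WeakDiff (i : Fin (n + 1)) (f : Strip n → ℝ) : Prop :=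
  ∃ g, HasWeakDeriv i f g

open Classical in
/-- A representative of the weak partial derivative `∂ᵢ f` (unique almost everywhere);
zero if there is none. -/
def weakDeriv (i : Fin (n + 1)) (f : Strip n → ℝ) : Strip n → ℝ :=
  if h : WeakDiff i f then h.choose else 0

/-- The Sobolev space `H^k(S)`: all weak derivatives up to order `k` lie in `L²(S)`. -/
def MemSobolev : ℕ → (Strip n → ℝ) → Prop
  | 0, f => MemLp f 2 volume
  | k + 1, f => MemLp f 2 volume ∧ ∀ i, ∃ g, HasWeakDeriv i f g ∧ MemSobolev k g

/-- `|∇ᵏ f|²`, the sum of the squares of all weak partial derivatives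
`∂_{i₁} ⋯ ∂_{iₖ} f` of order `k`. -/
def gradSq : ℕ → (Strip n → ℝ) → Strip n → ℝ
  | 0, f => fun x => f x ^ 2
  | k + 1, f => fun x => ∑ i, gradSq k (weakDeriv i f) x

/-- The weak Laplacian. -/
def laplacian (f : Strip n → ℝ) (x : Strip n) : ℝ :=
  ∑ i, weakDeriv i (weakDeriv i f) x

/-- The double well potential `G(s) = (1 - s²)² / 4`. -/
def doubleWell (s : ℝ) : ℝ := (1 - s ^ 2) ^ 2 / 4

/-- The kink `v_c(x', z) = tanh ((z - c) / √2)`. -/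
def kink (n : ℕ) (c : ℝ) : Strip n → ℝ := fun x => Real.tanh ((x.2 - c) / √2)

/-- `v_c` minimizes the `L²` distance to `u` among all kinks. -/
def IsClosestKink (u : Strip n → ℝ) (c : ℝ) : Prop :=
  ∀ c' : ℝ, eLpNorm (u - kink n c) 2 volume ≤ eLpNorm (u - kink n c') 2 volume

open Classical in
/-- The energy `E(u) = ∫_S ½|∇u|² + G(u)`, with value `∞` if `u` has no weak gradient. -/
def energy (u : Strip n → ℝ) : ℝ≥0∞ :=
  if ∀ i, WeakDiff i u then
    ∫⁻ x, ENNReal.ofReal (1 / 2 * gradSq 1 u x + doubleWell (u x))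
  else ⊤

/-- `m₀ = ∫_{-1}^{1} √(2 G(s)) ds`, the energy of the kinks. -/
def kinkEnergy : ℝ := ∫ s in (-1 : ℝ)..1, √(2 * doubleWell s)

/-- The energy gap `ℰ(u) = E(u) - m₀`, with values in `(-∞, ∞]`. -/
def energyGap (u : Strip n → ℝ) : EReal := (energy u : EReal) - (kinkEnergy : EReal)

/-- `Δu - G'(u)`. -/
def potential (u : Strip n → ℝ) : Strip n → ℝ :=
  fun x => laplacian u x - deriv doubleWell (u x)

open Classical in
/-- The dissipation `D(u) = ∫_S |∇(Δu - G'(u))|²`, with value `∞` if one of the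
weak derivatives in it does not exist. -/
def dissipation (u : Strip n → ℝ) : ℝ≥0∞ :=
  if (∀ i, WeakDiff i u ∧ WeakDiff i (weakDeriv i u) ∧ WeakDiff i (potential u)) then
    ∫⁻ x, ENNReal.ofReal (gradSq 1 (potential u) x)
  else ⊤

end Strip

end

/-! Write v = v_c, f = u - v and w = ∂_z v = (1 - v²)/√2. Then w' = -√2 v w, which is the kink
equation v'' = v³ - v. The linearization L = -Δ + 3v² - 1 splits as L = A*A - Δ', where A = ∂_z + √2
v annihilates w and Δ' is the tangential Laplacian. In the other order AA* = -∂_z² + 1 + v², which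
is bounded below by 1. Since v_c is a closest kink, ∫ w f = 0
(`IsClosestKink.integral_kinkW_mul_eq_zero`).

The analytic core is one family of weighted inequalities, `HasGrad.poincare`: ∫ w^b f² is bounded by
∫ w^b (|∇'f|² + (∂_z f + a√2 v f)²) and (∫ w f)², for a, b ∈ {0, 1} not both zero. The case (1, 0)
is the spectral gap of L, (0, 1) bounds ∫ w f² by ∫ |∇f|², and (1, 1) is the weighted form for A.

Energy. The terms linear in f integrate to zero, so the gap is ½∫ |∇'f|² + ½∫ (A f)² + ∫ (v f³ +
f⁴/4). The spectral gap makes the quadratic part coercive in H¹, and a small sup norm absorbs the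
rest (`HasGrad.energyGap_eq`, `HasGrad.le_integral_excess`).

Dissipation. Here Δu - G'(u) = -(q + 3v f² + f³) with q = L f. The right-hand side contains no ∫ f²,
so f may only enter through ∫ w f². Tangential derivatives commute with L and are orthogonal to w,
so elliptic estimates apply to them directly. In the normal direction L ∂_z f = ∂_z q - 6 v w f, and
both this error and ∫ w ∂_z f are controlled by ∫ w f². To bound the latter by ∫ |∇q|²: Lw = 0 gives
∫ w q = 0, hence a bound on ∫ w q²; then g = A f solves (-Δ + 1 + v²) g = A q, and testing with w g
bounds ∫ w g²; case (1, 1) returns to f (`IsJet.integral_kinkW_mul_sq`). This yields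
`IsJet.linear_estimate`, and the gradient of the nonlinear part is O(δ) in L² relative to ∇f.

Integrations by parts are packed into functions of vanishing integral (`NullInt`), so each estimate
becomes a pointwise inequality. They are justified by density of test functions in H¹
(`HasGrad.exists_test`), and `HasWeakDeriv.unique` replaces the chosen representatives `weakDeriv`
by explicit derivatives. The bound on the dimension serves to make the constants numerical. -/

noncomputable section

open Filter Topology

namespace Strip

variable {n : ℕ}

/-! ### The measure of the strip -/

instance : IsProbabilityMeasure (volume : Measure UnitAddCircle) := ⟨by simp⟩

instance : (volume : Measure (Strip n)).IsAddHaarMeasure :=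
  Measure.prod.instIsAddHaarMeasure
    (volume : Measure (Fin n → UnitAddCircle)) (volume : Measure ℝ)

instance : (volume : Measure (Strip n)).Regular :=
  Measure.Regular.of_sigmaCompactSpace_of_isLocallyFiniteMeasure _

instance : (volume : Measure (Strip n)).IsNegInvariant :=
  Measure.IsAddHaarMeasure.isNegInvariant_of_regular _

/-! ### The covering map and smooth functions -/

lemma cover_add (y y' : Fin (n + 1) → ℝ) : cover (y + y') = cover y + cover y' := by
  simp only [cover, Prod.mk_add_mk, Pi.add_apply, AddCircle.coe_add]
  rfl

@[simp] lemma cover_zero : cover (0 : Fin (n + 1) → ℝ) = 0 := by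
  simp only [cover, Pi.zero_apply]
  rfl

/-- The cover is a product of the quotient maps ℝ → ℝ/ℤ and the identity of ℝ. Being a quotient map,
it lets continuity on the strip be tested on ℝᵈ, where smoothness is defined. -/
lemma isOpenQuotientMap_cover : IsOpenQuotientMap (cover : (Fin (n + 1) → ℝ) → Strip n) := by
  have h1 : IsOpenQuotientMap (Pi.map fun (_ : Fin n) (t : ℝ) => (t : UnitAddCircle)) :=
    IsOpenQuotientMap.piMap fun _ => QuotientAddGroup.isOpenQuotientMap_mk
  have h2 := h1.prodMap (IsOpenQuotientMap.id (X := ℝ))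
  let e : (Fin (n + 1) → ℝ) ≃ₜ (Fin n → ℝ) × ℝ :=
    { toFun := fun y => (fun i => y i.castSucc, y (Fin.last n))
      invFun := fun p => Fin.snoc p.1 p.2
      left_inv := fun y => Fin.snoc_init_self y
      right_inv := fun p => by ext <;> simp
      continuous_toFun := by fun_prop
      continuous_invFun := by fun_prop }
  exact h2.comp e.isOpenQuotientMap

lemma continuous_cover : Continuous (cover : (Fin (n + 1) → ℝ) → Strip n) :=
  isOpenQuotientMap_cover.continuous

lemma cover_surjective : Function.Surjective (cover : (Fin (n + 1) → ℝ) → Strip n) :=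
  isOpenQuotientMap_cover.surjective

/-- Smooth functions on the strip. -/
def IsSmooth (φ : Strip n → ℝ) : Prop :=
  ContDiff ℝ ∞ (fun y : Fin (n + 1) → ℝ => φ (cover y))

lemma IsTest.isSmooth {φ : Strip n → ℝ} (h : IsTest φ) : IsSmooth φ := h.smooth

lemma IsSmooth.continuous {φ : Strip n → ℝ} (h : IsSmooth φ) : Continuous φ :=
  isOpenQuotientMap_cover.isQuotientMap.continuous_iff.2 (ContDiff.continuous h)

lemma IsTest.continuous {φ : Strip n → ℝ} (h : IsTest φ) : Continuous φ := h.isSmooth.continuous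

lemma IsTest.integrable {φ : Strip n → ℝ} (h : IsTest φ) : Integrable φ :=
  h.continuous.integrable_of_hasCompactSupport h.compact

lemma IsTest.memLp {φ : Strip n → ℝ} (h : IsTest φ) (p : ℝ≥0∞) : MemLp φ p :=
  h.continuous.memLp_of_hasCompactSupport h.compact

lemma IsSmooth.hasDerivAt {φ : Strip n → ℝ} (h : IsSmooth φ) (i : Fin (n + 1)) (x : Strip n)
    (t : ℝ) : HasDerivAt (fun t : ℝ => φ (x + cover (Pi.single i t)))
      (pderiv i φ (x + cover (Pi.single i t))) t := by
  have key : ∀ x : Strip n, DifferentiableAt ℝ (fun t : ℝ => φ (x + cover (Pi.single i t))) 0 := by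
    intro x
    obtain ⟨y, rfl⟩ := cover_surjective x
    simp_rw [← cover_add]
    have h1 : DifferentiableAt ℝ (fun y : Fin (n + 1) → ℝ => φ (cover y)) (y + Pi.single i 0) :=
      (h.differentiable (by simp)).differentiableAt
    have h2 : DifferentiableAt ℝ (fun t : ℝ => y + Pi.single i t) 0 := by
      have : (fun t : ℝ => y + Pi.single i t) = fun t : ℝ => y + t • Pi.single i (1 : ℝ) := by
        ext t j; simp [Pi.single_apply]
      rw [this]
      fun_prop
    exact DifferentiableAt.comp (g := fun y : Fin (n + 1) → ℝ => φ (cover y)) (0 : ℝ) h1 h2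
  have h0 := (key (x + cover (Pi.single i t))).hasDerivAt
  have h1 : HasDerivAt (fun s : ℝ => s - t) 1 t := (hasDerivAt_id t).sub_const t
  have h2 : HasDerivAt (fun s : ℝ => φ (x + cover (Pi.single i t) + cover (Pi.single i s)))
      (pderiv i φ (x + cover (Pi.single i t))) (t - t) := by rw [sub_self]; exact h0
  have h3 := HasDerivAt.comp (h₂ := fun s : ℝ => φ (x + cover (Pi.single i t) + cover (Pi.single i s)))
    (h := fun s : ℝ => s - t) t h2 h1
  rw [mul_one] at h3
  refine h3.congr_of_eventuallyEq (Eventually.of_forall fun s => ?_)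
  simp only [Function.comp]
  rw [add_assoc, ← cover_add, ← Pi.single_add]
  simp

lemma IsSmooth.pderiv_cover {φ : Strip n → ℝ} (h : IsSmooth φ) (i : Fin (n + 1))
    (y : Fin (n + 1) → ℝ) :
    pderiv i φ (cover y) = fderiv ℝ (fun y => φ (cover y)) y (Pi.single i 1) := by
  have h1 : HasFDerivAt (fun y : Fin (n + 1) → ℝ => φ (cover y))
      (fderiv ℝ (fun y => φ (cover y)) y) (y + (0 : ℝ) • Pi.single i (1 : ℝ)) := by
    simpa using (h.differentiable (by simp)).differentiableAt.hasFDerivAt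
  have h2 : HasDerivAt (fun t : ℝ => y + t • Pi.single i (1 : ℝ)) (Pi.single i (1 : ℝ)) 0 := by
    simpa using ((hasDerivAt_id (0 : ℝ)).smul_const (Pi.single i (1 : ℝ))).const_add y
  have h3 := h1.comp_hasDerivAt (0 : ℝ) h2
  refine Eq.trans ?_ h3.deriv
  unfold pderiv
  congr 1
  ext t
  simp only [Function.comp, ← cover_add]
  congr 3
  ext j
  simp [Pi.single_apply]

lemma IsSmooth.pderiv {φ : Strip n → ℝ} (h : IsSmooth φ) (i : Fin (n + 1)) :
    IsSmooth (pderiv i φ) := by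
  unfold IsSmooth
  simp_rw [h.pderiv_cover]
  exact (h.fderiv_right (m := ∞) (by simp)).clm_apply contDiff_const

lemma pderiv_eq_zero_of_notMem_tsupport {φ : Strip n → ℝ} {i : Fin (n + 1)} {x : Strip n}
    (hx : x ∉ tsupport φ) : pderiv i φ x = 0 := by
  have h0 : φ =ᶠ[𝓝 x] 0 := notMem_tsupport_iff_eventuallyEq.1 hx
  have h1 : ContinuousAt (fun t : ℝ => x + cover (Pi.single i t)) 0 :=
    (continuous_const.add (continuous_cover.comp
      (continuous_single (A := fun _ => ℝ) i))).continuousAt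
  have h2 : Tendsto (fun t : ℝ => x + cover (Pi.single i t)) (𝓝 0) (𝓝 x) := by
    simpa using h1.tendsto
  have h3 : (fun t : ℝ => φ (x + cover (Pi.single i t))) =ᶠ[𝓝 0] fun _ => 0 :=
    h2.eventually h0
  unfold pderiv
  rw [h3.deriv_eq]
  simp

lemma IsTest.pderiv {φ : Strip n → ℝ} (h : IsTest φ) (i : Fin (n + 1)) :
    IsTest (pderiv i φ) where
  smooth := h.isSmooth.pderiv i
  compact := h.compact.mono' fun x hx => by
    by_contra hxs
    exact hx (pderiv_eq_zero_of_notMem_tsupport hxs)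

lemma IsSmooth.mul {φ ψ : Strip n → ℝ} (h : IsSmooth φ) (h' : IsSmooth ψ) :
    IsSmooth (fun x => φ x * ψ x) := ContDiff.mul h h'

lemma isSmooth_const (a : ℝ) : IsSmooth (fun _ : Strip n => a) := contDiff_const

lemma IsSmooth.mul_isTest {φ ψ : Strip n → ℝ} (h : IsSmooth φ) (h' : IsTest ψ) :
    IsTest (fun x => φ x * ψ x) := ⟨h.mul h'.isSmooth, h'.compact.mul_left⟩

lemma IsSmooth.pderiv_mul {φ ψ : Strip n → ℝ} (h : IsSmooth φ) (h' : IsSmooth ψ)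
    (i : Fin (n + 1)) (x : Strip n) :
    Strip.pderiv i (fun x => φ x * ψ x) x
      = Strip.pderiv i φ x * ψ x + φ x * Strip.pderiv i ψ x := by
  have h1 := h.hasDerivAt i x 0
  have h2 := h'.hasDerivAt i x 0
  have := (h1.fun_mul h2).deriv
  simpa [Strip.pderiv] using this

lemma IsSmooth.pderiv_comm {φ : Strip n → ℝ} (h : IsSmooth φ) (i j : Fin (n + 1)) (x : Strip n) :
    Strip.pderiv i (Strip.pderiv j φ) x = Strip.pderiv j (Strip.pderiv i φ) x := by
  obtain ⟨y, rfl⟩ := cover_surjective x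
  rw [(h.pderiv j).pderiv_cover, (h.pderiv i).pderiv_cover]
  simp_rw [h.pderiv_cover]
  have hd : Differentiable ℝ (fderiv ℝ (fun y : Fin (n + 1) → ℝ => φ (cover y))) :=
    (h.fderiv_right (m := ∞) (by simp)).differentiable (by simp)
  have hs : IsSymmSndFDerivAt ℝ (fun y : Fin (n + 1) → ℝ => φ (cover y)) y :=
    (ContDiff.contDiffAt h).isSymmSndFDerivAt (by simpa using WithTop.coe_le_coe.2 (le_top : (2 : ℕ∞) ≤ ⊤))
  rw [fderiv_clm_apply hd.differentiableAt (by fun_prop),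
    fderiv_clm_apply hd.differentiableAt (by fun_prop)]
  simpa using hs.eq _ _

/-- A function of the last variable is smooth on the strip. -/
lemma isSmooth_comp_snd {η : ℝ → ℝ} (h : ContDiff ℝ ∞ η) : IsSmooth (fun x : Strip n => η x.2) :=
  h.comp (contDiff_apply ℝ ℝ (Fin.last n))

lemma pderiv_comp_snd_last {η : ℝ → ℝ} (x : Strip n) :
    pderiv (Fin.last n) (fun x : Strip n => η x.2) x = deriv η x.2 := by
  unfold pderiv
  have : (fun t : ℝ => η (x + cover (Pi.single (Fin.last n) t)).2) = fun t => η (x.2 + t) := by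
    ext t; simp [cover]
  rw [this, deriv_comp_const_add, add_zero]

lemma pderiv_comp_snd_castSucc {η : ℝ → ℝ} (i : Fin n) (x : Strip n) :
    pderiv i.castSucc (fun x : Strip n => η x.2) x = 0 := by
  unfold pderiv
  have : (fun t : ℝ => η (x + cover (Pi.single i.castSucc t)).2) = fun t => η x.2 := by
    ext t; simp [cover, Pi.single_apply]
  rw [this]; simp

/-! ### Integration by parts for test functions -/

/-- Averaging the derivative over translates by t e_i, 0 ≤ t ≤ 1, does not change its integral. By
the fundamental theorem of calculus the average is a difference of two translates of φ, whose
integral vanishes by invariance of the measure. This treats periodic and unbounded directions alike.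
-/
lemma integral_pderiv_eq_zero {φ : Strip n → ℝ} (h : IsTest φ) (i : Fin (n + 1)) :
    ∫ x, pderiv i φ x = 0 := by
  have hs : Continuous fun p : Strip n × ℝ => p.1 + cover (Pi.single i p.2) :=
    continuous_fst.add (continuous_cover.comp ((continuous_single (A := fun _ => ℝ) i).comp continuous_snd))
  have hc : Continuous (pderiv i φ) := (h.pderiv i).continuous
  have ftc : ∀ x, ∫ t in (0 : ℝ)..1, pderiv i φ (x + cover (Pi.single i t))
      = φ (x + cover (Pi.single i 1)) - φ x := by
    intro x
    rw [intervalIntegral.integral_eq_sub_of_hasDerivAt (fun t _ => h.isSmooth.hasDerivAt i x t)]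
    · simp
    · exact (hc.comp (hs.comp (by fun_prop : Continuous fun t : ℝ => (x, t)))).intervalIntegrable _ _
  have h1 : ∫ x, (φ (x + cover (Pi.single i 1)) - φ x) = 0 := by
    rw [integral_sub (h.integrable.comp_add_right _) h.integrable, integral_add_right_eq_self,
      sub_self]
  rw [← h1]
  simp_rw [← ftc]
  simp_rw [intervalIntegral.integral_of_le zero_le_one]
  rw [integral_integral_swap]
  · simp [integral_add_right_eq_self (fun x => pderiv i φ x)]
  · have hm : AEStronglyMeasurable
        (Function.uncurry fun (x : Strip n) (t : ℝ) => pderiv i φ (x + cover (Pi.single i t)))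
        ((volume : Measure (Strip n)).prod (volume.restrict (Set.Ioc (0 : ℝ) 1))) :=
      Continuous.aestronglyMeasurable (hc.comp hs)
    rw [integrable_prod_iff' hm]
    constructor
    · refine Eventually.of_forall fun t => ?_
      exact (h.pderiv i).integrable.comp_add_right (cover (Pi.single i t))
    · simp only [Function.uncurry]
      simp_rw [integral_add_right_eq_self (fun x => ‖pderiv i φ x‖)]
      exact integrable_const _

end Strip

namespace Strip

variable {n : ℕ}

/-! ### Weak derivatives -/

lemma IsTest.integrable_mul {f φ : Strip n → ℝ} (h : IsTest φ) (hf : LocallyIntegrable f) :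
    Integrable (fun x => f x * φ x) := by
  simpa [mul_comm] using hf.integrable_smul_left_of_hasCompactSupport h.continuous h.compact

lemma _root_.MeasureTheory.LocallyIntegrable.mul_isSmooth {f φ : Strip n → ℝ}
    (hf : LocallyIntegrable f) (h : IsSmooth φ) : LocallyIntegrable (fun x => φ x * f x) := by
  simpa using LocallyIntegrable.continuous_smul h.continuous hf

lemma HasWeakDeriv.congr {i : Fin (n + 1)} {f f' g g' : Strip n → ℝ} (h : HasWeakDeriv i f g)
    (hf : f =ᵐ[volume] f') (hg : g =ᵐ[volume] g') : HasWeakDeriv i f' g' where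
  locInt := h.locInt.congr hf
  locInt_deriv := h.locInt_deriv.congr hg
  byParts φ hφ := by
    have h1 : ∫ x, f x * pderiv i φ x = ∫ x, f' x * pderiv i φ x :=
      integral_congr_ae (hf.mul (ae_eq_refl (pderiv i φ)))
    have h2 : ∫ x, g x * φ x = ∫ x, g' x * φ x := integral_congr_ae (hg.mul (ae_eq_refl φ))
    rw [← h1, ← h2]
    exact h.byParts φ hφ

lemma HasWeakDeriv.add {i : Fin (n + 1)} {f f' g g' : Strip n → ℝ} (h : HasWeakDeriv i f g)
    (h' : HasWeakDeriv i f' g') :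
    HasWeakDeriv i (fun x => f x + f' x) (fun x => g x + g' x) where
  locInt := h.locInt.add h'.locInt
  locInt_deriv := h.locInt_deriv.add h'.locInt_deriv
  byParts φ hφ := by
    simp_rw [add_mul]
    rw [integral_add ((hφ.pderiv i).integrable_mul h.locInt)
      ((hφ.pderiv i).integrable_mul h'.locInt), integral_add (hφ.integrable_mul h.locInt_deriv)
      (hφ.integrable_mul h'.locInt_deriv), h.byParts φ hφ, h'.byParts φ hφ]
    ring

lemma IsSmooth.hasWeakDeriv {φ : Strip n → ℝ} (h : IsSmooth φ) (i : Fin (n + 1)) :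
    HasWeakDeriv i φ (Strip.pderiv i φ) where
  locInt := h.continuous.locallyIntegrable
  locInt_deriv := (h.pderiv i).continuous.locallyIntegrable
  byParts ψ hψ := by
    have h0 := integral_pderiv_eq_zero (h.mul_isTest hψ) i
    simp_rw [h.pderiv_mul hψ.isSmooth] at h0
    rw [integral_add (((h.pderiv i).mul_isTest hψ).integrable)
      ((h.mul_isTest (hψ.pderiv i)).integrable)] at h0
    linarith

lemma HasWeakDeriv.isSmooth_mul {i : Fin (n + 1)} {f g φ : Strip n → ℝ} (h : HasWeakDeriv i f g)
    (hφ : IsSmooth φ) :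
    HasWeakDeriv i (fun x => φ x * f x) (fun x => pderiv i φ x * f x + φ x * g x) where
  locInt := h.locInt.mul_isSmooth hφ
  locInt_deriv := (h.locInt.mul_isSmooth (hφ.pderiv i)).add (h.locInt_deriv.mul_isSmooth hφ)
  byParts ψ hψ := by
    have h0 := h.byParts _ (hφ.mul_isTest hψ)
    simp_rw [hφ.pderiv_mul hψ.isSmooth, mul_add] at h0
    rw [integral_add (((hφ.pderiv i).mul_isTest hψ).integrable_mul h.locInt)
      ((hφ.mul_isTest (hψ.pderiv i)).integrable_mul h.locInt)] at h0
    simp_rw [add_mul]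
    rw [integral_add (hψ.integrable_mul (h.locInt.mul_isSmooth (hφ.pderiv i)))
      (hψ.integrable_mul (h.locInt_deriv.mul_isSmooth hφ))]
    have e1 : ∀ x, pderiv i φ x * f x * ψ x = f x * (pderiv i φ x * ψ x) := fun x => by ring
    have e2 : ∀ x, φ x * g x * ψ x = g x * (φ x * ψ x) := fun x => by ring
    have e3 : ∀ x, φ x * f x * pderiv i ψ x = f x * (φ x * pderiv i ψ x) := fun x => by ring
    simp_rw [e1, e2, e3]
    linarith

lemma HasWeakDeriv.const_mul {i : Fin (n + 1)} {f g : Strip n → ℝ} (h : HasWeakDeriv i f g)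
    (a : ℝ) : HasWeakDeriv i (fun x => a * f x) (fun x => a * g x) := by
  have := h.isSmooth_mul (isSmooth_const a)
  simpa [pderiv] using this

lemma HasWeakDeriv.sum {ι : Type*} {i : Fin (n + 1)} {f g : ι → Strip n → ℝ} (s : Finset ι)
    (h : ∀ j ∈ s, HasWeakDeriv i (f j) (g j)) :
    HasWeakDeriv i (fun x => ∑ j ∈ s, f j x) (fun x => ∑ j ∈ s, g j x) := by
  classical
  induction s using Finset.induction_on with
  | empty =>
    refine ((isSmooth_const (n := n) 0).hasWeakDeriv i).congr ?_ ?_ <;>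
      exact Eventually.of_forall fun x => by simp [pderiv]
  | insert a s ha ih =>
    simp_rw [Finset.sum_insert ha]
    exact (h a (by simp)).add (ih fun j hj => h j (by simp [hj]))

/-- Weak derivatives commute. -/
lemma HasWeakDeriv.comm {i j : Fin (n + 1)} {f gi gj h : Strip n → ℝ} (hi : HasWeakDeriv i f gi)
    (hj : HasWeakDeriv j f gj) (hij : HasWeakDeriv j gi h) : HasWeakDeriv i gj h where
  locInt := hj.locInt_deriv
  locInt_deriv := hij.locInt_deriv
  byParts φ hφ := by
    have h1 := hj.byParts _ (hφ.pderiv i)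
    have h2 := hi.byParts _ (hφ.pderiv j)
    have h3 := hij.byParts _ hφ
    simp_rw [hφ.isSmooth.pderiv_comm j i] at h1
    linarith

/-! ### Convolution with test functions -/

/-- The convolution of `f` with the kernel `k`. -/
def conv (f k : Strip n → ℝ) (x : Strip n) : ℝ := ∫ s, f s * k (x - s)

lemma IsTest.comp_sub_left {k : Strip n → ℝ} (hk : IsTest k) (x : Strip n) :
    IsTest (fun s => k (x - s)) where
  smooth := by
    obtain ⟨y, rfl⟩ := cover_surjective x
    have : ∀ z : Fin (n + 1) → ℝ, cover y - cover z = cover (y - z) := fun z => by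
      rw [sub_eq_iff_eq_add, ← cover_add, sub_add_cancel]
    simp_rw [this]
    exact ContDiff.comp (g := fun y : Fin (n + 1) → ℝ => k (cover y)) hk.smooth
      (contDiff_const.sub contDiff_id)
  compact := hk.compact.comp_homeomorph (Homeomorph.subLeft x)

lemma IsTest.pderiv_comp_sub_left {k : Strip n → ℝ} (hk : IsTest k) (x s : Strip n)
    (i : Fin (n + 1)) : Strip.pderiv i (fun s => k (x - s)) s = - Strip.pderiv i k (x - s) := by
  have h1 : HasDerivAt (fun t : ℝ => k (x - s + cover (Pi.single i t)))
      (Strip.pderiv i k (x - s)) (-(0 : ℝ)) := by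
    have := hk.isSmooth.hasDerivAt i (x - s) 0
    simpa using this
  have h2 := HasDerivAt.comp (h₂ := fun t : ℝ => k (x - s + cover (Pi.single i t)))
    (h := fun t : ℝ => -t) (0 : ℝ) h1 (hasDerivAt_neg (0 : ℝ))
  have h3 := h2.deriv
  rw [mul_neg_one] at h3
  rw [← h3]
  unfold Strip.pderiv
  congr 1
  ext t
  simp only [Function.comp]
  have : cover (Pi.single i (-t)) = - cover (Pi.single i t) := by
    rw [eq_neg_iff_add_eq_zero, ← cover_add, ← Pi.single_add]; simp
  rw [this]
  congr 1
  abel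

/-- The function s ↦ k (x - s) is itself a test function, and its reflection cancels the sign in the
definition of the weak derivative. -/
lemma HasWeakDeriv.conv_pderiv {i : Fin (n + 1)} {f g k : Strip n → ℝ} (h : HasWeakDeriv i f g)
    (hk : IsTest k) : conv f (pderiv i k) = conv g k := by
  ext x
  have := h.byParts _ (hk.comp_sub_left x)
  simp_rw [hk.pderiv_comp_sub_left, mul_neg, integral_neg] at this
  exact neg_injective this

lemma clm_eq_sum (L : (Fin (n + 1) → ℝ) →L[ℝ] ℝ) :
    L = ∑ i, L (Pi.single i 1) • ContinuousLinearMap.proj (R := ℝ) (φ := fun _ => ℝ) i := by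
  ext y
  conv_lhs => rw [pi_eq_sum_univ' y]
  simp [mul_comm]

lemma hasFDerivAt_conv {f k : Strip n → ℝ} (hf : LocallyIntegrable f) (hk : IsTest k)
    (y : Fin (n + 1) → ℝ) :
    HasFDerivAt (fun y : Fin (n + 1) → ℝ => conv f k (cover y))
      (∑ i, conv f (pderiv i k) (cover y) •
        ContinuousLinearMap.proj (R := ℝ) (φ := fun _ : Fin (n + 1) => ℝ) i) y := by
  let P : Fin (n + 1) → ((Fin (n + 1) → ℝ) →L[ℝ] ℝ) :=
    fun i => ContinuousLinearMap.proj (R := ℝ) (φ := fun _ : Fin (n + 1) => ℝ) i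
  have hk1 : ∀ s, ∀ y : Fin (n + 1) → ℝ,
      HasFDerivAt (fun y => k (cover y - s)) (∑ i, pderiv i k (cover y - s) • P i) y := by
    intro s y
    obtain ⟨t, rfl⟩ := cover_surjective s
    have : ∀ z : Fin (n + 1) → ℝ, cover z - cover t = cover (z - t) := fun z => by
      rw [sub_eq_iff_eq_add, ← cover_add, sub_add_cancel]
    simp_rw [this, hk.isSmooth.pderiv_cover]
    have h1 : HasFDerivAt (fun y => k (cover y)) (fderiv ℝ (fun y => k (cover y)) (y - t)) (y - t) :=
      (hk.smooth.differentiable (by simp)).differentiableAt.hasFDerivAt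
    have h2 := h1.comp y ((hasFDerivAt_id y).sub_const t)
    rw [← clm_eq_sum]
    exact h2
  -- `K` contains the supports of s ↦ k (cover z - s) for all z in the unit ball around y, so the
  -- dominating function lives on a compact set, where f is integrable.
  let K : Set (Strip n) := (fun p : Strip n × Strip n => p.1 - p.2) ''
    ((cover '' Metric.closedBall y 1) ×ˢ tsupport k)
  have hK : IsCompact K :=
    (((isCompact_closedBall y 1).image continuous_cover).prod hk.compact).image
      (continuous_fst.sub continuous_snd)
  obtain ⟨M, hM⟩ : ∃ M, ∀ i x, ‖pderiv i k x‖ ≤ M := by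
    choose M hM using fun i => (hk.pderiv i).compact.exists_bound_of_continuous (hk.pderiv i).continuous
    exact ⟨∑ i, |M i|, fun i x => (hM i x).trans ((le_abs_self _).trans
      (Finset.single_le_sum (f := fun i => |M i|) (fun _ _ => abs_nonneg _) (Finset.mem_univ i)))⟩
  have key := hasFDerivAt_integral_of_dominated_of_fderiv_le (𝕜 := ℝ) (μ := (volume : Measure (Strip n)))
    (F := fun (y : Fin (n + 1) → ℝ) s => f s * k (cover y - s)) (x₀ := y)
    (F' := fun (y : Fin (n + 1) → ℝ) s => f s • ∑ i, pderiv i k (cover y - s) • P i)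
    (bound := fun s => K.indicator (fun s => ‖f s‖ * ∑ i, M * ‖P i‖) s)
    (s := Metric.ball y 1) (Metric.ball_mem_nhds y one_pos) ?_ ?_ ?_ ?_ ?_ ?_
  · refine key.congr_fderiv ?_
    simp_rw [Finset.smul_sum, smul_smul]
    rw [integral_finsetSum]
    · refine Finset.sum_congr rfl fun i _ => ?_
      rw [integral_smul_const]
      rfl
    · intro i _
      exact (((hk.pderiv i).comp_sub_left _).integrable_mul hf).smul_const _
  · exact Eventually.of_forall fun y => ((hk.comp_sub_left _).integrable_mul hf).aestronglyMeasurable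
  · exact (hk.comp_sub_left _).integrable_mul hf
  · refine hf.aestronglyMeasurable.smul (Continuous.aestronglyMeasurable ?_)
    refine continuous_finsetSum _ fun i _ => Continuous.fun_smul ?_ continuous_const
    exact (hk.pderiv i).continuous.comp (continuous_const.sub continuous_id)
  · refine Eventually.of_forall fun s z hz => ?_
    by_cases hs : s ∈ K
    · rw [Set.indicator_of_mem hs, norm_smul]
      refine mul_le_mul_of_nonneg_left ((norm_sum_le _ _).trans ?_) (norm_nonneg _)
      refine Finset.sum_le_sum fun i _ => ?_
      rw [norm_smul]
      exact mul_le_mul_of_nonneg_right (hM i _) (norm_nonneg _)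
    · rw [Set.indicator_of_notMem hs]
      have : ∀ i, pderiv i k (cover z - s) = 0 := by
        intro i
        by_contra hne
        have h1 : cover z - s ∈ tsupport k := by
          have h2 : pderiv i k (cover z - s) ≠ 0 := hne
          by_contra h3
          exact hne (pderiv_eq_zero_of_notMem_tsupport h3)
        exact hs ⟨(cover z, cover z - s), ⟨⟨z, Metric.ball_subset_closedBall hz, rfl⟩, h1⟩, by simp⟩
      simp [this]
  · refine IntegrableOn.integrable_indicator ?_ hK.measurableSet
    exact ((hf.integrableOn_isCompact hK).norm).mul_const _
  · refine Eventually.of_forall fun s z _ => ?_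
    exact (hk1 s z).const_mul (f s)

/-- Induction on the order of differentiability: the partial derivatives of a convolution are
convolutions with the derivatives of the kernel, which are again test functions. -/
lemma isSmooth_conv {f k : Strip n → ℝ} (hf : LocallyIntegrable f) (hk : IsTest k) :
    IsSmooth (conv f k) := by
  refine contDiff_infty.2 fun m => ?_
  induction m generalizing k with
  | zero =>
    exact contDiff_zero.2 (continuous_iff_continuousAt.2 fun y => (hasFDerivAt_conv hf hk y).continuousAt)
  | succ m ih =>
    refine contDiff_succ_iff_hasFDerivAt.2 ⟨_, ?_, hasFDerivAt_conv hf hk⟩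
    exact ContDiff.sum fun i _ => (ih (hk.pderiv i)).smul contDiff_const

lemma pderiv_conv {f k : Strip n → ℝ} (hf : LocallyIntegrable f) (hk : IsTest k)
    (i : Fin (n + 1)) : pderiv i (conv f k) = conv f (pderiv i k) := by
  ext x
  obtain ⟨y, rfl⟩ := cover_surjective x
  rw [(isSmooth_conv hf hk).pderiv_cover, (hasFDerivAt_conv hf hk y).fderiv]
  simp [Pi.single_apply]

end Strip

/-! ### Convergence in `L²` -/

lemma MeasureTheory.MemLp.eLpNorm_two_eq {α : Type*} {m : MeasurableSpace α} {μ : Measure α}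
    {f : α → ℝ} (hf : MemLp f 2 μ) :
    eLpNorm f 2 μ = ENNReal.ofReal √(∫ x, f x ^ 2 ∂μ) := by
  rw [hf.eLpNorm_eq_integral_rpow_norm (by simp) (by simp), Real.sqrt_eq_rpow]
  simp

lemma MeasureTheory.MemLp.integrable_mul_two {α : Type*} {m : MeasurableSpace α} {μ : Measure α}
    {f g : α → ℝ} (hf : MemLp f 2 μ) (hg : MemLp g 2 μ) : Integrable (fun x => f x * g x) μ :=
  hf.integrable_mul hg

/-- Convergence in `L²` of functions. -/
def L2Tendsto {α : Type*} [MeasureSpace α] (φ : ℕ → α → ℝ) (f : α → ℝ) : Prop :=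
  Tendsto (fun N => eLpNorm (φ N - f) 2 volume) atTop (𝓝 0)

namespace L2Tendsto

variable {α : Type*} [MeasureSpace α] {φ ψ : ℕ → α → ℝ} {f g : α → ℝ}

lemma add (h : L2Tendsto φ f) (h' : L2Tendsto ψ g) (hφ : ∀ N, MemLp (φ N) 2) (hf : MemLp f 2)
    (hψ : ∀ N, MemLp (ψ N) 2) (hg : MemLp g 2) :
    L2Tendsto (fun N x => φ N x + ψ N x) (fun x => f x + g x) := by
  have h0 := Tendsto.add h h'
  rw [add_zero] at h0
  refine tendsto_of_tendsto_of_tendsto_of_le_of_le tendsto_const_nhds h0 (fun _ => zero_le)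
    fun N => ?_
  refine le_trans (le_of_eq ?_) (eLpNorm_add_le ((hφ N).sub hf).1 ((hψ N).sub hg).1 (by simp))
  congr 1
  ext x
  simp only [Pi.sub_apply, Pi.add_apply]
  ring

/-- The hypothesis `hη` covers two situations at once: a fixed multiplier η N = ξ, and a varying
multiplier with limit f = 0. -/
lemma bdd_mul {η : ℕ → α → ℝ} {ξ : α → ℝ} {M : ℝ} (h : L2Tendsto φ f)
    (hη : ∀ N x, η N x * φ N x - ξ x * f x = η N x * (φ N x - f x)) (hM : ∀ N x, |η N x| ≤ M) :
    L2Tendsto (fun N x => η N x * φ N x) (fun x => ξ x * f x) := by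
  have h0 := ENNReal.Tendsto.const_mul (a := ENNReal.ofReal M) h (Or.inr ENNReal.ofReal_ne_top)
  rw [mul_zero] at h0
  refine tendsto_of_tendsto_of_tendsto_of_le_of_le tendsto_const_nhds h0 (fun _ => zero_le)
    fun N => ?_
  refine eLpNorm_le_mul_eLpNorm_of_ae_le_mul (Eventually.of_forall fun x => ?_) _
  simp only [Pi.sub_apply, hη, norm_mul, Real.norm_eq_abs]
  exact mul_le_mul_of_nonneg_right (hM N x) (abs_nonneg _)

lemma bdd_const_mul {η : α → ℝ} {M : ℝ} (h : L2Tendsto φ f) (hM : ∀ x, |η x| ≤ M) :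
    L2Tendsto (fun N x => η x * φ N x) (fun x => η x * f x) :=
  h.bdd_mul (η := fun _ => η) (fun _ _ => by ring) fun _ => hM

lemma integral_mul (h : L2Tendsto φ f) (h' : L2Tendsto ψ g) (hφ : ∀ N, MemLp (φ N) 2)
    (hf : MemLp f 2) (hψ : ∀ N, MemLp (ψ N) 2) (hg : MemLp g 2) :
    Tendsto (fun N => ∫ x, φ N x * ψ N x) atTop (𝓝 (∫ x, f x * g x)) := by
  have key : ∀ {a b : α → ℝ} (ha : MemLp a 2) (hb : MemLp b 2),
      ∫ x, a x * b x = inner ℝ (ha.toLp a) (hb.toLp b) := by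
    intro a b ha hb
    rw [L2.inner_def]
    refine integral_congr_ae ?_
    filter_upwards [ha.coeFn_toLp, hb.coeFn_toLp] with x h1 h2
    rw [h1, h2]
    simp [mul_comm]
  rw [key hf hg]
  simp_rw [fun N => key (hφ N) (hψ N)]
  exact ((Lp.tendsto_Lp_iff_tendsto_eLpNorm'' φ hφ f hf).2 h).inner
    ((Lp.tendsto_Lp_iff_tendsto_eLpNorm'' ψ hψ g hg).2 h')

lemma const (f : α → ℝ) : L2Tendsto (fun _ => f) f := by
  simp [L2Tendsto]

end L2Tendsto

namespace Strip

variable {n : ℕ}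

/-! ### Mollifiers -/

/-- A sequence of nonnegative test functions of mass one whose supports shrink to the origin. -/
structure IsMollifier (k : ℕ → Strip n → ℝ) : Prop where
  isTest : ∀ N, IsTest (k N)
  nonneg : ∀ N x, 0 ≤ k N x
  integral_eq_one : ∀ N, ∫ x, k N x = 1
  eventually_mem : ∀ U ∈ 𝓝 (0 : Strip n), ∀ᶠ N in atTop, ∀ x, k N x ≠ 0 → x ∈ U

/-- A smooth substitute for the square of the distance to the origin. -/
def gauge (x : Strip n) : ℝ := ∑ i, (1 - (fourier 1 (x.1 i) : ℂ).re) + x.2 ^ 2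

lemma one_sub_fourier_nonneg (t : UnitAddCircle) : 0 ≤ 1 - (fourier 1 t : ℂ).re := by
  have h1 : ‖(fourier 1 t : ℂ)‖ = 1 := by rw [fourier_apply]; exact Circle.norm_coe _
  have := (Complex.re_le_norm (fourier 1 t : ℂ))
  linarith

lemma isSmooth_gauge : IsSmooth (gauge : Strip n → ℝ) := by
  have : (fun y : Fin (n + 1) → ℝ => gauge (cover y))
      = fun y => ∑ i : Fin n, (1 - Real.cos (2 * Real.pi * y i.castSucc)) + y (Fin.last n) ^ 2 := by
    ext y
    simp only [gauge, cover]
    congr 1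
    refine Finset.sum_congr rfl fun i _ => ?_
    rw [fourier_coe_apply]
    have : (2 * Real.pi * Complex.I * (1 : ℤ) * (y i.castSucc : ℂ) / (1 : ℝ))
        = ((2 * Real.pi * y i.castSucc : ℝ) : ℂ) * Complex.I := by push_cast; ring
    rw [this, Complex.exp_ofReal_mul_I_re]
  unfold IsSmooth
  rw [this]
  fun_prop

lemma gauge_nonneg (x : Strip n) : 0 ≤ gauge x :=
  add_nonneg (Finset.sum_nonneg fun _ _ => one_sub_fourier_nonneg _) (sq_nonneg _)

lemma gauge_zero : gauge (0 : Strip n) = 0 := by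
  have := fun i : Fin n => fourier_eval_zero (T := 1) 1
  simp [gauge]

lemma eq_zero_of_gauge_eq_zero {x : Strip n} (h : gauge x = 0) : x = 0 := by
  have h1 := Finset.sum_nonneg (s := Finset.univ) fun (i : Fin n) _ => one_sub_fourier_nonneg (x.1 i)
  have h2 := sq_nonneg x.2
  unfold gauge at h
  have h3 : ∑ i, (1 - (fourier 1 (x.1 i) : ℂ).re) = 0 := by linarith
  have h4 : x.2 = 0 := by
    have : x.2 ^ 2 = 0 := by linarith
    simpa using this
  rw [Finset.sum_eq_zero_iff_of_nonneg fun i _ => one_sub_fourier_nonneg _] at h3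
  refine Prod.ext (funext fun i => ?_) h4
  have h5 := h3 i (Finset.mem_univ i)
  have h6 : ‖(fourier 1 (x.1 i) : ℂ)‖ = 1 := by
    rw [fourier_apply]; exact Circle.norm_coe _
  have h7 : (fourier 1 (x.1 i) : ℂ) = 1 := by
    have hre : (fourier 1 (x.1 i) : ℂ).re = 1 := by linarith
    refine Complex.ext hre ?_
    have := Complex.sq_norm (fourier 1 (x.1 i) : ℂ)
    rw [h6, Complex.normSq_apply, hre] at this
    simp only [Complex.one_im]
    nlinarith
  refine AddCircle.injective_toCircle (T := (1 : ℝ)) one_ne_zero ?_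
  refine Subtype.ext ?_
  rw [fourier_one] at h7
  simpa using h7

lemma isCompact_gauge_le (r : ℝ) : IsCompact {x : Strip n | gauge x ≤ r} := by
  have h1 : IsCompact ((Set.univ : Set (Fin n → UnitAddCircle)) ×ˢ Set.Icc (-√r) (√r)) :=
    isCompact_univ.prod isCompact_Icc
  refine h1.of_isClosed_subset (isClosed_le isSmooth_gauge.continuous continuous_const) ?_
  intro x hx
  refine ⟨trivial, ?_⟩
  have h2 := Finset.sum_nonneg (s := Finset.univ) fun (i : Fin n) _ => one_sub_fourier_nonneg (x.1 i)
  have h3 : gauge x ≤ r := hx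
  unfold gauge at h3
  exact abs_le.1 (Real.abs_le_sqrt (by linarith))

/-- Sublevel sets of the gauge form a neighbourhood basis of the origin: on the compact set {gauge ≤
1} minus an open neighbourhood, the gauge attains a positive minimum. -/
lemma exists_gauge_lt_subset {U : Set (Strip n)} (hU : U ∈ 𝓝 (0 : Strip n)) :
    ∃ ε > 0, ∀ x, gauge x < ε → x ∈ U := by
  obtain ⟨V, hVU, hV, h0⟩ := mem_nhds_iff.1 hU
  have hK : IsCompact ({x : Strip n | gauge x ≤ 1} \ V) := (isCompact_gauge_le 1).diff hV
  rcases Set.eq_empty_or_nonempty ({x : Strip n | gauge x ≤ 1} \ V) with he | hne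
  · refine ⟨1, one_pos, fun x hx => hVU ?_⟩
    by_contra hxV
    have : x ∈ ({x : Strip n | gauge x ≤ 1} \ V) := ⟨hx.le, hxV⟩
    simp [he] at this
  · obtain ⟨m, hm, hmin⟩ := hK.exists_isMinOn hne isSmooth_gauge.continuous.continuousOn
    have hpos : 0 < gauge m := by
      refine lt_of_le_of_ne (gauge_nonneg m) fun h => ?_
      rw [eq_zero_of_gauge_eq_zero h.symm] at hm
      exact hm.2 h0
    refine ⟨min 1 (gauge m), lt_min one_pos hpos, fun x hx => hVU ?_⟩
    by_contra hxV
    have h1 : x ∈ ({x : Strip n | gauge x ≤ 1} \ V) := ⟨(hx.trans_le (min_le_left _ _)).le, hxV⟩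
    have h2 : gauge m ≤ gauge x := hmin h1
    exact absurd (hx.trans_le (min_le_right _ _)) (not_lt.2 h2)

/-- A fixed bump is applied to (N + 1) times the gauge, which shrinks the support while keeping
smoothness on the quotient; the result is then divided by its integral. -/
lemma exists_isMollifier : ∃ k : ℕ → Strip n → ℝ, IsMollifier k := by
  let b : ContDiffBump (0 : ℝ) := ⟨1 / 2, 1, by norm_num, by norm_num⟩
  let k : ℕ → Strip n → ℝ := fun N x => b ((N + 1) * gauge x)
  have hsupp : ∀ N x, k N x ≠ 0 → gauge x < 1 / (N + 1) := by
    intro N x hx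
    have h1 : ((N : ℝ) + 1) * gauge x ∈ Function.support b := hx
    rw [b.support_eq, Metric.mem_ball, Real.dist_eq, sub_zero] at h1
    have hN : (0 : ℝ) < N + 1 := by positivity
    rw [lt_div_iff₀ hN, mul_comm]
    exact (le_abs_self _).trans_lt h1
  have hsm : ∀ N, IsSmooth (k N) := fun N => by
    have h1 : IsSmooth fun x : Strip n => ((N : ℝ) + 1) * gauge x :=
      (isSmooth_const _).mul isSmooth_gauge
    exact ContDiff.comp (g := fun t : ℝ => b t) b.contDiff h1
  have hte : ∀ N, IsTest (k N) := fun N => by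
    refine ⟨hsm N, HasCompactSupport.intro (isCompact_gauge_le (1 / (N + 1))) fun x hx => ?_⟩
    by_contra h
    exact hx (hsupp N x h).le
  have hnn : ∀ N x, 0 ≤ k N x := fun N x => b.nonneg
  have hpos : ∀ N, 0 < ∫ x, k N x := fun N => by
    refine (hte N).continuous.integral_pos_of_hasCompactSupport_nonneg_nonzero (hte N).compact
      (hnn N) (x := 0) ?_
    have : k N 0 = 1 := by
      simp only [k, gauge_zero, mul_zero]
      exact b.one_of_mem_closedBall (by simp [b])
    rw [this]; exact one_ne_zero
  refine ⟨fun N x => (∫ x, k N x)⁻¹ * k N x, fun N => (isSmooth_const _).mul_isTest (hte N),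
    fun N x => mul_nonneg (inv_nonneg.2 (hpos N).le) (hnn N x), fun N => ?_, fun U hU => ?_⟩
  · rw [integral_const_mul, inv_mul_cancel₀ (hpos N).ne']
  · obtain ⟨ε, hε, hεU⟩ := exists_gauge_lt_subset hU
    have h1 := tendsto_one_div_add_atTop_nhds_zero_nat (𝕜 := ℝ)
    filter_upwards [h1.eventually_lt_const hε] with N hN x hx
    exact hεU x ((hsupp N x fun h => hx (by simp [h])).trans hN)

lemma conv_eq_integral_sub (f k : Strip n → ℝ) (x : Strip n) :
    conv f k x = ∫ s, f (x - s) * k s := by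
  have := integral_sub_left_eq_self (fun s => f (x - s) * k s) (volume : Measure (Strip n)) x
  rw [← this]
  simp [conv]

lemma conv_add {f g k : Strip n → ℝ} (hf : LocallyIntegrable f) (hg : LocallyIntegrable g)
    (hk : IsTest k) : conv (fun x => f x + g x) k = fun x => conv f k x + conv g k x := by
  ext x
  unfold conv
  rw [← integral_add ((hk.comp_sub_left x).integrable_mul hf)
    ((hk.comp_sub_left x).integrable_mul hg)]
  simp_rw [add_mul]

lemma _root_.MeasureTheory.MemLp.locallyIntegrable_two {f : Strip n → ℝ} (hf : MemLp f 2) :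
    LocallyIntegrable f := hf.locallyIntegrable (by norm_num)

/-- Jensen's inequality: f has nonnegative variance under the probability density s ↦ k (x - s). -/
lemma conv_sq_le {f k : Strip n → ℝ} (hf : MemLp f 2) (hk : IsTest k) (hnn : ∀ x, 0 ≤ k x)
    (h1 : ∫ x, k x = 1) (x : Strip n) :
    conv f k x ^ 2 ≤ conv (fun s => f s ^ 2) k x := by
  set m := conv f k x with hm
  have hk' := hk.comp_sub_left x
  have i1 : Integrable fun s => f s * k (x - s) := hk'.integrable_mul hf.locallyIntegrable_two
  have i2 : Integrable fun s => f s ^ 2 * k (x - s) :=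
    hk'.integrable_mul hf.integrable_sq.locallyIntegrable
  have h0 : 0 ≤ ∫ s, (f s - m) ^ 2 * k (x - s) :=
    integral_nonneg fun s => mul_nonneg (sq_nonneg _) (hnn _)
  have e : ∀ s, (f s - m) ^ 2 * k (x - s)
      = f s ^ 2 * k (x - s) - (2 * m) * (f s * k (x - s)) + m ^ 2 * k (x - s) := fun s => by ring
  simp_rw [e] at h0
  rw [integral_add (f := fun s => f s ^ 2 * k (x - s) - (2 * m) * (f s * k (x - s)))
    (i2.sub (i1.const_mul _)) (hk'.integrable.const_mul _), integral_sub i2 (i1.const_mul _), integral_const_mul, integral_const_mul,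
    integral_sub_left_eq_self k, h1] at h0
  have : ∫ s, f s * k (x - s) = m := rfl
  rw [this] at h0
  unfold conv
  nlinarith

lemma integrable_conv {f k : Strip n → ℝ} (hf : Integrable f) (hk : IsTest k) :
    Integrable (conv f k) :=
  Integrable.integrable_convolution (ContinuousLinearMap.mul ℝ ℝ) hf hk.integrable

lemma integral_conv {f k : Strip n → ℝ} (hf : Integrable f) (hk : IsTest k) :
    ∫ x, conv f k x = (∫ x, f x) * ∫ x, k x :=
  integral_convolution (ContinuousLinearMap.mul ℝ ℝ) hf hk.integrable

lemma memLp_conv {f k : Strip n → ℝ} (hf : MemLp f 2) (hk : IsTest k) (hnn : ∀ x, 0 ≤ k x)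
    (h1 : ∫ x, k x = 1) : MemLp (conv f k) 2 := by
  have hc := (isSmooth_conv hf.locallyIntegrable_two hk).continuous
  rw [memLp_two_iff_integrable_sq hc.aestronglyMeasurable]
  refine (integrable_conv hf.integrable_sq hk).mono' (hc.pow 2).aestronglyMeasurable ?_
  refine Eventually.of_forall fun x => ?_
  rw [Real.norm_of_nonneg (sq_nonneg _)]
  exact conv_sq_le hf hk hnn h1 x

lemma eLpNorm_conv_le {f k : Strip n → ℝ} (hf : MemLp f 2) (hk : IsTest k) (hnn : ∀ x, 0 ≤ k x)
    (h1 : ∫ x, k x = 1) : eLpNorm (conv f k) 2 volume ≤ eLpNorm f 2 volume := by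
  have hm := memLp_conv hf hk hnn h1
  rw [hm.eLpNorm_two_eq, hf.eLpNorm_two_eq]
  refine ENNReal.ofReal_le_ofReal (Real.sqrt_le_sqrt ?_)
  have := integral_conv hf.integrable_sq hk
  rw [h1, mul_one] at this
  rw [← this]
  exact integral_mono hm.integrable_sq (integrable_conv hf.integrable_sq hk)
    (conv_sq_le hf hk hnn h1)

lemma IsMollifier.eventually_conv_sub_le {k : ℕ → Strip n → ℝ} (hk : IsMollifier k)
    {ψ : Strip n → ℝ} (hc : Continuous ψ) (hs : HasCompactSupport ψ) {ε : ℝ} (hε : 0 < ε) :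
    ∀ᶠ N in atTop, ∀ x, |conv ψ (k N) x - ψ x| ≤ ε := by
  have hu : UniformContinuous ψ := hs.uniformContinuous_of_continuous hc
  obtain ⟨δ, hδ, hψ⟩ := Metric.uniformContinuous_iff.1 hu ε hε
  filter_upwards [hk.eventually_mem _ (Metric.ball_mem_nhds 0 hδ)] with N hN x
  have hli : LocallyIntegrable ψ := hc.locallyIntegrable
  have i1 : Integrable fun s => ψ (x - s) * k N s :=
    (hk.isTest N).integrable_mul (hc.comp (continuous_const.sub continuous_id)).locallyIntegrable
  have e1 : conv ψ (k N) x - ψ x = ∫ s, (ψ (x - s) - ψ x) * k N s := by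
    simp_rw [sub_mul]
    rw [integral_sub i1 ((hk.isTest N).integrable.const_mul _), integral_const_mul,
      hk.integral_eq_one, mul_one, conv_eq_integral_sub]
  rw [e1, ← Real.norm_eq_abs]
  calc ‖∫ s, (ψ (x - s) - ψ x) * k N s‖ ≤ ∫ s, ε * k N s := by
        refine norm_integral_le_of_norm_le ((hk.isTest N).integrable.const_mul _)
          (Eventually.of_forall fun s => ?_)
        rw [norm_mul, Real.norm_of_nonneg (hk.nonneg N s)]
        by_cases h0 : k N s = 0
        · simp [h0]
        · refine mul_le_mul_of_nonneg_right ?_ (hk.nonneg N s)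
          rw [← dist_eq_norm]
          refine (hψ ?_).le
          have := hN s h0
          rw [mem_ball_zero_iff] at this
          rw [dist_eq_norm]
          simpa using this
    _ = ε := by rw [integral_const_mul, hk.integral_eq_one, mul_one]

lemma IsMollifier.eventually_conv_eq_zero {k : ℕ → Strip n → ℝ} (hk : IsMollifier k)
    (ψ : Strip n → ℝ) : ∀ᶠ N in atTop, ∀ x ∉ Metric.cthickening 1 (tsupport ψ),
      conv ψ (k N) x = 0 := by
  filter_upwards [hk.eventually_mem _ (Metric.ball_mem_nhds 0 one_pos)] with N hN x hx
  unfold conv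
  refine integral_eq_zero_of_ae (Eventually.of_forall fun s => ?_)
  by_contra h
  simp only [Pi.zero_apply, mul_eq_zero, not_or] at h
  refine hx (Metric.mem_cthickening_of_dist_le x s 1 _ (subset_tsupport _ h.1) ?_)
  have := hN _ h.2
  rw [mem_ball_zero_iff] at this
  rw [dist_eq_norm]
  exact this.le

lemma IsMollifier.l2Tendsto_of_continuous {k : ℕ → Strip n → ℝ} (hk : IsMollifier k)
    {ψ : Strip n → ℝ} (hc : Continuous ψ) (hs : HasCompactSupport ψ) :
    L2Tendsto (fun N => conv ψ (k N)) ψ := by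
  set K := Metric.cthickening 1 (tsupport ψ) with hKdef
  have hK : IsCompact K := hs.isCompact.cthickening
  have hψK : ∀ x ∉ K, ψ x = 0 := fun x hx =>
    image_eq_zero_of_notMem_tsupport fun h => hx (Metric.self_subset_cthickening _ h)
  have hvol : volume K ≠ ⊤ := hK.measure_lt_top.ne
  refine ENNReal.tendsto_nhds_zero.2 fun ε hε => ?_
  obtain ⟨η, hη, hηε⟩ : ∃ η : ℝ, 0 < η ∧
      ENNReal.ofReal η * volume K ^ (1 / (2 : ℝ≥0∞).toReal) ≤ ε := by
    have hv : volume K ^ (1 / (2 : ℝ≥0∞).toReal) ≠ ⊤ :=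
      ENNReal.rpow_ne_top_of_nonneg (by simp) hvol
    have ht : Tendsto (fun η : ℝ => ENNReal.ofReal η * volume K ^ (1 / (2 : ℝ≥0∞).toReal))
        (𝓝[>] 0) (𝓝 0) := by
      have h1 : Tendsto (fun η : ℝ => ENNReal.ofReal η) (𝓝[>] 0) (𝓝 0) := by
        have := ENNReal.tendsto_ofReal (tendsto_id (α := ℝ) (x := 𝓝 0))
        rw [ENNReal.ofReal_zero] at this
        exact this.mono_left nhdsWithin_le_nhds
      have h2 := ENNReal.Tendsto.mul_const h1 (Or.inr hv)
      rwa [zero_mul] at h2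
    have h3 := (ENNReal.tendsto_nhds_zero.1 ht ε hε).and self_mem_nhdsWithin
    obtain ⟨η, h4, h5⟩ := h3.exists
    exact ⟨η, h5, h4⟩
  filter_upwards [hk.eventually_conv_sub_le hc hs hη, hk.eventually_conv_eq_zero ψ] with N h1 h2
  refine le_trans ?_ hηε
  have hle : eLpNorm (conv ψ (k N) - ψ) 2 volume
      ≤ eLpNorm (K.indicator fun _ => η) 2 (volume : Measure (Strip n)) := by
    refine eLpNorm_mono fun x => ?_
    by_cases hx : x ∈ K
    · rw [Set.indicator_of_mem hx, Pi.sub_apply, Real.norm_eq_abs, Real.norm_of_nonneg hη.le]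
      exact h1 x
    · rw [Set.indicator_of_notMem hx, Pi.sub_apply, h2 x hx, hψK x hx]
      simp
  refine hle.trans (le_of_eq ?_)
  rw [eLpNorm_indicator_const hK.measurableSet (by simp) (by simp)]
  congr 1
  rw [Real.enorm_eq_ofReal hη.le]

/-- Convolution with a mollifier contracts L², so convergence passes from the dense class of
continuous compactly supported functions to all of L² by an ε/3 argument. -/
lemma IsMollifier.l2Tendsto {k : ℕ → Strip n → ℝ} (hk : IsMollifier k) {f : Strip n → ℝ}
    (hf : MemLp f 2) : L2Tendsto (fun N => conv f (k N)) f := by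
  refine ENNReal.tendsto_nhds_zero.2 fun ε hε => ?_
  have hε3 : ε / 3 ≠ 0 := by simp [hε.ne']
  obtain ⟨ψ, hs, hle, hc, hψ⟩ := hf.exists_hasCompactSupport_eLpNorm_sub_le (by simp) hε3
  have hd : MemLp (f - ψ) 2 := hf.sub hψ
  filter_upwards [ENNReal.tendsto_nhds_zero.1 (hk.l2Tendsto_of_continuous hc hs) _
    (pos_iff_ne_zero.2 hε3)] with N hN
  have hkN := hk.isTest N
  have e : conv f (k N) - f = conv (f - ψ) (k N) + (conv ψ (k N) - ψ) + (ψ - f) := by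
    have h1 := conv_add (f := f - ψ) (g := ψ) hd.locallyIntegrable_two
      hψ.locallyIntegrable_two hkN
    have h2 : (fun x => (f - ψ) x + ψ x) = f := by ext x; simp
    rw [h2] at h1
    rw [h1]
    ext x
    simp only [Pi.sub_apply, Pi.add_apply]
    ring
  have m1 := memLp_conv hd hkN (hk.nonneg N) (hk.integral_eq_one N)
  have m2 := memLp_conv hψ hkN (hk.nonneg N) (hk.integral_eq_one N)
  rw [e]
  calc _ ≤ eLpNorm (conv (f - ψ) (k N)) 2 volume + eLpNorm (conv ψ (k N) - ψ) 2 volume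
        + eLpNorm (ψ - f) 2 volume :=
        (eLpNorm_add_le (m1.add (m2.sub hψ)).1 (hψ.sub hf).1 (by simp)).trans
          (add_le_add_left (eLpNorm_add_le m1.1 (m2.sub hψ).1 (by simp)) _)
    _ ≤ ε / 3 + ε / 3 + ε / 3 := by
        refine add_le_add (add_le_add ?_ hN) ?_
        · exact (eLpNorm_conv_le hd hkN (hk.nonneg N) (hk.integral_eq_one N)).trans hle
        · rw [eLpNorm_sub_comm]; exact hle
    _ = ε := ENNReal.add_thirds ε

end Strip

namespace Strip

variable {n : ℕ}

/-! ### Uniqueness of weak derivatives -/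

/-- Mollifying ψ gives test functions that converge to it uniformly, with all supports in one
compact set on which d is integrable. -/
lemma integral_mul_continuous_eq_zero {d : Strip n → ℝ} (hd : LocallyIntegrable d)
    (h : ∀ φ, IsTest φ → ∫ x, d x * φ x = 0) {ψ : Strip n → ℝ} (hc : Continuous ψ)
    (hs : HasCompactSupport ψ) : ∫ x, d x * ψ x = 0 := by
  obtain ⟨k, hk⟩ := exists_isMollifier (n := n)
  set K := Metric.cthickening 1 (tsupport ψ) with hKdef
  have hK : IsCompact K := hs.isCompact.cthickening
  have hψK : ∀ x ∉ K, ψ x = 0 := fun x hx =>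
    image_eq_zero_of_notMem_tsupport fun h => hx (Metric.self_subset_cthickening _ h)
  have hi : Integrable fun x => d x * ψ x := by
    simpa [mul_comm] using hd.integrable_smul_left_of_hasCompactSupport hc hs
  have hdK := (hd.integrableOn_isCompact hK).norm
  have key : ∀ ε > 0, |∫ x, d x * ψ x| ≤ ε * ∫ x in K, ‖d x‖ := by
    intro ε hε
    obtain ⟨N, h1, h2⟩ := ((hk.eventually_conv_sub_le hc hs hε).and
      (hk.eventually_conv_eq_zero ψ)).exists
    have ht : IsTest (conv ψ (k N)) :=
      ⟨isSmooth_conv hc.locallyIntegrable (hk.isTest N), HasCompactSupport.intro hK h2⟩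
    have e : ∫ x, d x * ψ x = ∫ x, d x * (ψ x - conv ψ (k N) x) := by
      simp_rw [mul_sub]
      rw [integral_sub hi (ht.integrable_mul hd), h _ ht, sub_zero]
    rw [e, ← Real.norm_eq_abs, ← integral_const_mul, ← integral_indicator hK.measurableSet]
    refine norm_integral_le_of_norm_le
      ((integrable_indicator_iff hK.measurableSet).2 (hdK.const_mul ε))
      (Eventually.of_forall fun x => ?_)
    by_cases hx : x ∈ K
    · rw [Set.indicator_of_mem hx, norm_mul, mul_comm, Real.norm_eq_abs (ψ x - _), abs_sub_comm]
      exact mul_le_mul_of_nonneg_right (h1 x) (norm_nonneg _)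
    · rw [Set.indicator_of_notMem hx, h2 x hx, hψK x hx]
      simp
  have hz : |∫ x, d x * ψ x| ≤ 0 := by
    have ht : Tendsto (fun ε : ℝ => ε * ∫ x in K, ‖d x‖) (𝓝[>] 0) (𝓝 0) := by
      have : Tendsto (fun ε : ℝ => ε * ∫ x in K, ‖d x‖) (𝓝 0) (𝓝 (0 * ∫ x in K, ‖d x‖)) :=
        tendsto_id.mul_const _
      rw [zero_mul] at this
      exact this.mono_left nhdsWithin_le_nhds
    exact ge_of_tendsto ht (eventually_nhdsWithin_of_forall fun ε hε => key ε hε)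
  exact abs_nonpos_iff.1 hz

/-- Continuous thickened indicators decrease to the indicator of a compact set, so d has zero
integral over every compact set. -/
lemma ae_eq_zero_of_integral_test {d : Strip n → ℝ} (hd : LocallyIntegrable d)
    (h : ∀ φ, IsTest φ → ∫ x, d x * φ x = 0) : d =ᵐ[volume] 0 := by
  refine ae_eq_zero_of_forall_setIntegral_isCompact_eq_zero' hd fun s hs => ?_
  have hpos : ∀ m : ℕ, (0 : ℝ) < 1 / (m + 1) := fun m => by positivity
  let ψ : ℕ → Strip n → ℝ := fun m x => thickenedIndicator (hpos m) s x
  have hψc : ∀ m, Continuous (ψ m) := fun m =>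
    NNReal.continuous_coe.comp (thickenedIndicator (hpos m) s).continuous
  set K := Metric.cthickening 1 s with hKdef
  have hK : IsCompact K := hs.cthickening
  have hψK : ∀ m, ∀ x ∉ K, ψ m x = 0 := by
    intro m x hx
    have hx' : x ∉ Metric.thickening (1 / ((m : ℝ) + 1)) s := fun h' => hx <|
      Metric.thickening_subset_cthickening_of_le (by
        rw [div_le_one (by positivity)]; linarith [(Nat.cast_nonneg m : (0 : ℝ) ≤ m)]) s h'
    exact congrArg NNReal.toReal (thickenedIndicator_zero (hpos m) s hx')
  have hψ1 : ∀ m x, ‖ψ m x‖ ≤ 1 := fun m x => by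
    rw [Real.norm_of_nonneg (NNReal.coe_nonneg _)]
    exact_mod_cast thickenedIndicator_le_one (hpos m) s x
  have h0 : ∀ m, ∫ x, d x * ψ m x = 0 := fun m =>
    integral_mul_continuous_eq_zero hd h (hψc m) (HasCompactSupport.intro hK (hψK m))
  have hlim : Tendsto (fun m => ∫ x, d x * ψ m x) atTop (𝓝 (∫ x, s.indicator d x)) := by
    refine tendsto_integral_of_dominated_convergence (K.indicator fun x => ‖d x‖) (fun m => ?_)
      ((integrable_indicator_iff hK.measurableSet).2 (hd.integrableOn_isCompact hK).norm)
      (fun m => Eventually.of_forall fun x => ?_) (Eventually.of_forall fun x => ?_)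
    · exact hd.aestronglyMeasurable.mul (hψc m).aestronglyMeasurable
    · by_cases hx : x ∈ K
      · rw [Set.indicator_of_mem hx, norm_mul]
        exact mul_le_of_le_one_right (norm_nonneg _) (hψ1 m x)
      · rw [Set.indicator_of_notMem hx, hψK m x hx]
        simp
    · have ht := thickenedIndicator_tendsto_indicator_closure hpos
        (tendsto_one_div_add_atTop_nhds_zero_nat (𝕜 := ℝ)) s
      rw [hs.isClosed.closure_eq] at ht
      have h1 := (NNReal.continuous_coe.tendsto _).comp ((tendsto_pi_nhds.1 ht) x)
      have h2 := h1.const_mul (d x)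
      have h3 : d x * ((s.indicator (fun _ => (1 : ℝ≥0)) x : ℝ≥0) : ℝ) = s.indicator d x := by
        by_cases hx : x ∈ s <;> simp [hx]
      rw [← h3]
      exact h2
  rw [integral_indicator hs.measurableSet] at hlim
  simp_rw [h0] at hlim
  exact (tendsto_nhds_unique hlim tendsto_const_nhds)

lemma HasWeakDeriv.unique {i : Fin (n + 1)} {f g g' : Strip n → ℝ} (h : HasWeakDeriv i f g)
    (h' : HasWeakDeriv i f g') : g =ᵐ[volume] g' := by
  have h0 : (fun x => g x - g' x) =ᵐ[volume] 0 := by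
    refine ae_eq_zero_of_integral_test (h.locInt_deriv.sub h'.locInt_deriv) fun φ hφ => ?_
    simp_rw [sub_mul]
    rw [integral_sub (hφ.integrable_mul h.locInt_deriv) (hφ.integrable_mul h'.locInt_deriv)]
    linarith [h.byParts φ hφ, h'.byParts φ hφ]
  filter_upwards [h0] with x hx
  simpa [sub_eq_zero] using hx

lemma HasWeakDeriv.weakDiff {i : Fin (n + 1)} {f g : Strip n → ℝ} (h : HasWeakDeriv i f g) :
    WeakDiff i f := ⟨g, h⟩

lemma WeakDiff.hasWeakDeriv {i : Fin (n + 1)} {f : Strip n → ℝ} (h : WeakDiff i f) :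
    HasWeakDeriv i f (weakDeriv i f) := by
  unfold weakDeriv
  rw [dif_pos h]
  exact h.choose_spec

lemma HasWeakDeriv.weakDeriv_ae {i : Fin (n + 1)} {f g : Strip n → ℝ} (h : HasWeakDeriv i f g) :
    weakDeriv i f =ᵐ[volume] g := h.weakDiff.hasWeakDeriv.unique h

/-! ### Sobolev functions -/

lemma MemSobolev.memLp {k : ℕ} {f : Strip n → ℝ} (h : MemSobolev k f) : MemLp f 2 := by
  cases k with
  | zero => exact h
  | succ k => exact h.1

lemma MemSobolev.congr {k : ℕ} {f f' : Strip n → ℝ} (h : MemSobolev k f)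
    (hf : f =ᵐ[volume] f') : MemSobolev k f' := by
  cases k with
  | zero => exact (memLp_congr_ae hf).1 h
  | succ k =>
    refine ⟨(memLp_congr_ae hf).1 h.1, fun i => ?_⟩
    obtain ⟨g, hg, hgk⟩ := h.2 i
    exact ⟨g, hg.congr hf (ae_eq_refl _), hgk⟩

lemma MemSobolev.hasWeakDeriv {k : ℕ} {f : Strip n → ℝ} (h : MemSobolev (k + 1) f)
    (i : Fin (n + 1)) : HasWeakDeriv i f (weakDeriv i f) := by
  obtain ⟨g, hg, _⟩ := h.2 i
  exact hg.weakDiff.hasWeakDeriv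

lemma MemSobolev.weakDeriv {k : ℕ} {f : Strip n → ℝ} (h : MemSobolev (k + 1) f)
    (i : Fin (n + 1)) : MemSobolev k (weakDeriv i f) := by
  obtain ⟨g, hg, hgk⟩ := h.2 i
  exact hgk.congr hg.weakDeriv_ae.symm

/-- `f ∈ H¹(S)` with weak gradient `g`. -/
structure HasGrad (f : Strip n → ℝ) (g : Fin (n + 1) → Strip n → ℝ) : Prop where
  memLp : MemLp f 2
  grad_memLp : ∀ i, MemLp (g i) 2
  weak : ∀ i, HasWeakDeriv i f (g i)

lemma MemSobolev.hasGrad {k : ℕ} {f : Strip n → ℝ} (h : MemSobolev (k + 1) f) :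
    HasGrad f (fun i => Strip.weakDeriv i f) where
  memLp := h.1
  grad_memLp i := (h.weakDeriv i).memLp
  weak := h.hasWeakDeriv

lemma MemSobolev.weakDeriv_comm {k : ℕ} {f : Strip n → ℝ} (h : MemSobolev (k + 2) f)
    (i j : Fin (n + 1)) :
    Strip.weakDeriv i (Strip.weakDeriv j f) =ᵐ[volume] Strip.weakDeriv j (Strip.weakDeriv i f) :=
  ((h.hasWeakDeriv i).comm (h.hasWeakDeriv j) ((h.weakDeriv i).hasWeakDeriv j)).weakDeriv_ae

/-! ### Density of test functions -/

lemma exists_cutoff : ∃ (b : ℝ → ℝ) (M : ℝ), ContDiff ℝ ∞ b ∧ HasCompactSupport b ∧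
    (∀ t, |t| ≤ 1 → b t = 1) ∧ (∀ t, |b t| ≤ 1) ∧ ∀ t, |deriv b t| ≤ M := by
  let b : ContDiffBump (0 : ℝ) := ⟨1, 2, by norm_num, by norm_num⟩
  obtain ⟨M, hM⟩ := b.hasCompactSupport.deriv.exists_bound_of_continuous
    (b.contDiff.continuous_deriv (n := ∞) (by simp))
  refine ⟨b, M, b.contDiff, b.hasCompactSupport, fun t ht => ?_, fun t => ?_, hM⟩
  · exact b.one_of_mem_closedBall (by simpa [b] using ht)
  · rw [abs_of_nonneg b.nonneg]; exact b.le_one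

lemma isTest_cutoff {b : ℝ → ℝ} (hb : ContDiff ℝ ∞ b) (hs : HasCompactSupport b) (N : ℕ) :
    IsTest (fun x : Strip n => b (x.2 / (N + 1))) where
  smooth := isSmooth_comp_snd (η := fun z => b (z / (N + 1)))
    (hb.comp (contDiff_id.div_const _))
  compact := by
    have h1 : IsCompact ((Set.univ : Set (Fin n → UnitAddCircle)) ×ˢ
        ((fun z : ℝ => ((N : ℝ) + 1) * z) '' tsupport b)) :=
      isCompact_univ.prod (hs.isCompact.image (by fun_prop))
    refine HasCompactSupport.intro h1 fun x hx => ?_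
    by_contra hne
    refine hx ⟨trivial, x.2 / (N + 1), subset_tsupport _ hne, ?_⟩
    have : (N : ℝ) + 1 ≠ 0 := by positivity
    field_simp

lemma abs_pderiv_cutoff_le {b : ℝ → ℝ} (hb : ContDiff ℝ ∞ b) {M : ℝ} (hM : ∀ t, |deriv b t| ≤ M)
    (N : ℕ) (i : Fin (n + 1)) (x : Strip n) :
    |pderiv i (fun x : Strip n => b (x.2 / (N + 1))) x| ≤ M * (1 / (N + 1)) := by
  have hM0 : 0 ≤ M := (abs_nonneg _).trans (hM 0)
  induction i using Fin.lastCases with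
  | last =>
    rw [pderiv_comp_snd_last (η := fun z => b (z / (N + 1)))]
    have h1 : HasDerivAt (fun z : ℝ => b (z / (N + 1))) (deriv b (x.2 / (N + 1)) * (1 / (N + 1)))
        x.2 := by
      have hd : HasDerivAt b (deriv b (x.2 / (N + 1))) (x.2 / (N + 1)) :=
        (hb.differentiable (by simp)).differentiableAt.hasDerivAt
      exact HasDerivAt.comp (h := fun z : ℝ => z / (N + 1)) x.2 hd
        ((hasDerivAt_id x.2).div_const _)
    rw [h1.deriv, abs_mul, abs_of_nonneg (by positivity : (0 : ℝ) ≤ 1 / (N + 1))]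
    exact mul_le_mul_of_nonneg_right (hM _) (by positivity)
  | cast i =>
    rw [pderiv_comp_snd_castSucc (η := fun z => b (z / (N + 1)))]
    simp only [abs_zero]
    positivity

lemma l2Tendsto_cutoff_mul {b : ℝ → ℝ} (hb : ContDiff ℝ ∞ b) (h1 : ∀ t, |t| ≤ 1 → b t = 1)
    (hb1 : ∀ t, |b t| ≤ 1) {f : Strip n → ℝ} (hf : MemLp f 2) {φ : ℕ → Strip n → ℝ}
    (hφ : ∀ N, MemLp (φ N) 2) (h : L2Tendsto φ f) :
    L2Tendsto (fun N x => b (x.2 / (N + 1)) * φ N x) f := by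
  have hbc : ∀ N : ℕ, Continuous fun x : Strip n => b (x.2 / (N + 1)) := fun N =>
    hb.continuous.comp (by fun_prop)
  have hbm : ∀ (N : ℕ) {a : Strip n → ℝ}, MemLp a 2 → MemLp (fun x => b (x.2 / (N + 1)) * a x) 2 :=
    fun N a ha => ha.of_le ((hbc N).aestronglyMeasurable.mul ha.1) (Eventually.of_forall fun x => by
      rw [norm_mul]; exact mul_le_of_le_one_left (norm_nonneg _) (hb1 _))
  have t1 : L2Tendsto (fun (N : ℕ) x => b (x.2 / (N + 1)) * (φ N x - f x)) (fun x => 0 * 0) := by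
    refine L2Tendsto.bdd_mul (φ := fun N x => φ N x - f x) (f := fun _ => 0)
      (η := fun (N : ℕ) x => b (x.2 / (N + 1))) (ξ := fun _ => 0) (M := 1) ?_
      (fun N x => by ring) fun N x => hb1 _
    refine (show Tendsto _ _ _ from h).congr fun N => ?_
    congr 1
    ext x
    simp
  have t2 : L2Tendsto (fun (N : ℕ) x => b (x.2 / (N + 1)) * f x) f := by
    have hint : Tendsto (fun N : ℕ => ∫ x, (b (x.2 / (N + 1)) * f x - f x) ^ 2) atTop
        (𝓝 (∫ x : Strip n, 0)) := by
      -- The factor 4 bounds (b - 1)², because |b| ≤ 1. Pointwise the integrand is eventually zero,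
      -- once N ≥ |x.2|.
      refine tendsto_integral_of_dominated_convergence (fun x => 4 * f x ^ 2) (fun N => ?_)
        (hf.integrable_sq.const_mul 4) (fun N => Eventually.of_forall fun x => ?_)
        (Eventually.of_forall fun x => ?_)
      · exact (((hbm N hf).sub hf).1.pow 2)
      · rw [Real.norm_of_nonneg (sq_nonneg _)]
        have e : (b (x.2 / (N + 1)) * f x - f x) ^ 2 = (b (x.2 / (N + 1)) - 1) ^ 2 * f x ^ 2 := by
          ring
        rw [e]
        refine mul_le_mul_of_nonneg_right ?_ (sq_nonneg _)
        have := abs_le.1 (hb1 (x.2 / (N + 1)))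
        nlinarith
      · refine tendsto_const_nhds.congr' ?_
        obtain ⟨N0, hN0⟩ := exists_nat_ge |x.2|
        filter_upwards [eventually_ge_atTop N0] with N hN
        have hN' : (N0 : ℝ) ≤ N := by exact_mod_cast hN
        rw [h1 _ (by
          rw [abs_div, abs_of_pos (by positivity : (0 : ℝ) < N + 1), div_le_one (by positivity)]
          linarith)]
        ring
    rw [integral_zero] at hint
    have e : ∀ N : ℕ, eLpNorm ((fun x => b (x.2 / (N + 1)) * f x) - f) 2 volume
        = ENNReal.ofReal √(∫ x, (b (x.2 / (N + 1)) * f x - f x) ^ 2) := fun N =>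
      ((hbm N hf).sub hf).eLpNorm_two_eq
    unfold L2Tendsto
    simp_rw [e]
    have h2 := (Real.continuous_sqrt.tendsto 0).comp hint
    rw [Real.sqrt_zero] at h2
    have h3 := ENNReal.tendsto_ofReal h2
    rwa [ENNReal.ofReal_zero] at h3
  have t3 := t1.add t2 (fun N => hbm N ((hφ N).sub hf)) (by simp) (fun N => hbm N hf) hf
  refine (show Tendsto _ _ _ from t3).congr fun N => ?_
  congr 1
  ext x
  simp only [Pi.sub_apply]
  ring

/-- Test functions are dense in `H¹(S)`. -/
lemma HasGrad.exists_test {f : Strip n → ℝ} {g : Fin (n + 1) → Strip n → ℝ} (h : HasGrad f g) :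
    ∃ φ : ℕ → Strip n → ℝ, (∀ N, IsTest (φ N)) ∧ L2Tendsto φ f ∧
      ∀ i, L2Tendsto (fun N => pderiv i (φ N)) (g i) := by
  obtain ⟨k, hk⟩ := exists_isMollifier (n := n)
  obtain ⟨b, M, hb, hs, h1, hb1, hM⟩ := exists_cutoff
  have hM0 : 0 ≤ M := (abs_nonneg _).trans (hM 0)
  have hli := h.memLp.locallyIntegrable_two
  have hmem : ∀ {a : Strip n → ℝ}, MemLp a 2 → ∀ N, MemLp (conv a (k N)) 2 := fun ha N =>
    memLp_conv ha (hk.isTest N) (hk.nonneg N) (hk.integral_eq_one N)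
  have hsm := fun N => isSmooth_conv hli (hk.isTest N)
  have hcut := fun N => isTest_cutoff (n := n) hb hs N
  have htest : ∀ N : ℕ, IsTest fun x : Strip n => b (x.2 / (N + 1)) * conv f (k N) x := fun N => by
    simpa [mul_comm] using (hsm N).mul_isTest (hcut N)
  refine ⟨fun N x => b (x.2 / (N + 1)) * conv f (k N) x, htest,
    l2Tendsto_cutoff_mul hb h1 hb1 h.memLp (hmem h.memLp) (hk.l2Tendsto h.memLp), fun i => ?_⟩
  have e : ∀ N : ℕ, pderiv i (fun x : Strip n => b (x.2 / (N + 1)) * conv f (k N) x)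
      = fun x => pderiv i (fun x : Strip n => b (x.2 / (N + 1))) x * conv f (k N) x
        + b (x.2 / (N + 1)) * conv (g i) (k N) x := fun N => by
    ext x
    rw [(hcut N).isSmooth.pderiv_mul (hsm N), pderiv_conv hli (hk.isTest N),
      (h.weak i).conv_pderiv (hk.isTest N)]
  simp_rw [e]
  have t2 := l2Tendsto_cutoff_mul hb h1 hb1 (h.grad_memLp i) (hmem (h.grad_memLp i))
    (hk.l2Tendsto (h.grad_memLp i))
  have m1 : ∀ N : ℕ, MemLp (fun x => pderiv i (fun x : Strip n => b (x.2 / (N + 1))) x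
      * conv f (k N) x) 2 := fun N => by
    have := (hsm N).mul_isTest ((hcut N).pderiv i)
    simpa [mul_comm] using this.memLp 2
  have m2 : ∀ N : ℕ, MemLp (fun x : Strip n => b (x.2 / (N + 1)) * conv (g i) (k N) x) 2 :=
    fun N => by
      have := (isSmooth_conv (h.grad_memLp i).locallyIntegrable_two (hk.isTest N)).mul_isTest (hcut N)
      simpa [mul_comm] using this.memLp 2
  -- The term in which the derivative falls on the cutoff is O(1/(N + 1)) times a function of L²
  -- norm at most that of f.
  have t1 : L2Tendsto (fun (N : ℕ) x => pderiv i (fun x : Strip n => b (x.2 / (N + 1))) x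
      * conv f (k N) x) (fun _ => 0) := by
    have l1 : Tendsto (fun N : ℕ => ENNReal.ofReal (M * (1 / (N + 1))) * eLpNorm f 2 volume) atTop
        (𝓝 0) := by
      have l2 := (tendsto_one_div_add_atTop_nhds_zero_nat (𝕜 := ℝ)).const_mul M
      rw [mul_zero] at l2
      have l3 := ENNReal.Tendsto.mul_const (ENNReal.tendsto_ofReal l2)
        (Or.inr h.memLp.eLpNorm_lt_top.ne)
      simpa using l3
    refine tendsto_of_tendsto_of_tendsto_of_le_of_le tendsto_const_nhds l1 (fun _ => zero_le)
      fun N => ?_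
    refine le_trans ?_ (mul_le_mul_right (eLpNorm_conv_le h.memLp (hk.isTest N) (hk.nonneg N)
      (hk.integral_eq_one N)) _)
    refine eLpNorm_le_mul_eLpNorm_of_ae_le_mul (Eventually.of_forall fun x => ?_) _
    simp only [Pi.sub_apply, sub_zero, norm_mul]
    exact mul_le_mul_of_nonneg_right (abs_pderiv_cutoff_le hb hM N i x) (norm_nonneg _)
  have t3 := t1.add t2 m1 (by simp) m2 (h.grad_memLp i)
  simpa using t3

/-! ### Integration by parts and the product rule -/

lemma memLp_bdd_mul {η a : Strip n → ℝ} {M : ℝ} (ha : MemLp a 2)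
    (hη : AEStronglyMeasurable η volume) (hM : ∀ᵐ x, |η x| ≤ M) :
    MemLp (fun x => η x * a x) 2 := by
  refine ha.of_le_mul (c := M) (hη.mul ha.1) ?_
  filter_upwards [hM] with x hx
  rw [norm_mul]
  exact mul_le_mul_of_nonneg_right hx (norm_nonneg _)

lemma IsTest.exists_bound {φ : Strip n → ℝ} (h : IsTest φ) : ∃ M, ∀ x, |φ x| ≤ M :=
  h.compact.exists_bound_of_continuous h.continuous

/-- Only one factor needs approximation: for a test function in place of a, this is the definition
of the weak derivative of b. -/
lemma HasGrad.integral_mul_eq {a b : Strip n → ℝ} {ga gb : Fin (n + 1) → Strip n → ℝ}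
    (ha : HasGrad a ga) (hb : HasGrad b gb) (i : Fin (n + 1)) :
    ∫ x, a x * gb i x = - ∫ x, ga i x * b x := by
  obtain ⟨φ, hφ, h0, h1⟩ := ha.exists_test
  have t1 := h0.integral_mul (L2Tendsto.const (gb i)) (fun N => (hφ N).memLp 2) ha.memLp
    (fun _ => hb.grad_memLp i) (hb.grad_memLp i)
  have t2 := (h1 i).integral_mul (L2Tendsto.const b) (fun N => ((hφ N).pderiv i).memLp 2)
    (ha.grad_memLp i) (fun _ => hb.memLp) hb.memLp
  refine tendsto_nhds_unique t1 (t2.neg.congr fun N => ?_)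
  have := (hb.weak i).byParts _ (hφ N)
  simp_rw [mul_comm (b _), mul_comm (gb i _)] at this
  linarith

/-- For a test function in place of a, both sides equal minus the integral of b against its mixed
second derivative. No second derivative of a or b is needed in the limit. -/
lemma HasGrad.integral_grad_mul_grad {a b : Strip n → ℝ} {ga gb : Fin (n + 1) → Strip n → ℝ}
    (ha : HasGrad a ga) (hb : HasGrad b gb) (i j : Fin (n + 1)) :
    ∫ x, ga i x * gb j x = ∫ x, ga j x * gb i x := by
  obtain ⟨φ, hφ, h0, h1⟩ := ha.exists_test
  have t := fun i j => (h1 i).integral_mul (L2Tendsto.const (gb j))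
    (fun N => ((hφ N).pderiv i).memLp 2) (ha.grad_memLp i) (fun _ => hb.grad_memLp j)
    (hb.grad_memLp j)
  refine tendsto_nhds_unique (t i j) ((t j i).congr fun N => ?_)
  have e1 := (hb.weak i).byParts _ ((hφ N).pderiv j)
  have e2 := (hb.weak j).byParts _ ((hφ N).pderiv i)
  simp_rw [mul_comm (gb _ _)] at e1 e2
  simp_rw [(hφ N).isSmooth.pderiv_comm i j] at e1
  linarith

/-- No boundedness is needed, as the product and its derivative are only claimed to be locally
integrable. After a is replaced by test functions, the limits pair L² convergence with the fixed L²
functions ψ b, ∂_i ψ b and ψ ∂_i b. -/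
lemma HasGrad.hasWeakDeriv_mul {a b : Strip n → ℝ} {ga gb : Fin (n + 1) → Strip n → ℝ}
    (ha : HasGrad a ga) (hb : HasGrad b gb) (i : Fin (n + 1)) :
    HasWeakDeriv i (fun x => a x * b x) (fun x => ga i x * b x + a x * gb i x) where
  locInt := (ha.memLp.integrable_mul hb.memLp).locallyIntegrable
  locInt_deriv := (((ha.grad_memLp i).integrable_mul hb.memLp).add
    (ha.memLp.integrable_mul (hb.grad_memLp i))).locallyIntegrable
  byParts ψ hψ := by
    obtain ⟨φ, hφ, h0, h1⟩ := ha.exists_test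
    have bdd : ∀ {c ψ : Strip n → ℝ}, MemLp c 2 → IsTest ψ → MemLp (fun x => ψ x * c x) 2 := by
      intro c ψ hc hψ
      obtain ⟨M, hM⟩ := hψ.exists_bound
      exact memLp_bdd_mul hc hψ.continuous.aestronglyMeasurable (Eventually.of_forall hM)
    have mb1 := bdd hb.memLp (hψ.pderiv i)
    have mb2 := bdd hb.memLp hψ
    have mb3 := bdd (hb.grad_memLp i) hψ
    have t1 := h0.integral_mul (L2Tendsto.const _) (fun N => (hφ N).memLp 2) ha.memLp
      (fun _ => mb1) mb1
    have t2 := (h1 i).integral_mul (L2Tendsto.const _) (fun N => ((hφ N).pderiv i).memLp 2)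
      (ha.grad_memLp i) (fun _ => mb2) mb2
    have t3 := h0.integral_mul (L2Tendsto.const _) (fun N => (hφ N).memLp 2) ha.memLp
      (fun _ => mb3) mb3
    have e : ∀ N, ∫ x, φ N x * (pderiv i ψ x * b x)
        = - ((∫ x, pderiv i (φ N) x * (ψ x * b x)) + ∫ x, φ N x * (ψ x * gb i x)) := by
      intro N
      rw [← integral_add ((((hφ N).pderiv i).memLp 2).integrable_mul_two mb2)
        (((hφ N).memLp 2).integrable_mul_two mb3)]
      have := ((hb.weak i).isSmooth_mul (hφ N).isSmooth).byParts ψ hψ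
      convert this using 2
      · ext x; ring
      · congr 1; ext x; ring
    have hu := tendsto_nhds_unique t1 (((t2.add t3).neg).congr fun N => (e N).symm)
    rw [← integral_add ((ha.grad_memLp i).integrable_mul_two mb2)
      (ha.memLp.integrable_mul_two mb3)] at hu
    convert hu using 2
    · ext x; ring
    · congr 1; ext x; ring

end Strip

/-! ### The kink profile on the line -/

/-- The one-dimensional kink `tanh ((z - c) / √2)`. -/
def kinkV (c z : ℝ) : ℝ := Real.tanh ((z - c) / √2)

/-- The derivative of the kink. -/
def kinkW (c z : ℝ) : ℝ := (1 - kinkV c z ^ 2) / √2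

lemma sqrt_two_mul_kinkW (c z : ℝ) : √2 * kinkW c z = 1 - kinkV c z ^ 2 := by
  unfold kinkW; field_simp

lemma Real.hasDerivAt_tanh (x : ℝ) : HasDerivAt Real.tanh (1 - Real.tanh x ^ 2) x := by
  have h := (Real.hasDerivAt_sinh x).div (Real.hasDerivAt_cosh x) (Real.cosh_pos x).ne'
  have e : Real.tanh = Real.sinh / Real.cosh := by
    ext x; simp [Real.tanh_eq_sinh_div_cosh]
  rw [e]
  refine HasDerivAt.congr_deriv h (Eq.symm ?_)
  have := (Real.cosh_pos x).ne'
  simp only [Pi.div_apply]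
  field_simp

lemma contDiff_tanh : ContDiff ℝ ∞ Real.tanh := by
  have e : Real.tanh = fun x => Real.sinh x / Real.cosh x := by
    ext x; simp [Real.tanh_eq_sinh_div_cosh]
  rw [e]
  exact Real.contDiff_sinh.div Real.contDiff_cosh fun x => (Real.cosh_pos x).ne'

lemma hasDerivAt_kinkV (c z : ℝ) : HasDerivAt (kinkV c) (kinkW c z) z := by
  have h1 : HasDerivAt (fun z : ℝ => (z - c) / √2) (1 / √2) z :=
    ((hasDerivAt_id z).sub_const c).div_const _
  have h2 := (Real.hasDerivAt_tanh ((z - c) / √2)).comp z h1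
  refine HasDerivAt.congr_deriv h2 (Eq.symm ?_)
  simp only [kinkW, kinkV]
  ring

lemma contDiff_kinkV (c : ℝ) : ContDiff ℝ ∞ (kinkV c) :=
  contDiff_tanh.comp ((contDiff_id.sub contDiff_const).div_const _)

lemma contDiff_kinkW (c : ℝ) : ContDiff ℝ ∞ (kinkW c) :=
  (contDiff_const.sub ((contDiff_kinkV c).pow 2)).div_const _

lemma continuous_kinkV (c : ℝ) : Continuous (kinkV c) := (contDiff_kinkV c).continuous

lemma continuous_kinkW (c : ℝ) : Continuous (kinkW c) := (contDiff_kinkW c).continuous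

lemma hasDerivAt_kinkW (c z : ℝ) :
    HasDerivAt (kinkW c) (-(√2 * kinkV c z * kinkW c z)) z := by
  have h := (((hasDerivAt_kinkV c z).pow 2).const_sub 1).div_const √2
  refine HasDerivAt.congr_deriv h (Eq.symm ?_)
  have h2 : √2 ^ 2 = 2 := Real.sq_sqrt (by norm_num)
  field_simp
  rw [h2]
  push_cast
  ring

lemma kinkV_sq_lt_one (c z : ℝ) : kinkV c z ^ 2 < 1 := by
  unfold kinkV
  have := Real.cosh_sq ((z - c) / √2)
  rw [Real.tanh_eq_sinh_div_cosh, div_pow, div_lt_one (by positivity [Real.cosh_pos ((z - c) / √2)])]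
  linarith

lemma abs_kinkV_lt_one (c z : ℝ) : |kinkV c z| < 1 := by
  have := kinkV_sq_lt_one c z
  rw [← one_pow 2] at this
  exact abs_lt_of_sq_lt_sq this zero_le_one

lemma abs_kinkV_le_one (c z : ℝ) : |kinkV c z| ≤ 1 := (abs_kinkV_lt_one c z).le

lemma kinkW_pos (c z : ℝ) : 0 < kinkW c z :=
  div_pos (by linarith [kinkV_sq_lt_one c z]) (by positivity)

lemma kinkW_le_one (c z : ℝ) : kinkW c z ≤ 1 := by
  unfold kinkW
  rw [div_le_one (by positivity)]
  have : (1 : ℝ) ≤ √2 := Real.one_le_sqrt.2 (by norm_num)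
  nlinarith [sq_nonneg (kinkV c z)]

lemma abs_kinkW_le_one (c z : ℝ) : |kinkW c z| ≤ 1 := by
  rw [abs_of_pos (kinkW_pos c z)]; exact kinkW_le_one c z

lemma kinkV_nonneg {c z : ℝ} (h : c ≤ z) : 0 ≤ kinkV c z := by
  unfold kinkV
  rw [Real.tanh_eq_sinh_div_cosh]
  refine div_nonneg (Real.sinh_nonneg_iff.2 ?_) (Real.cosh_pos _).le
  exact div_nonneg (by linarith) (by positivity)

lemma kinkV_reflect (c z : ℝ) : kinkV c (2 * c - z) = - kinkV c z := by
  unfold kinkV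
  rw [← Real.tanh_neg]
  congr 1
  ring

lemma kinkW_reflect (c z : ℝ) : kinkW c (2 * c - z) = kinkW c z := by
  simp [kinkW, kinkV_reflect]

lemma tendsto_tanh_atTop : Tendsto Real.tanh atTop (𝓝 1) := by
  have h1 : Tendsto (fun x : ℝ => 1 - 2 * Real.exp (-x)) atTop (𝓝 (1 - 2 * 0)) :=
    (Real.tendsto_exp_neg_atTop_nhds_zero.const_mul 2).const_sub 1
  rw [mul_zero, sub_zero] at h1
  refine tendsto_of_tendsto_of_tendsto_of_le_of_le' h1 tendsto_const_nhds ?_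
    (Eventually.of_forall fun x => (Real.tanh_lt_one x).le)
  filter_upwards [eventually_ge_atTop 0] with x hx
  rw [Real.tanh_eq_sinh_div_cosh, le_div_iff₀ (Real.cosh_pos x), Real.sinh_eq, Real.cosh_eq]
  have e : Real.exp x * Real.exp (-x) = 1 := by rw [← Real.exp_add]; simp
  have h2 : 0 < Real.exp (-x) := Real.exp_pos _
  have h3 : Real.exp (-x) ≤ 1 := Real.exp_le_one_iff.2 (by linarith)
  nlinarith

lemma tendsto_kinkV_atTop (c : ℝ) : Tendsto (kinkV c) atTop (𝓝 1) := by
  refine tendsto_tanh_atTop.comp ?_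
  exact (tendsto_atTop_add_const_right _ (-c) tendsto_id).atTop_div_const (by positivity)

lemma tendsto_kinkV_atBot (c : ℝ) : Tendsto (kinkV c) atBot (𝓝 (-1)) := by
  have h1 : Tendsto (fun z => 2 * c - z) atBot atTop :=
    tendsto_atTop_add_const_left _ _ tendsto_neg_atBot_atTop
  have h2 := ((tendsto_kinkV_atTop c).comp h1).neg
  refine h2.congr fun z => ?_
  simp [kinkV_reflect]

lemma tendsto_kinkW_atTop (c : ℝ) : Tendsto (kinkW c) atTop (𝓝 0) := by
  have := (((tendsto_kinkV_atTop c).pow 2).const_sub 1).div_const √2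
  rw [one_pow, sub_self, zero_div] at this
  exact this

lemma integrable_kinkW (c : ℝ) : Integrable (kinkW c) := by
  refine integrable_of_intervalIntegral_norm_bounded (l := atTop (α := ℝ)) 2
    (a := fun r => -r) (b := id) (fun r => ?_) tendsto_neg_atTop_atBot tendsto_id
    (Eventually.of_forall fun r => ?_)
  · exact ((continuous_kinkW c).integrableOn_Icc).mono_set Set.Ioc_subset_Icc_self
  · simp_rw [Real.norm_of_nonneg (kinkW_pos c _).le]
    rw [intervalIntegral.integral_eq_sub_of_hasDerivAt (fun z _ => hasDerivAt_kinkV c z)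
      ((continuous_kinkW c).intervalIntegrable _ _)]
    have h1 := abs_le.1 (abs_kinkV_le_one c (id r))
    have h2 := abs_le.1 (abs_kinkV_le_one c (-r))
    linarith

lemma integral_kinkW (c : ℝ) : ∫ z, kinkW c z = 2 := by
  rw [integral_of_hasDerivAt_of_tendsto (fun z => hasDerivAt_kinkV c z) (integrable_kinkW c)
    (tendsto_kinkV_atBot c) (tendsto_kinkV_atTop c)]
  norm_num

lemma kinkW_pow_le {c z : ℝ} {k l : ℕ} (h : l ≤ k) : kinkW c z ^ k ≤ kinkW c z ^ l :=
  pow_le_pow_of_le_one (kinkW_pos c z).le (kinkW_le_one c z) h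

lemma integrable_kinkW_pow (c : ℝ) {k : ℕ} (hk : 1 ≤ k) : Integrable fun z => kinkW c z ^ k := by
  refine (integrable_kinkW c).mono' ((continuous_kinkW c).pow k).aestronglyMeasurable
    (Eventually.of_forall fun z => ?_)
  rw [Real.norm_of_nonneg (pow_nonneg (kinkW_pos c z).le k)]
  simpa using kinkW_pow_le (c := c) (z := z) hk

lemma integral_kinkW_sq (c : ℝ) : ∫ z, kinkW c z ^ 2 = 2 * √2 / 3 := by
  have hd : ∀ z, HasDerivAt (fun z => (kinkV c z - kinkV c z ^ 3 / 3) / √2) (kinkW c z ^ 2) z := by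
    intro z
    have h := ((hasDerivAt_kinkV c z).sub (((hasDerivAt_kinkV c z).pow 3).div_const 3)).div_const √2
    refine HasDerivAt.congr_deriv h (Eq.symm ?_)
    have := sqrt_two_mul_kinkW c z
    field_simp
    push_cast
    linear_combination 3 * kinkW c z * this
  have l1 := (((tendsto_kinkV_atBot c).sub (((tendsto_kinkV_atBot c).pow 3).div_const 3)).div_const √2)
  have l2 := (((tendsto_kinkV_atTop c).sub (((tendsto_kinkV_atTop c).pow 3).div_const 3)).div_const √2)
  rw [integral_of_hasDerivAt_of_tendsto hd (integrable_kinkW_pow c one_le_two) l1 l2]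
  have h2 : √2 ^ 2 = 2 := Real.sq_sqrt (by norm_num)
  field_simp
  rw [h2]; norm_num

/-! ### A weighted Poincaré inequality on the line -/

lemma setIntegral_Iic_eq_reflect (c : ℝ) (h : ℝ → ℝ) :
    ∫ z in Set.Iic c, h z = ∫ z in Set.Ioi c, h (2 * c - z) := by
  rw [← integral_Ici_eq_integral_Ioi, ← integral_indicator measurableSet_Iic,
    ← integral_indicator measurableSet_Ici,
    ← integral_sub_left_eq_self (fun z => (Set.Iic c).indicator h z) volume (2 * c)]
  congr 1
  ext z
  by_cases hz : c ≤ z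
  · rw [Set.indicator_of_mem (show z ∈ Set.Ici c from hz),
      Set.indicator_of_mem (show 2 * c - z ∈ Set.Iic c by simp; linarith)]
  · rw [Set.indicator_of_notMem (show z ∉ Set.Ici c from hz),
      Set.indicator_of_notMem (show 2 * c - z ∉ Set.Iic c by simp; linarith)]

section Poincare

variable {c : ℝ} {f f' : ℝ → ℝ} {a b : ℕ}

/-- `f` minus the multiple of `w ^ a` that agrees with it at the centre of the kink. -/
def centered (c : ℝ) (a : ℕ) (f : ℝ → ℝ) (z : ℝ) : ℝ := f z - f c / kinkW c c ^ a * kinkW c z ^ a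

lemma centered_self : centered c a f c = 0 := by
  have := (pow_pos (kinkW_pos c c) a).ne'
  unfold centered
  field_simp
  simp

lemma hasDerivAt_kinkW_pow (c z : ℝ) (a : ℕ) :
    HasDerivAt (fun z => kinkW c z ^ a) (-(a * √2 * kinkV c z * kinkW c z ^ a)) z := by
  have h := (hasDerivAt_kinkW c z).fun_pow a
  refine HasDerivAt.congr_deriv h (Eq.symm ?_)
  cases a with
  | zero => simp
  | succ a => simp only [Nat.add_sub_cancel, pow_succ]; ring

/-- The operator ∂ + a√2 v annihilates w ^ a, so centering leaves the twisted derivative of f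
unchanged. -/
lemma hasDerivAt_centered (hf : ∀ z, HasDerivAt f (f' z) z) (z : ℝ) :
    HasDerivAt (centered c a f)
      (f' z + a * √2 * kinkV c z * f z - a * √2 * kinkV c z * centered c a f z) z := by
  have h := (hf z).fun_sub ((hasDerivAt_kinkW_pow c z a).const_mul (f c / kinkW c c ^ a))
  refine HasDerivAt.congr_deriv h (Eq.symm ?_)
  unfold centered
  ring

lemma integrable_pow_mul_centered_sq (hfc : Continuous f) (hs : HasCompactSupport f)
    (hab : 1 ≤ 2 * a + b) : Integrable fun z => kinkW c z ^ b * centered c a f z ^ 2 := by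
  set α := f c / kinkW c c ^ a with hα
  have e : (fun z => kinkW c z ^ b * centered c a f z ^ 2) = fun z =>
      (kinkW c z ^ b * (f z - 2 * α * kinkW c z ^ a)) * f z + α ^ 2 * kinkW c z ^ (2 * a + b) := by
    ext z
    unfold centered
    rw [← hα, pow_add, pow_mul']
    ring
  rw [e]
  refine Integrable.add ?_ ((integrable_kinkW_pow c hab).const_mul _)
  refine Continuous.integrable_of_hasCompactSupport ?_ hs.mul_left
  have := continuous_kinkW c
  fun_prop

/-- A Hardy inequality on a half line. One integrates the derivative of w^b F² P for a weight P
adapted to w; the boundary term at c vanishes because F is centered there. -/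
lemma setIntegral_Ioi_centered_le (hf : ∀ z, HasDerivAt f (f' z) z) (hf' : Continuous f')
    (hs : HasCompactSupport f) (hab : 1 ≤ 2 * a + b) :
    ∫ z in Set.Ioi c, kinkW c z ^ b * centered c a f z ^ 2
      ≤ 8 * ∫ z in Set.Ioi c, kinkW c z ^ b * (f' z + a * √2 * kinkV c z * f z) ^ 2 := by
  have hfc : Continuous f := continuous_iff_continuousAt.2 fun z => (hf z).continuousAt
  have hs' : HasCompactSupport f' := by
    have : f' = deriv f := funext fun z => (hf z).deriv.symm
    rw [this]; exact hs.deriv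
  have hv := continuous_kinkV c
  have hw := continuous_kinkW c
  set g : ℝ → ℝ := fun z => f' z + a * √2 * kinkV c z * f z with hg
  set F := centered c a f with hF
  have hFd : ∀ z, HasDerivAt F (g z - a * √2 * kinkV c z * F z) z := hasDerivAt_centered hf
  have hFc : Continuous F := continuous_iff_continuousAt.2 fun z => (hFd z).continuousAt
  have hgc : Continuous g := by fun_prop
  have hgs : HasCompactSupport g := hs'.add hs.mul_left
  have hv1 : ∀ z, 0 < 1 + kinkV c z := fun z => by linarith [(abs_lt.1 (abs_kinkV_lt_one c z)).1]
  -- P is the tail mass of w divided by w, since w P = 1 - v is the integral of w over (z, ∞).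
  -- Equivalently P' = √2 v P - 1, and the term -1 produces the integral to be bounded.
  let P : ℝ → ℝ := fun z => √2 / (1 + kinkV c z)
  have hPc : Continuous P := continuous_const.div (by fun_prop) fun z => (hv1 z).ne'
  have hPd : ∀ z, HasDerivAt P (√2 * kinkV c z * P z - 1) z := by
    intro z
    have h := (hasDerivAt_const z √2).fun_div ((hasDerivAt_kinkV c z).const_add 1) (hv1 z).ne'
    refine HasDerivAt.congr_deriv h (Eq.symm ?_)
    have h1 := sqrt_two_mul_kinkW c z
    have h2 : √2 ^ 2 = 2 := Real.sq_sqrt (by norm_num)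
    have := (hv1 z).ne'
    simp only [P]
    field_simp
    linear_combination h1 + kinkV c z * (1 + kinkV c z) * h2
  have hΦd : ∀ z, HasDerivAt (fun z => kinkW c z ^ b * F z ^ 2 * P z)
      (kinkW c z ^ b * (2 * P z * F z * g z) - kinkW c z ^ b * F z ^ 2 *
        (1 + (2 * a + b - 1) * √2 * kinkV c z * P z)) z := by
    intro z
    have h := ((hasDerivAt_kinkW_pow c z b).fun_mul ((hFd z).fun_pow 2)).fun_mul (hPd z)
    refine HasDerivAt.congr_deriv h (Eq.symm ?_)
    push_cast
    ring
  have iF := integrable_pow_mul_centered_sq (c := c) hfc hs hab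
  have ig : Integrable fun z => kinkW c z ^ b * g z ^ 2 := by
    refine Continuous.integrable_of_hasCompactSupport (by fun_prop) ?_
    simp_rw [sq]
    exact (hgs.mul_left).mul_left
  have iPg : Integrable fun z => kinkW c z ^ b * (2 * P z * F z * g z) :=
    Continuous.integrable_of_hasCompactSupport (by fun_prop) (hgs.mul_left.mul_left)
  have hP2 : ∀ z ∈ Set.Ioi c, 0 ≤ P z ∧ P z ≤ √2 := by
    intro z hz
    have := kinkV_nonneg (le_of_lt hz)
    refine ⟨div_nonneg (by positivity) (hv1 z).le, ?_⟩
    exact div_le_self (by positivity) (by linarith)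
  have iΦ : IntegrableOn (fun z => kinkW c z ^ b * F z ^ 2 *
      (1 + (2 * a + b - 1) * √2 * kinkV c z * P z)) (Set.Ioi c) := by
    refine iF.integrableOn.mul_bdd (c := 1 + |(2 * a + b - 1 : ℝ)| * √2 * 1 * √2) ?_ ?_
    · exact Continuous.aestronglyMeasurable (by fun_prop)
    · refine (ae_restrict_iff' measurableSet_Ioi).2 (Eventually.of_forall fun z hz => ?_)
      obtain ⟨h0, h1⟩ := hP2 z hz
      refine (norm_add_le _ _).trans (add_le_add (by simp) ?_)
      simp only [norm_mul, Real.norm_eq_abs]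
      rw [abs_of_nonneg h0, abs_of_nonneg (Real.sqrt_nonneg 2)]
      gcongr
      exact abs_kinkV_le_one c z
  -- Beyond the support of f, F is a multiple of w ^ a. Decay therefore needs 2a + b ≥ 1.
  have hlim : Tendsto (fun z => kinkW c z ^ b * F z ^ 2 * P z) atTop (𝓝 0) := by
    have h1 : Tendsto (fun z => (f c / kinkW c c ^ a) ^ 2 * kinkW c z ^ (2 * a + b) * P z) atTop
        (𝓝 ((f c / kinkW c c ^ a) ^ 2 * 0 ^ (2 * a + b) * (√2 / (1 + 1)))) :=
      (((tendsto_kinkW_atTop c).pow _).const_mul _).mul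
        (tendsto_const_nhds.div ((tendsto_kinkV_atTop c).const_add 1) (by norm_num))
    rw [zero_pow (by omega), mul_zero, zero_mul] at h1
    refine h1.congr' ?_
    have h2 : ∀ᶠ z in atTop, f z = 0 := by
      exact (atTop_le_cocompact.trans_eq coclosedCompact_eq_cocompact.symm)
        (hasCompactSupport_iff_eventuallyEq.1 hs)
    filter_upwards [h2] with z hz
    simp only [hF, centered, hz]
    rw [pow_add, pow_mul']
    ring
  have key := integral_Ioi_of_hasDerivAt_of_tendsto' (a := c) (fun z _ => hΦd z)
    (iPg.integrableOn.sub iΦ) hlim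
  rw [integral_sub iPg.integrableOn iΦ] at key
  have hF0 : F c = 0 := centered_self
  rw [hF0] at key
  -- On this half line v ≥ 0, so the term with the factor 2a + b - 1 has the favourable sign.
  have e1 : ∫ z in Set.Ioi c, kinkW c z ^ b * F z ^ 2 ≤ ∫ z in Set.Ioi c, kinkW c z ^ b * F z ^ 2 *
      (1 + (2 * a + b - 1) * √2 * kinkV c z * P z) := by
    refine setIntegral_mono_on iF.integrableOn iΦ measurableSet_Ioi fun z hz => ?_
    refine le_mul_of_one_le_right (mul_nonneg (pow_nonneg (kinkW_pos c z).le b) (sq_nonneg _)) ?_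
    have h1 : (0 : ℝ) ≤ 2 * a + b - 1 := by
      have : (1 : ℝ) ≤ 2 * a + b := by exact_mod_cast hab
      linarith
    have h2 := kinkV_nonneg (le_of_lt hz)
    have h3 := (hP2 z hz).1
    have : 0 ≤ (2 * a + b - 1 : ℝ) * √2 * kinkV c z * P z := by positivity
    linarith
  -- Young's inequality with P² ≤ 2. Absorbing half of the left-hand side doubles 4 to the constant
  -- 8.
  have e2 : ∫ z in Set.Ioi c, kinkW c z ^ b * (2 * P z * F z * g z)
      ≤ ∫ z in Set.Ioi c, (1 / 2 * (kinkW c z ^ b * F z ^ 2) + 4 * (kinkW c z ^ b * g z ^ 2)) := by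
    refine setIntegral_mono_on iPg.integrableOn
      ((iF.integrableOn.const_mul _).add (ig.integrableOn.const_mul _)) measurableSet_Ioi
      fun z hz => ?_
    obtain ⟨h0, h1⟩ := hP2 z hz
    have h2 : √2 ^ 2 = 2 := Real.sq_sqrt (by norm_num)
    have h3 : P z ^ 2 ≤ 2 := by nlinarith
    have h4 : 2 * P z * F z * g z ≤ 1 / 2 * F z ^ 2 + 4 * g z ^ 2 := by
      nlinarith [sq_nonneg (F z - 2 * P z * g z), mul_nonneg (sub_nonneg.2 h3) (sq_nonneg (g z))]
    have h5 := pow_nonneg (kinkW_pos c z).le b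
    nlinarith
  rw [integral_add (iF.integrableOn.const_mul _) (ig.integrableOn.const_mul _),
    integral_const_mul, integral_const_mul] at e2
  simp only [ne_eq, OfNat.ofNat_ne_zero, not_false_eq_true, zero_pow, mul_zero, zero_mul,
    sub_zero] at key
  linarith

/-- The reflection z ↦ 2c - z carries the left half line to the right one; v is odd and w is even
about c. -/
lemma integral_centered_le (hf : ∀ z, HasDerivAt f (f' z) z) (hf' : Continuous f')
    (hs : HasCompactSupport f) (hab : 1 ≤ 2 * a + b) :
    ∫ z, kinkW c z ^ b * centered c a f z ^ 2
      ≤ 8 * ∫ z, kinkW c z ^ b * (f' z + a * √2 * kinkV c z * f z) ^ 2 := by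
  have hfc : Continuous f := continuous_iff_continuousAt.2 fun z => (hf z).continuousAt
  have hs' : HasCompactSupport f' := by
    have : f' = deriv f := funext fun z => (hf z).deriv.symm
    rw [this]; exact hs.deriv
  have hv := continuous_kinkV c
  have hw := continuous_kinkW c
  have iF := integrable_pow_mul_centered_sq (c := c) hfc hs hab
  have ig : Integrable fun z => kinkW c z ^ b * (f' z + a * √2 * kinkV c z * f z) ^ 2 := by
    refine Continuous.integrable_of_hasCompactSupport (by fun_prop) ?_
    simp_rw [sq]
    exact ((hs'.add hs.mul_left).mul_left).mul_left
  rw [← intervalIntegral.integral_Iic_add_Ioi iF.integrableOn iF.integrableOn (b := c),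
    ← intervalIntegral.integral_Iic_add_Ioi ig.integrableOn ig.integrableOn (b := c), mul_add]
  refine add_le_add ?_ (setIntegral_Ioi_centered_le hf hf' hs hab)
  rw [setIntegral_Iic_eq_reflect, setIntegral_Iic_eq_reflect]
  have hfr : ∀ z, HasDerivAt (fun z => f (2 * c - z)) (-f' (2 * c - z)) z := by
    intro z
    have := HasDerivAt.comp (h := fun z : ℝ => 2 * c - z) z (hf (2 * c - z))
      ((hasDerivAt_id z).const_sub (2 * c))
    rw [mul_neg_one] at this
    exact this
  have hsr : HasCompactSupport fun z => f (2 * c - z) :=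
    hs.comp_homeomorph (Homeomorph.subLeft (2 * c))
  have h := setIntegral_Ioi_centered_le (c := c) (a := a) (b := b) hfr (by fun_prop) hsr hab
  have e1 : ∀ z, centered c a (fun z => f (2 * c - z)) z = centered c a f (2 * c - z) := by
    intro z
    unfold centered
    rw [kinkW_reflect]
    congr 3
    ring_nf
  simp_rw [e1] at h
  simp_rw [kinkW_reflect, kinkV_reflect]
  refine h.trans (le_of_eq ?_)
  congr 2
  ext z
  ring

/-- The quadratic polynomial t ↦ ∫ ρ (F - t)² is nonnegative, so its discriminant is at most zero.
-/
lemma sq_integral_mul_le {α : Type*} {m : MeasurableSpace α} {μ : Measure α} {ρ F : α → ℝ}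
    (h0 : ∀ x, 0 ≤ ρ x) (h1 : Integrable ρ μ) (h2 : Integrable (fun x => ρ x * F x ^ 2) μ)
    (h3 : Integrable (fun x => ρ x * F x) μ) :
    (∫ x, ρ x * F x ∂μ) ^ 2 ≤ (∫ x, ρ x ∂μ) * ∫ x, ρ x * F x ^ 2 ∂μ := by
  have key : ∀ t : ℝ, 0 ≤ (∫ x, ρ x ∂μ) * (t * t) + (-2 * ∫ x, ρ x * F x ∂μ) * t
      + ∫ x, ρ x * F x ^ 2 ∂μ := by
    intro t
    have h4 : 0 ≤ ∫ x, (ρ x * F x ^ 2 + (-2 * t) * (ρ x * F x) + t ^ 2 * ρ x) ∂μ :=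
      integral_nonneg fun x => by
        have := mul_nonneg (h0 x) (sq_nonneg (F x - t))
        simp only [Pi.zero_apply]
        nlinarith
    rw [integral_add (f := fun x => ρ x * F x ^ 2 + (-2 * t) * (ρ x * F x))
      (h2.add (h3.const_mul _)) (h1.const_mul _), integral_add h2 (h3.const_mul _),
      integral_const_mul, integral_const_mul] at h4
    nlinarith
  have := discrim_le_zero key
  unfold discrim at this
  nlinarith

lemma sq_integral_le {α : Type*} {m : MeasurableSpace α} {μ : Measure α} [IsProbabilityMeasure μ]
    {F : α → ℝ} (h1 : Integrable F μ) (h2 : Integrable (fun x => F x ^ 2) μ) :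
    (∫ x, F x ∂μ) ^ 2 ≤ ∫ x, F x ^ 2 ∂μ := by
  have := sq_integral_mul_le (μ := μ) (ρ := fun _ => 1) (F := F) (fun _ => zero_le_one)
    (integrable_const _) (by simp_rw [one_mul]; exact h2) (by simp_rw [one_mul]; exact h1)
  simpa using this

/-- The weighted Poincaré inequality on the line, for the derivative twisted by `w ^ a` and the
weight `w ^ b`. -/
lemma integral_kinkW_pow_mul_sq_le (hf : ∀ z, HasDerivAt f (f' z) z) (hf' : Continuous f')
    (hs : HasCompactSupport f) (hab : 1 ≤ 2 * a + b) (ha : a ≤ 1) (hb : b ≤ 1) :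
    ∫ z, kinkW c z ^ b * f z ^ 2
      ≤ 160 * (∫ z, kinkW c z ^ b * (f' z + a * √2 * kinkV c z * f z) ^ 2)
        + 9 * (∫ z, kinkW c z * f z) ^ 2 := by
  have hfc : Continuous f := continuous_iff_continuousAt.2 fun z => (hf z).continuousAt
  have hw := continuous_kinkW c
  have hmain := integral_centered_le (c := c) hf hf' hs hab
  have iF := integrable_pow_mul_centered_sq (c := c) hfc hs hab
  have iF1 := integrable_pow_mul_centered_sq (c := c) (a := a) (b := 1) hfc hs (by omega)
  simp only [pow_one] at iF1
  have iwf : Integrable fun z => kinkW c z * f z :=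
    Continuous.integrable_of_hasCompactSupport (by fun_prop) hs.mul_left
  have iw := integrable_kinkW_pow c (k := a + 1) (by omega)
  set G := ∫ z, kinkW c z ^ b * (f' z + a * √2 * kinkV c z * f z) ^ 2 with hG
  set m := ∫ z, kinkW c z * f z with hm
  -- In the decomposition f = F + α w^a, `hmain` controls F, and pairing with w controls α through α
  -- ∫ w^(a+1) = m - ∫ w F.
  set α := f c / kinkW c c ^ a with hα
  have e0 : ∀ z, kinkW c z * centered c a f z = kinkW c z * f z - α * kinkW c z ^ (a + 1) := by
    intro z; unfold centered; rw [← hα, pow_succ]; ring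
  have iwF : Integrable fun z => kinkW c z * centered c a f z := by
    simp_rw [e0]; exact iwf.sub (iw.const_mul _)
  set B := ∫ z, kinkW c z ^ b * centered c a f z ^ 2 with hB
  have hcs := sq_integral_mul_le (fun z => (kinkW_pos c z).le) (integrable_kinkW c) iF1 iwF
  rw [integral_kinkW] at hcs
  have hB1 : ∫ z, kinkW c z * centered c a f z ^ 2 ≤ B := by
    refine integral_mono iF1 iF fun z => mul_le_mul_of_nonneg_right ?_ (sq_nonneg _)
    simpa using kinkW_pow_le (c := c) (z := z) hb
  have e1 : ∫ z, kinkW c z * centered c a f z = m - α * ∫ z, kinkW c z ^ (a + 1) := by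
    simp_rw [e0]
    rw [integral_sub iwf (iw.const_mul _), integral_const_mul]
  have hlow : 2 * √2 / 3 ≤ ∫ z, kinkW c z ^ (a + 1) := by
    rw [← integral_kinkW_sq c]
    exact integral_mono (integrable_kinkW_pow c one_le_two) iw fun z => kinkW_pow_le (by omega)
  set I := ∫ z, kinkW c z ^ (a + 1) with hI
  have h2 : √2 ^ 2 = 2 := Real.sq_sqrt (by norm_num)
  have hI2 : 8 / 9 ≤ I ^ 2 := by
    have h3 : (0 : ℝ) ≤ 2 * √2 / 3 := by positivity
    nlinarith
  have hα2 : α ^ 2 * (8 / 9) ≤ 2 * m ^ 2 + 4 * B := by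
    have h3 : α ^ 2 * (8 / 9) ≤ (α * I) ^ 2 := by
      rw [mul_pow]; exact mul_le_mul_of_nonneg_left hI2 (sq_nonneg _)
    rw [e1] at hcs
    nlinarith [sq_nonneg (2 * m - α * I)]
  have ik := integrable_kinkW_pow c hab
  have hk2 : ∫ z, kinkW c z ^ (2 * a + b) ≤ 2 := by
    rw [← integral_kinkW c]
    refine integral_mono ik (integrable_kinkW c) fun z => ?_
    simpa using kinkW_pow_le (c := c) (z := z) hab
  have hfin : ∫ z, kinkW c z ^ b * f z ^ 2
      ≤ ∫ z, (2 * (kinkW c z ^ b * centered c a f z ^ 2)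
        + 2 * α ^ 2 * kinkW c z ^ (2 * a + b)) := by
    refine integral_mono ?_ ((iF.const_mul _).add (ik.const_mul _)) fun z => ?_
    · refine Continuous.integrable_of_hasCompactSupport (by fun_prop) ?_
      simp_rw [sq]
      exact hs.mul_left.mul_left
    · have e : f z = centered c a f z + α * kinkW c z ^ a := by unfold centered; ring
      have e' : kinkW c z ^ (2 * a + b) = kinkW c z ^ b * (kinkW c z ^ a) ^ 2 := by
        rw [pow_add, pow_mul']; ring
      simp only
      rw [e']
      have h6 : f z ^ 2 = (centered c a f z + α * kinkW c z ^ a) ^ 2 := by rw [← e]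
      rw [h6]
      have h5 := mul_nonneg (pow_nonneg (kinkW_pos c z).le b)
        (sq_nonneg (centered c a f z - α * kinkW c z ^ a))
      nlinarith
  -- The left-hand side is at most 2B + 4α², and α² ≤ (9/8)(2m² + 4B), hence at most 20B + 9m². With
  -- B ≤ 8G this gives 160 and 9.
  rw [integral_add (iF.const_mul _) (ik.const_mul _), integral_const_mul, integral_const_mul] at hfin
  have h6 : 2 * α ^ 2 * ∫ z, kinkW c z ^ (2 * a + b) ≤ 2 * α ^ 2 * 2 :=
    mul_le_mul_of_nonneg_left hk2 (by positivity)
  nlinarith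

end Poincare

namespace Strip

variable {n : ℕ}

/-! ### A Poincaré inequality on the cross section -/

lemma IsSmooth.hasDerivAt_line {φ : Strip n → ℝ} (h : IsSmooth φ) (x : Strip n)
    (r : Fin (n + 1) → ℝ) (t : ℝ) :
    HasDerivAt (fun t : ℝ => φ (x + cover (t • r)))
      (∑ i, r i * Strip.pderiv i φ (x + cover (t • r))) t := by
  obtain ⟨y, rfl⟩ := cover_surjective x
  simp_rw [← cover_add, h.pderiv_cover]
  have h1 : HasFDerivAt (fun y => φ (cover y)) (fderiv ℝ (fun y => φ (cover y)) (y + t • r))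
      (y + t • r) := (ContDiff.differentiable h (by simp)).differentiableAt.hasFDerivAt
  have h2 : HasDerivAt (fun t : ℝ => y + t • r) r t := by
    simpa using ((hasDerivAt_id t).smul_const r).const_add y
  have h3 := h1.comp_hasDerivAt t h2
  refine HasDerivAt.congr_deriv h3 ?_
  conv_lhs => rw [clm_eq_sum (fderiv ℝ (fun y => φ (cover y)) (y + t • r))]
  simp [mul_comm]

lemma integral_integral_translate {K : Strip n → ℝ} (hc : Continuous K) (hs : HasCompactSupport K)
    {γ : ℝ → Strip n} (hγ : Continuous γ) :
    Integrable (fun x => ∫ t in Set.Ioc (0 : ℝ) 1, K (x + γ t)) ∧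
      ∫ x, ∫ t in Set.Ioc (0 : ℝ) 1, K (x + γ t) = ∫ x, K x := by
  have hK : Integrable K := hc.integrable_of_hasCompactSupport hs
  have hcont : Continuous fun p : Strip n × ℝ => K (p.1 + γ p.2) :=
    hc.comp (continuous_fst.add (hγ.comp continuous_snd))
  have hm : AEStronglyMeasurable (Function.uncurry fun (x : Strip n) (t : ℝ) => K (x + γ t))
      ((volume : Measure (Strip n)).prod (volume.restrict (Set.Ioc (0 : ℝ) 1))) :=
    Continuous.aestronglyMeasurable hcont
  have hi : Integrable (Function.uncurry fun (x : Strip n) (t : ℝ) => K (x + γ t))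
      ((volume : Measure (Strip n)).prod (volume.restrict (Set.Ioc (0 : ℝ) 1))) := by
    rw [integrable_prod_iff' hm]
    constructor
    · exact Eventually.of_forall fun t => hK.comp_add_right (γ t)
    · simp only [Function.uncurry]
      simp_rw [integral_add_right_eq_self (fun x => ‖K x‖)]
      exact integrable_const _
  refine ⟨hi.integral_prod_left, ?_⟩
  rw [integral_integral_swap hi]
  simp [integral_add_right_eq_self (fun x => K x)]

/-- The squared tangential gradient of a smooth function. -/
def tanSq (φ : Strip n → ℝ) (x : Strip n) : ℝ := ∑ i : Fin n, pderiv i.castSucc φ x ^ 2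

lemma IsTest.continuous_tanSq {φ : Strip n → ℝ} (h : IsTest φ) : Continuous (tanSq φ) :=
  continuous_finsetSum _ fun i _ => (h.pderiv i.castSucc).continuous.pow 2

lemma IsTest.tanSq_eq_zero {φ : Strip n → ℝ} {x : Strip n} (hx : x ∉ tsupport φ) :
    tanSq φ x = 0 :=
  Finset.sum_eq_zero fun i _ => by rw [pderiv_eq_zero_of_notMem_tsupport hx]; simp

lemma IsTest.hasCompactSupport_tanSq {φ : Strip n → ℝ} (h : IsTest φ) :
    HasCompactSupport (tanSq φ) :=
  HasCompactSupport.intro h.compact fun _ => IsTest.tanSq_eq_zero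

/-- The difference is the integral of the tangential derivative along a straight segment.
Cauchy-Schwarz in time and in the n components, followed by translation invariance of the integral,
leaves the factor n. The weight is constant along the segment. -/
lemma IsTest.integral_sq_sub_translate_le {φ : Strip n → ℝ} (h : IsTest φ) {ρ : ℝ → ℝ}
    (hρ : Continuous ρ) (hρ0 : ∀ z, 0 ≤ ρ z) (y : Fin n → UnitAddCircle) :
    ∫ x, ρ x.2 * (φ (x + (y, 0)) - φ x) ^ 2 ≤ n * ∫ x, ρ x.2 * tanSq φ x := by
  -- Representatives in [0, 1] ensure r_i² ≤ 1.
  choose r hr hry using fun i => AddCircle.coe_image_Icc_eq (p := (1 : ℝ)) 0 ▸ Set.mem_univ (y i)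
  let R : Fin (n + 1) → ℝ := Fin.snoc r 0
  have hR : cover R = (y, 0) := by
    simp only [cover, R, Fin.snoc_castSucc, Fin.snoc_last]
    exact Prod.ext (funext hry) rfl
  have hR2 : ∀ t : ℝ, (cover (t • R)).2 = 0 := fun t => by simp [cover, R]
  have hγ : Continuous fun t : ℝ => cover (t • R) :=
    continuous_cover.comp (continuous_id.smul continuous_const)
  set H : Strip n → ℝ := fun x => ρ x.2 * tanSq φ x with hH
  have hHc : Continuous H := (hρ.comp continuous_snd).mul h.continuous_tanSq
  have hHs : HasCompactSupport H := h.hasCompactSupport_tanSq.mul_left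
  have hpt : ∀ x : Strip n, ρ x.2 * (φ (x + (y, 0)) - φ x) ^ 2
      ≤ n * ∫ t in Set.Ioc (0 : ℝ) 1, H (x + cover (t • R)) := by
    intro x
    set D : ℝ → ℝ := fun t => ∑ i, R i * Strip.pderiv i φ (x + cover (t • R)) with hD
    have hDc : Continuous D := continuous_finsetSum _ fun i _ =>
      continuous_const.mul ((h.pderiv i).continuous.comp (continuous_const.add hγ))
    have ftc : ∫ t in (0 : ℝ)..1, D t = φ (x + (y, 0)) - φ x := by
      rw [intervalIntegral.integral_eq_sub_of_hasDerivAt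
        (fun t _ => h.isSmooth.hasDerivAt_line x R t) (hDc.intervalIntegrable _ _)]
      simp [hR]
    rw [intervalIntegral.integral_of_le zero_le_one] at ftc
    have iD : IntegrableOn D (Set.Ioc 0 1) :=
      (hDc.integrableOn_Icc).mono_set Set.Ioc_subset_Icc_self
    have iD2 : IntegrableOn (fun t => D t ^ 2) (Set.Ioc 0 1) :=
      ((hDc.pow 2).integrableOn_Icc).mono_set Set.Ioc_subset_Icc_self
    have : IsProbabilityMeasure (volume.restrict (Set.Ioc (0 : ℝ) 1)) := ⟨by simp⟩
    have hcs := sq_integral_le iD iD2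
    rw [ftc] at hcs
    have hcst : ∀ t, ρ x.2 * D t ^ 2 ≤ n * H (x + cover (t • R)) := by
      intro t
      have e1 : (x + cover (t • R)).2 = x.2 := by simp [hR2]
      have e2 : D t = ∑ i : Fin n, r i * Strip.pderiv i.castSucc φ (x + cover (t • R)) := by
        simp [hD, Fin.sum_univ_castSucc, R]
      have e3 : D t ^ 2 ≤ n * tanSq φ (x + cover (t • R)) := by
        rw [e2]
        refine (sq_sum_le_card_mul_sum_sq).trans ?_
        simp only [Finset.card_univ, Fintype.card_fin]
        refine mul_le_mul_of_nonneg_left (Finset.sum_le_sum fun i _ => ?_) (by positivity)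
        rw [mul_pow]
        refine mul_le_of_le_one_left (sq_nonneg _) ?_
        have h1 := (hr i).1
        have h2 := (hr i).2
        nlinarith
      simp only [hH, e1]
      have := mul_le_mul_of_nonneg_left e3 (hρ0 x.2)
      linarith
    calc ρ x.2 * (φ (x + (y, 0)) - φ x) ^ 2 ≤ ρ x.2 * ∫ t in Set.Ioc (0 : ℝ) 1, D t ^ 2 :=
          mul_le_mul_of_nonneg_left hcs (hρ0 _)
      _ = ∫ t in Set.Ioc (0 : ℝ) 1, ρ x.2 * D t ^ 2 := (integral_const_mul _ _).symm
      _ ≤ ∫ t in Set.Ioc (0 : ℝ) 1, n * H (x + cover (t • R)) := by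
          refine integral_mono (iD2.const_mul _) ?_ hcst
          exact ((continuous_const.mul (hHc.comp
            (continuous_const.add hγ))).integrableOn_Icc).mono_set Set.Ioc_subset_Icc_self
      _ = _ := integral_const_mul _ _
  obtain ⟨i1, i2⟩ := integral_integral_translate hHc hHs hγ
  rw [← i2, ← integral_const_mul]
  exact integral_mono_of_nonneg
    (Eventually.of_forall fun x => mul_nonneg (hρ0 _) (sq_nonneg _)) (i1.const_mul _)
    (Eventually.of_forall hpt)

lemma integrable_of_continuous_torus {g : (Fin n → UnitAddCircle) → ℝ} (hg : Continuous g) :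
    Integrable g :=
  hg.integrable_of_hasCompactSupport (HasCompactSupport.of_compactSpace _)

/-- The average over the cross section. -/
def avg (φ : Strip n → ℝ) (z : ℝ) : ℝ := ∫ y, φ (y, z)

/-- The set of all points with the same last coordinate as a point of the support. -/
def slab (φ : Strip n → ℝ) : Set ℝ := Prod.snd '' tsupport φ

lemma IsTest.isCompact_slab {φ : Strip n → ℝ} (h : IsTest φ) : IsCompact (slab φ) :=
  h.compact.isCompact.image continuous_snd

lemma notMem_tsupport_of_slab {φ : Strip n → ℝ} {x : Strip n} (hx : x.2 ∉ slab φ) :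
    x ∉ tsupport φ := fun h => hx ⟨x, h, rfl⟩

/-- Subtracting the mean is averaging over all translates, so Jensen and Fubini reduce this to the
bound for a single translate. -/
lemma IsTest.integral_sq_sub_avg_le {φ : Strip n → ℝ} (h : IsTest φ) {ρ : ℝ → ℝ}
    (hρ : Continuous ρ) (hρ0 : ∀ z, 0 ≤ ρ z) :
    ∫ x, ρ x.2 * (φ x - avg φ x.2) ^ 2 ≤ n * ∫ x, ρ x.2 * tanSq φ x := by
  set Ψ : Strip n → (Fin n → UnitAddCircle) → ℝ :=
    fun x y => ρ x.2 * (φ (x + (y, 0)) - φ x) ^ 2 with hΨ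
  have hΨc : Continuous (Function.uncurry Ψ) := by
    have h1 : Continuous fun p : Strip n × (Fin n → UnitAddCircle) => p.1 + (p.2, (0 : ℝ)) :=
      continuous_fst.add (continuous_snd.prodMk continuous_const)
    exact (hρ.comp (continuous_snd.comp continuous_fst)).mul
      (((h.continuous.comp h1).sub (h.continuous.comp continuous_fst)).pow 2)
  have hΨs : HasCompactSupport (Function.uncurry Ψ) := by
    refine HasCompactSupport.intro (K := (Set.univ ×ˢ slab φ) ×ˢ Set.univ)
      ((isCompact_univ.prod h.isCompact_slab).prod isCompact_univ) fun p hp => ?_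
    have h2 : p.1.2 ∉ slab φ := fun h' => hp ⟨⟨trivial, h'⟩, trivial⟩
    simp only [Function.uncurry, hΨ]
    rw [image_eq_zero_of_notMem_tsupport (notMem_tsupport_of_slab h2),
      image_eq_zero_of_notMem_tsupport (f := φ)
        (notMem_tsupport_of_slab (x := p.1 + (p.2, 0)) (by simpa))]
    simp
  have hΨi : Integrable (Function.uncurry Ψ) (volume.prod volume) :=
    hΨc.integrable_of_hasCompactSupport hΨs
  have hpt : ∀ x : Strip n, ρ x.2 * (φ x - avg φ x.2) ^ 2 ≤ ∫ y, Ψ x y := by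
    intro x
    have hc : Continuous fun y : Fin n → UnitAddCircle => φ (x + (y, 0)) - φ x :=
      (h.continuous.comp (continuous_const.add (continuous_id.prodMk continuous_const))).sub
        continuous_const
    have hcs := sq_integral_le (integrable_of_continuous_torus hc)
      (integrable_of_continuous_torus (hc.pow 2))
    have hc' : Continuous fun y : Fin n → UnitAddCircle => φ (x + (y, 0)) :=
      h.continuous.comp (continuous_const.add (continuous_id.prodMk continuous_const))
    have e : ∫ y : Fin n → UnitAddCircle, (φ (x + (y, 0)) - φ x) = avg φ x.2 - φ x := by
      rw [integral_sub (integrable_of_continuous_torus hc') (integrable_const _)]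
      simp only [integral_const, probReal_univ, smul_eq_mul, one_mul]
      have := integral_add_left_eq_self (μ := (volume : Measure (Fin n → UnitAddCircle)))
        (fun y => φ (y, x.2)) x.1
      simp only [avg]
      rw [← this]
      congr 2
      ext y
      congr 1
      ext <;> simp
    rw [e] at hcs
    simp only [hΨ]
    rw [integral_const_mul]
    refine mul_le_mul_of_nonneg_left ?_ (hρ0 _)
    nlinarith
  calc ∫ x, ρ x.2 * (φ x - avg φ x.2) ^ 2 ≤ ∫ x, ∫ y, Ψ x y :=
        integral_mono_of_nonneg (Eventually.of_forall fun x => mul_nonneg (hρ0 _) (sq_nonneg _))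
          hΨi.integral_prod_left (Eventually.of_forall hpt)
    _ = ∫ y, ∫ x, Ψ x y := integral_integral_swap hΨi
    _ ≤ ∫ _y : Fin n → UnitAddCircle, n * ∫ x, ρ x.2 * tanSq φ x :=
        integral_mono hΨi.integral_prod_right (integrable_const _)
          fun y => h.integral_sq_sub_translate_le hρ hρ0 y
    _ = _ := by simp

/-! ### Averages over the cross section -/

lemma integral_eq_integral_avg {φ : Strip n → ℝ} (h : Integrable φ) :
    ∫ x, φ x = ∫ z, avg φ z := integral_prod_symm φ h

lemma continuous_avg {φ : Strip n → ℝ} (hc : Continuous φ) : Continuous (avg φ) := by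
  have := continuous_parametric_integral_of_continuous
    (μ := (volume : Measure (Fin n → UnitAddCircle))) (s := Set.univ)
    (f := fun (z : ℝ) (y : Fin n → UnitAddCircle) => φ (y, z))
    (hc.comp (continuous_snd.prodMk continuous_fst)) isCompact_univ
  simp only [Measure.restrict_univ] at this
  exact this

lemma IsTest.hasCompactSupport_avg {φ : Strip n → ℝ} (h : IsTest φ) :
    HasCompactSupport (avg φ) := by
  refine HasCompactSupport.intro h.isCompact_slab fun z hz => ?_
  refine integral_eq_zero_of_ae (Eventually.of_forall fun y => ?_)
  exact image_eq_zero_of_notMem_tsupport (notMem_tsupport_of_slab (x := (y, z)) hz)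

lemma IsSmooth.hasDerivAt_last {φ : Strip n → ℝ} (h : IsSmooth φ) (y : Fin n → UnitAddCircle)
    (z : ℝ) : HasDerivAt (fun z => φ (y, z)) (Strip.pderiv (Fin.last n) φ (y, z)) z := by
  have h1 := h.hasDerivAt (Fin.last n) (y, 0) z
  have e : ∀ t : ℝ, ((y, 0) : Strip n) + cover (Pi.single (Fin.last n) t) = (y, t) := by
    intro t
    have : (cover (Pi.single (Fin.last n) t) : Strip n) = (0, t) := by
      simp only [cover, Pi.single_eq_same]
      refine Prod.ext (funext fun i => ?_) rfl
      simp [Fin.castSucc_ne_last]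
    rw [this]
    simp
  simp_rw [e] at h1
  exact h1

lemma IsTest.hasDerivAt_avg {φ : Strip n → ℝ} (h : IsTest φ) (z : ℝ) :
    HasDerivAt (avg φ) (avg (Strip.pderiv (Fin.last n) φ) z) z := by
  obtain ⟨M, hM⟩ := (h.pderiv (Fin.last n)).exists_bound
  have hsl : ∀ {ψ : Strip n → ℝ}, IsTest ψ → ∀ z, Continuous fun y => ψ (y, z) := fun hψ z =>
    hψ.continuous.comp (continuous_id.prodMk continuous_const)
  exact (hasDerivAt_integral_of_dominated_loc_of_deriv_le
    (F := fun (z : ℝ) (y : Fin n → UnitAddCircle) => φ (y, z))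
    (F' := fun z y => Strip.pderiv (Fin.last n) φ (y, z)) (bound := fun _ => M) (s := Set.univ)
    univ_mem (Eventually.of_forall fun z => (hsl h z).aestronglyMeasurable)
    (integrable_of_continuous_torus (hsl h z)) (hsl (h.pderiv _) z).aestronglyMeasurable
    (Eventually.of_forall fun y z _ => hM _) (integrable_const _)
    (Eventually.of_forall fun y z _ => h.isSmooth.hasDerivAt_last y z)).2

lemma avg_sq_le {φ : Strip n → ℝ} (hc : Continuous φ) (z : ℝ) :
    avg φ z ^ 2 ≤ avg (fun x => φ x ^ 2) z := by
  have hsl : Continuous fun y => φ (y, z) := hc.comp (continuous_id.prodMk continuous_const)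
  exact sq_integral_le (integrable_of_continuous_torus hsl)
    (integrable_of_continuous_torus (hsl.pow 2))

lemma avg_mul_left (ρ : ℝ → ℝ) (φ : Strip n → ℝ) (z : ℝ) :
    avg (fun x => ρ x.2 * φ x) z = ρ z * avg φ z :=
  integral_const_mul (ρ z) fun y => φ (y, z)

/-! ### The weighted Poincaré inequality on the strip -/

/-- The deviation from the cross-sectional average is controlled by tangential derivatives, and the
average by the inequality on the line. Averaging commutes with ∂_z + a√2 v and with the weights,
which depend on z only; the splitting into two parts doubles the constants. -/
lemma IsTest.poincare {φ : Strip n → ℝ} (h : IsTest φ) (c : ℝ) {a b : ℕ} (hab : 1 ≤ 2 * a + b)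
    (ha : a ≤ 1) (hb : b ≤ 1) :
    ∫ x, kinkW c x.2 ^ b * φ x ^ 2 ≤ 2 * n * (∫ x, kinkW c x.2 ^ b * tanSq φ x)
      + 320 * (∫ x, kinkW c x.2 ^ b
        * (Strip.pderiv (Fin.last n) φ x + a * √2 * kinkV c x.2 * φ x) ^ 2)
      + 18 * (∫ x, kinkW c x.2 * φ x) ^ 2 := by
  have hw := continuous_kinkW c
  have hv := continuous_kinkV c
  have hwS : Continuous fun x : Strip n => kinkW c x.2 := hw.comp continuous_snd
  have hvS : Continuous fun x : Strip n => kinkV c x.2 := hv.comp continuous_snd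
  have hφc := h.continuous
  have hd := (h.pderiv (Fin.last n))
  have hdc := hd.continuous
  have hac := continuous_avg hφc
  have h1 := h.integral_sq_sub_avg_le (ρ := fun z => kinkW c z ^ b) (hw.pow b)
    fun z => pow_nonneg (kinkW_pos c z).le b
  have h2 := integral_kinkW_pow_mul_sq_le (c := c) (f := avg φ) h.hasDerivAt_avg
    (continuous_avg hdc) h.hasCompactSupport_avg hab ha hb
  have cint : ∀ {g : Strip n → ℝ}, Continuous g → (∀ x, x.2 ∉ slab φ → g x = 0) →
      Integrable g := by
    intro g hg hz
    refine hg.integrable_of_hasCompactSupport (HasCompactSupport.intro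
      (K := Set.univ ×ˢ slab φ) (isCompact_univ.prod h.isCompact_slab) fun x hx => hz x ?_)
    exact fun h' => hx ⟨trivial, h'⟩
  have zφ : ∀ x : Strip n, x.2 ∉ slab φ → φ x = 0 := fun x hx =>
    image_eq_zero_of_notMem_tsupport (notMem_tsupport_of_slab hx)
  have zd : ∀ x : Strip n, x.2 ∉ slab φ → Strip.pderiv (Fin.last n) φ x = 0 := fun x hx =>
    pderiv_eq_zero_of_notMem_tsupport (notMem_tsupport_of_slab hx)
  have za : ∀ z, z ∉ slab φ → avg φ z = 0 := fun z hz =>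
    integral_eq_zero_of_ae (Eventually.of_forall fun y => zφ (y, z) hz)
  have hacS : Continuous fun x : Strip n => avg φ x.2 := hac.comp continuous_snd
  have e1 : ∫ z, kinkW c z * avg φ z = ∫ x : Strip n, kinkW c x.2 * φ x := by
    rw [integral_eq_integral_avg (cint (by fun_prop) fun x hx => by rw [zφ x hx, mul_zero])]
    simp_rw [avg_mul_left]
  have e2 : ∫ z, kinkW c z ^ b * avg φ z ^ 2
      = ∫ x : Strip n, kinkW c x.2 ^ b * avg φ x.2 ^ 2 := by
    rw [integral_eq_integral_avg (cint (by fun_prop) fun x hx => by rw [za _ hx]; simp)]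
    simp [avg]
  set g : Strip n → ℝ :=
    fun x => Strip.pderiv (Fin.last n) φ x + a * √2 * kinkV c x.2 * φ x with hg
  have hgc : Continuous g := by fun_prop
  have ig : Integrable fun x : Strip n => kinkW c x.2 ^ b * g x ^ 2 :=
    cint (by fun_prop) fun x hx => by simp [hg, zφ x hx, zd x hx]
  have e3 : ∀ z, avg (Strip.pderiv (Fin.last n) φ) z + a * √2 * kinkV c z * avg φ z
      = avg g z := by
    intro z
    have hsl : ∀ {ψ : Strip n → ℝ}, Continuous ψ → Integrable fun y => ψ (y, z) := fun hψ =>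
      integrable_of_continuous_torus (hψ.comp (continuous_id.prodMk continuous_const))
    simp only [avg, hg]
    rw [integral_add (hsl hdc) ((hsl hφc).const_mul _), integral_const_mul]
  have e4 : ∫ z, kinkW c z ^ b * (avg (Strip.pderiv (Fin.last n) φ) z
      + a * √2 * kinkV c z * avg φ z) ^ 2 ≤ ∫ x : Strip n, kinkW c x.2 ^ b * g x ^ 2 := by
    simp_rw [e3]
    rw [integral_eq_integral_avg ig]
    simp_rw [avg_mul_left (fun z => kinkW c z ^ b)]
    have hga := continuous_avg hgc
    have hga2 := continuous_avg (hgc.pow 2)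
    refine integral_mono ?_ ?_ fun z =>
      mul_le_mul_of_nonneg_left (avg_sq_le hgc z) (pow_nonneg (kinkW_pos c z).le b)
    · refine Continuous.integrable_of_hasCompactSupport (by fun_prop)
        (HasCompactSupport.intro h.isCompact_slab fun z hz => ?_)
      have : avg g z = 0 := integral_eq_zero_of_ae
        (Eventually.of_forall fun y => by simp [hg, zφ (y, z) hz, zd (y, z) hz])
      simp [this]
    · refine Continuous.integrable_of_hasCompactSupport ((hw.pow b).mul hga2)
        (HasCompactSupport.intro h.isCompact_slab fun z hz => ?_)
      have : avg (fun x => g x ^ 2) z = 0 := integral_eq_zero_of_ae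
        (Eventually.of_forall fun y => by simp [hg, zφ (y, z) hz, zd (y, z) hz])
      simp [this]
  have e5 : ∫ x : Strip n, kinkW c x.2 ^ b * φ x ^ 2
      ≤ ∫ x : Strip n, (2 * (kinkW c x.2 ^ b * (φ x - avg φ x.2) ^ 2)
        + 2 * (kinkW c x.2 ^ b * avg φ x.2 ^ 2)) := by
    refine integral_mono (cint (by fun_prop) fun x hx => by simp [zφ x hx])
      (cint (by fun_prop) fun x hx => by simp [zφ x hx, za _ hx]) fun x => ?_
    have := mul_nonneg (pow_nonneg (kinkW_pos c x.2).le b)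
      (sq_nonneg (φ x - 2 * avg φ x.2))
    simp only
    nlinarith
  rw [integral_add ((cint (by fun_prop) fun x hx => by simp [zφ x hx, za _ hx]))
    ((cint (by fun_prop) fun x hx => by simp [za _ hx])), integral_const_mul,
    integral_const_mul] at e5
  rw [e1, e2] at h2
  nlinarith

end Strip

/-! ### Integrable functions of vanishing integral -/

/-- `Z` is integrable with vanishing integral. -/
def NullInt {α : Type*} [MeasureSpace α] (Z : α → ℝ) : Prop := Integrable Z ∧ ∫ x, Z x = 0

namespace NullInt

variable {α : Type*} [MeasureSpace α] {Z Z' p q : α → ℝ}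

lemma add (h : NullInt Z) (h' : NullInt Z') : NullInt fun x => Z x + Z' x :=
  ⟨h.1.add h'.1, by rw [integral_add h.1 h'.1, h.2, h'.2, add_zero]⟩

lemma const_mul (h : NullInt Z) (a : ℝ) : NullInt fun x => a * Z x :=
  ⟨h.1.const_mul a, by rw [integral_const_mul, h.2, mul_zero]⟩

lemma sum {ι : Type*} {s : Finset ι} {Z : ι → α → ℝ} (h : ∀ i ∈ s, NullInt (Z i)) :
    NullInt fun x => ∑ i ∈ s, Z i x :=
  ⟨integrable_finsetSum _ fun i hi => (h i hi).1, by
    rw [integral_finsetSum _ fun i hi => (h i hi).1]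
    exact Finset.sum_eq_zero fun i hi => (h i hi).2⟩

/-- Integrations by parts are collected in Z, so that an integral inequality reduces to a pointwise
one. -/
lemma integral_le (h : NullInt Z) (hp : Integrable p) (hq : Integrable q)
    (hle : ∀ᵐ x, p x ≤ q x + Z x) : ∫ x, p x ≤ ∫ x, q x := by
  have := integral_mono_ae hp (hq.add h.1) hle
  simp only [Pi.add_apply] at this
  rwa [integral_add hq h.1, h.2, add_zero] at this

end NullInt

namespace Strip

variable {n : ℕ}

/-! ### Algebra of Sobolev functions -/

/-- `1` in the direction of the last variable and `0` otherwise. -/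
def lastInd (i : Fin (n + 1)) : ℝ := if i = Fin.last n then 1 else 0

@[simp] lemma lastInd_last : lastInd (Fin.last n) = 1 := by simp [lastInd]

@[simp] lemma lastInd_castSucc (i : Fin n) : lastInd i.castSucc = 0 := by
  simp [lastInd, Fin.castSucc_ne_last]

lemma HasGrad.congr {f f' : Strip n → ℝ} {g g' : Fin (n + 1) → Strip n → ℝ} (h : HasGrad f g)
    (hf : f =ᵐ[volume] f') (hg : ∀ i, g i =ᵐ[volume] g' i) : HasGrad f' g' where
  memLp := (memLp_congr_ae hf).1 h.memLp
  grad_memLp i := (memLp_congr_ae (hg i)).1 (h.grad_memLp i)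
  weak i := (h.weak i).congr hf (hg i)

lemma HasGrad.add {f f' : Strip n → ℝ} {g g' : Fin (n + 1) → Strip n → ℝ} (h : HasGrad f g)
    (h' : HasGrad f' g') : HasGrad (fun x => f x + f' x) (fun i x => g i x + g' i x) where
  memLp := h.memLp.add h'.memLp
  grad_memLp i := (h.grad_memLp i).add (h'.grad_memLp i)
  weak i := (h.weak i).add (h'.weak i)

lemma HasGrad.const_mul {f : Strip n → ℝ} {g : Fin (n + 1) → Strip n → ℝ} (h : HasGrad f g)
    (a : ℝ) : HasGrad (fun x => a * f x) (fun i x => a * g i x) where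
  memLp := h.memLp.const_mul a
  grad_memLp i := (h.grad_memLp i).const_mul a
  weak i := (h.weak i).const_mul a

lemma HasGrad.sum {ι : Type*} {s : Finset ι} {f : ι → Strip n → ℝ}
    {g : ι → Fin (n + 1) → Strip n → ℝ} (h : ∀ j ∈ s, HasGrad (f j) (g j)) :
    HasGrad (fun x => ∑ j ∈ s, f j x) (fun i x => ∑ j ∈ s, g j i x) where
  memLp := memLp_finsetSum s fun j hj => (h j hj).memLp
  grad_memLp i := memLp_finsetSum s fun j hj => (h j hj).grad_memLp i
  weak i := HasWeakDeriv.sum s fun j hj => (h j hj).weak i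

lemma pderiv_profile {η η' : ℝ → ℝ} (hd : ∀ z, HasDerivAt η (η' z) z) (i : Fin (n + 1))
    (x : Strip n) : pderiv i (fun x : Strip n => η x.2) x = lastInd i * η' x.2 := by
  induction i using Fin.lastCases with
  | last => rw [pderiv_comp_snd_last, (hd x.2).deriv]; simp
  | cast i => rw [pderiv_comp_snd_castSucc]; simp

/-- The product of a Sobolev function with a smooth function of the last variable. -/
lemma HasGrad.profile_mul {f : Strip n → ℝ} {g : Fin (n + 1) → Strip n → ℝ} (h : HasGrad f g)
    {η η' : ℝ → ℝ} (hη : ContDiff ℝ ∞ η) (hd : ∀ z, HasDerivAt η (η' z) z) {M M' : ℝ}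
    (hM : ∀ z, |η z| ≤ M) (hM' : ∀ z, |η' z| ≤ M') :
    HasGrad (fun x => η x.2 * f x)
      (fun i x => lastInd i * η' x.2 * f x + η x.2 * g i x) := by
  have hc : Continuous fun x : Strip n => η x.2 := hη.continuous.comp continuous_snd
  have hd' : η' = deriv η := funext fun z => (hd z).deriv.symm
  have hc' : Continuous fun x : Strip n => η' x.2 := by
    rw [hd']; exact (hη.continuous_deriv (by simp)).comp continuous_snd
  refine ⟨memLp_bdd_mul h.memLp hc.aestronglyMeasurable (Eventually.of_forall fun x => hM _),
    fun i => MemLp.add ?_ ?_, fun i => ?_⟩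
  · refine memLp_bdd_mul (M := 1 * M') h.memLp
      (continuous_const.mul hc').aestronglyMeasurable (Eventually.of_forall fun x => ?_)
    rw [abs_mul]
    refine mul_le_mul ?_ (hM' _) (abs_nonneg _) zero_le_one
    unfold lastInd
    split_ifs <;> simp
  · exact memLp_bdd_mul (h.grad_memLp i) hc.aestronglyMeasurable
      (Eventually.of_forall fun x => hM _)
  · have := (h.weak i).isSmooth_mul (isSmooth_comp_snd (n := n) hη)
    simp_rw [pderiv_profile hd] at this
    exact this

lemma HasGrad.kinkV_mul {f : Strip n → ℝ} {g : Fin (n + 1) → Strip n → ℝ} (h : HasGrad f g)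
    (c : ℝ) : HasGrad (fun x => kinkV c x.2 * f x)
      (fun i x => lastInd i * kinkW c x.2 * f x + kinkV c x.2 * g i x) :=
  h.profile_mul (contDiff_kinkV c) (hasDerivAt_kinkV c) (abs_kinkV_le_one c) (abs_kinkW_le_one c)

lemma abs_sqrt_two_mul_le (c z : ℝ) : |-(√2 * kinkV c z * kinkW c z)| ≤ √2 * 1 * 1 := by
  rw [abs_neg, abs_mul, abs_mul, abs_of_nonneg (Real.sqrt_nonneg 2)]
  gcongr
  exacts [abs_kinkV_le_one c z, abs_kinkW_le_one c z]

lemma HasGrad.kinkW_mul {f : Strip n → ℝ} {g : Fin (n + 1) → Strip n → ℝ} (h : HasGrad f g)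
    (c : ℝ) : HasGrad (fun x => kinkW c x.2 * f x)
      (fun i x => lastInd i * (-(√2 * kinkV c x.2 * kinkW c x.2)) * f x + kinkW c x.2 * g i x) :=
  h.profile_mul (contDiff_kinkW c) (hasDerivAt_kinkW c) (abs_kinkW_le_one c)
    (abs_sqrt_two_mul_le c)

lemma aesm_profile {η : ℝ → ℝ} (hη : Continuous η) :
    AEStronglyMeasurable (fun x : Strip n => η x.2) volume :=
  (hη.comp continuous_snd).aestronglyMeasurable

lemma integrable_profile {η : ℝ → ℝ} (h : Integrable η) :
    Integrable fun x : Strip n => η x.2 :=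
  h.comp_snd (volume : Measure (Fin n → UnitAddCircle))

lemma integral_profile {η : ℝ → ℝ} (h : Integrable η) :
    ∫ x : Strip n, η x.2 = ∫ z, η z := by
  rw [integral_eq_integral_avg (integrable_profile h)]
  simp [avg]

lemma memLp_profile_kinkW {η : ℝ → ℝ} (hη : Continuous η) {M : ℝ} (c : ℝ)
    (hM : ∀ z, |η z| ≤ M) : MemLp (fun x : Strip n => η x.2 * kinkW c x.2) 2 := by
  refine memLp_bdd_mul ?_ (hη.comp continuous_snd).aestronglyMeasurable
    (Eventually.of_forall fun x => hM _)
  rw [memLp_two_iff_integrable_sq (aesm_profile (continuous_kinkW c))]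
  exact integrable_profile (integrable_kinkW_pow c one_le_two)

lemma memLp_kinkW (c : ℝ) : MemLp (fun x : Strip n => kinkW c x.2) 2 := by
  simpa using memLp_profile_kinkW (n := n) (η := fun _ => 1) continuous_const (M := 1) c (by simp)

lemma hasGrad_kinkW (c : ℝ) : HasGrad (fun x : Strip n => kinkW c x.2)
    (fun i x => lastInd i * (-(√2 * kinkV c x.2 * kinkW c x.2))) where
  memLp := memLp_kinkW c
  grad_memLp i := by
    have := (memLp_profile_kinkW (n := n) (continuous_kinkV c) c (abs_kinkV_le_one c)).const_mul
      (-(lastInd i * √2))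
    refine (memLp_congr_ae (Eventually.of_forall fun x => ?_)).1 this
    ring
  weak i := by
    have := (isSmooth_comp_snd (n := n) (contDiff_kinkW c)).hasWeakDeriv i
    exact this.congr (ae_eq_refl _) (Eventually.of_forall fun x =>
      pderiv_profile (hasDerivAt_kinkW c) i x)

lemma HasGrad.nullInt_mul {a b : Strip n → ℝ} {ga gb : Fin (n + 1) → Strip n → ℝ}
    (ha : HasGrad a ga) (hb : HasGrad b gb) (i : Fin (n + 1)) :
    NullInt fun x => a x * gb i x + ga i x * b x := by
  have i1 := ha.memLp.integrable_mul_two (hb.grad_memLp i)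
  have i2 := (ha.grad_memLp i).integrable_mul_two hb.memLp
  refine ⟨i1.add i2, ?_⟩
  rw [integral_add i1 i2, ha.integral_mul_eq hb]
  ring

/-- For H¹ functions this replaces two integrations by parts. Applied to the gradients of φ, it
gives ∫ |∇²φ|² = ∫ (Δφ)² without third derivatives. -/
lemma HasGrad.nullInt_swap {a b : Strip n → ℝ} {ga gb : Fin (n + 1) → Strip n → ℝ}
    (ha : HasGrad a ga) (hb : HasGrad b gb) (i j : Fin (n + 1)) :
    NullInt fun x => ga i x * gb j x - ga j x * gb i x := by
  have i1 := (ha.grad_memLp i).integrable_mul_two (hb.grad_memLp j)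
  have i2 := (ha.grad_memLp j).integrable_mul_two (hb.grad_memLp i)
  refine ⟨i1.sub i2, ?_⟩
  rw [integral_sub i1 i2, ha.integral_grad_mul_grad hb, sub_self]

/-! ### The Poincaré inequality for Sobolev functions -/

lemma kinkW_pow_abs_le (c z : ℝ) (b : ℕ) : |kinkW c z ^ b| ≤ 1 := by
  rw [abs_of_nonneg (pow_nonneg (kinkW_pos c z).le b)]
  exact pow_le_one₀ (kinkW_pos c z).le (kinkW_le_one c z)

lemma integrable_kinkW_pow_mul_sq {f : Strip n → ℝ} (hf : MemLp f 2) (c : ℝ) (b : ℕ) :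
    Integrable fun x => kinkW c x.2 ^ b * f x ^ 2 := by
  have h1 := memLp_bdd_mul hf (aesm_profile ((continuous_kinkW c).pow b))
    (Eventually.of_forall fun x : Strip n => kinkW_pow_abs_le c x.2 b)
  refine (h1.integrable_mul_two hf).congr (Eventually.of_forall fun x => ?_)
  simp only [Pi.pow_apply]
  ring

/-- All terms are continuous in H¹, so the bound passes from test functions to the limit. The factor
8 is 2n at n = 4. -/
lemma HasGrad.poincare {f : Strip n → ℝ} {g : Fin (n + 1) → Strip n → ℝ} (h : HasGrad f g)
    (hn : n ≤ 4) (c : ℝ) {a b : ℕ} (hab : 1 ≤ 2 * a + b) (ha : a ≤ 1) (hb : b ≤ 1) :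
    ∫ x, kinkW c x.2 ^ b * f x ^ 2 ≤
      (∫ x, (8 * (∑ i : Fin n, kinkW c x.2 ^ b * g i.castSucc x ^ 2)
        + 320 * (kinkW c x.2 ^ b * (g (Fin.last n) x + a * √2 * kinkV c x.2 * f x) ^ 2)))
      + 18 * (∫ x, kinkW c x.2 * f x) ^ 2 := by
  obtain ⟨φ, hφ, h0, h1⟩ := h.exists_test
  have hw := continuous_kinkW c
  have hv := continuous_kinkV c
  have sqlim : ∀ {u : ℕ → Strip n → ℝ} {v : Strip n → ℝ}, L2Tendsto u v →
      (∀ N, MemLp (u N) 2) → MemLp v 2 →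
      Tendsto (fun N => ∫ x, kinkW c x.2 ^ b * u N x ^ 2) atTop
        (𝓝 (∫ x, kinkW c x.2 ^ b * v x ^ 2)) := by
    intro u v huv hu hv
    have hwu : ∀ {v : Strip n → ℝ}, MemLp v 2 → MemLp (fun x => kinkW c x.2 ^ b * v x) 2 :=
      fun hv => memLp_bdd_mul hv (aesm_profile (hw.pow b))
        (Eventually.of_forall fun x => kinkW_pow_abs_le c x.2 b)
    have := (huv.bdd_const_mul (η := fun x : Strip n => kinkW c x.2 ^ b)
      fun x => kinkW_pow_abs_le c x.2 b).integral_mul huv (fun N => hwu (hu N)) (hwu hv) hu hv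
    refine (this.congr fun N => ?_).trans (le_of_eq ?_)
    · congr 1; ext x; ring
    · congr 2; ext x; ring
  have mφ : ∀ N, MemLp (φ N) 2 := fun N => (hφ N).memLp 2
  have mp : ∀ i N, MemLp (pderiv i (φ N)) 2 := fun i N => ((hφ N).pderiv i).memLp 2
  have t1 := sqlim h0 mφ h.memLp
  have t2 := fun i : Fin n => sqlim (h1 i.castSucc) (mp _) (h.grad_memLp _)
  have hvb : ∀ x : Strip n, |a * √2 * kinkV c x.2| ≤ a * √2 * 1 := fun x => by
    rw [abs_mul, abs_of_nonneg (by positivity : (0 : ℝ) ≤ a * √2)]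
    gcongr
    exact abs_kinkV_le_one c _
  have hvm : ∀ {v : Strip n → ℝ}, MemLp v 2 → MemLp (fun x => a * √2 * kinkV c x.2 * v x) 2 :=
    fun h => memLp_bdd_mul h (aesm_profile (n := n) (η := fun z => a * √2 * kinkV c z)
      (by fun_prop)) (Eventually.of_forall hvb)
  have t3 := sqlim ((h1 (Fin.last n)).add (h0.bdd_const_mul hvb) (mp _) (h.grad_memLp _)
    (fun N => hvm (mφ N)) (hvm h.memLp)) (fun N => (mp _ N).add (hvm (mφ N)))
    ((h.grad_memLp _).add (hvm h.memLp))
  have t4 := (L2Tendsto.const (fun x : Strip n => kinkW c x.2)).integral_mul h0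
    (fun _ => memLp_kinkW c) (memLp_kinkW c) mφ h.memLp
  have iT : ∀ i : Fin n, Integrable fun x => kinkW c x.2 ^ b * g i.castSucc x ^ 2 := fun i =>
    integrable_kinkW_pow_mul_sq (h.grad_memLp _) c b
  have iA : Integrable fun x => kinkW c x.2 ^ b
      * (g (Fin.last n) x + a * √2 * kinkV c x.2 * f x) ^ 2 :=
    integrable_kinkW_pow_mul_sq ((h.grad_memLp _).add (hvm h.memLp)) c b
  rw [integral_add ((integrable_finsetSum _ fun i _ => iT i).const_mul 8) (iA.const_mul 320),
    integral_const_mul, integral_const_mul, integral_finsetSum _ fun i _ => iT i]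
  refine le_of_tendsto_of_tendsto' t1 ((((tendsto_finsetSum _ fun i _ => t2 i).const_mul 8).add
    (t3.const_mul 320)).add ((t4.pow 2).const_mul 18)) fun N => ?_
  have key := (hφ N).poincare c hab ha hb
  have e : ∫ x : Strip n, kinkW c x.2 ^ b * tanSq (φ N) x
      = ∑ i : Fin n, ∫ x, kinkW c x.2 ^ b * pderiv i.castSucc (φ N) x ^ 2 := by
    rw [← integral_finsetSum _ fun i _ => integrable_kinkW_pow_mul_sq (mp _ N) c b]
    congr 1
    ext x
    rw [tanSq, Finset.mul_sum]
  rw [e] at key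
  have hn' : (n : ℝ) ≤ 4 := by exact_mod_cast hn
  have h0 : 0 ≤ ∑ i : Fin n, ∫ x, kinkW c x.2 ^ b * pderiv i.castSucc (φ N) x ^ 2 :=
    Finset.sum_nonneg fun i _ => integral_nonneg fun x =>
      mul_nonneg (pow_nonneg (kinkW_pos c x.2).le b) (sq_nonneg _)
  nlinarith

end Strip

lemma NullInt.congr {α : Type*} [MeasureSpace α] {Z Z' : α → ℝ} (h : NullInt Z)
    (he : ∀ᵐ x, Z' x = Z x) : NullInt Z' :=
  ⟨h.1.congr (Filter.EventuallyEq.symm he), by rw [integral_congr_ae he, h.2]⟩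

namespace Strip

variable {n : ℕ}

/-! ### Coercivity of the linearized operator -/

section Coercive

variable {φ r : Strip n → ℝ} {g : Fin (n + 1) → Strip n → ℝ}
  {g2 : Fin (n + 1) → Fin (n + 1) → Strip n → ℝ}

lemma integrable_sum_sq {ι : Type*} [Fintype ι] {g : ι → Strip n → ℝ} (hg : ∀ i, MemLp (g i) 2) :
    Integrable fun x => ∑ i, g i x ^ 2 :=
  integrable_finsetSum _ fun i _ => (hg i).integrable_sq

lemma memLp_sqrt_two_kinkV_mul {f : Strip n → ℝ} (hf : MemLp f 2) (c : ℝ) :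
    MemLp (fun x => √2 * kinkV c x.2 * f x) 2 := by
  refine memLp_bdd_mul (M := √2 * 1) hf (aesm_profile (n := n) (η := fun z => √2 * kinkV c z)
    (continuous_const.mul (continuous_kinkV c))) (Eventually.of_forall fun x => ?_)
  rw [abs_mul, abs_of_nonneg (Real.sqrt_nonneg 2)]
  gcongr
  exact abs_kinkV_le_one c _

/-- The spectral gap of the linearized operator. -/
lemma HasGrad.integral_sq_le (h : HasGrad φ g) (hn : n ≤ 4) (c : ℝ) :
    ∃ Z, NullInt Z ∧ (∀ x, Z x = √2 * (2 * kinkV c x.2 * φ x * g (Fin.last n) x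
        + kinkW c x.2 * φ x ^ 2)) ∧
      ∫ x, φ x ^ 2 ≤ (∫ x, (8 * (∑ i : Fin n, g i.castSucc x ^ 2)
        + 320 * (g (Fin.last n) x + √2 * kinkV c x.2 * φ x) ^ 2))
        + 18 * (∫ x, kinkW c x.2 * φ x) ^ 2 := by
  -- This Z is ∂_z (√2 v φ²). With A = ∂_z + √2 v it satisfies (A φ)² = (∂_z φ)² + (3v² - 1) φ² + Z,
  -- which turns the factored form into the quadratic form of L.
  refine ⟨_, (((h.kinkV_mul c).nullInt_mul h (Fin.last n)).const_mul √2), fun x => ?_, ?_⟩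
  · simp only [lastInd_last]
    ring
  · have := h.poincare hn c (a := 1) (b := 0) (by norm_num) le_rfl (by norm_num)
    simpa using this

/-- With r = Lφ, the pairing ∫ r φ equals ∫ |∇'φ|² + ∫ (Aφ)². The spectral gap bounds ∫ φ² by 320 ∫
r φ plus the projection term, and 320 r φ ≤ φ²/2 + 51200 r² is absorbed. -/
lemma HasGrad.h1_estimate (hn : n ≤ 4) (c : ℝ) (h : HasGrad φ g)
    (h2 : ∀ i, HasGrad (g i) (g2 i)) (hrm : MemLp r 2)
    (hr : ∀ᵐ x, r x = -∑ i, g2 i i x + (3 * kinkV c x.2 ^ 2 - 1) * φ x) :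
    ∫ x, φ x ^ 2 ≤ 102400 * (∫ x, r x ^ 2) + 36 * (∫ x, kinkW c x.2 * φ x) ^ 2 := by
  obtain ⟨Z1, hZ1, hZ1e, hP⟩ := h.integral_sq_le hn c
  have hZ2 : NullInt fun x => ∑ i, (φ x * g2 i i x + g i x * g i x) :=
    NullInt.sum fun i _ => h.nullInt_mul (h2 i) i
  have ip : Integrable fun x => 8 * (∑ i : Fin n, g i.castSucc x ^ 2)
      + 320 * (g (Fin.last n) x + √2 * kinkV c x.2 * φ x) ^ 2 :=
    ((integrable_sum_sq fun i : Fin n => h.grad_memLp i.castSucc).const_mul 8).add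
      (((h.grad_memLp _).add (memLp_sqrt_two_kinkV_mul h.memLp c)).integrable_sq.const_mul 320)
  have iφ := h.memLp.integrable_sq
  have ir := hrm.integrable_sq
  have key := ((hZ2.const_mul 320).add (hZ1.const_mul 320)).integral_le ip
    ((iφ.const_mul (1 / 2)).add (ir.const_mul 51200)) (by
      filter_upwards [hr] with x hx
      rw [hZ1e]
      have hw := sqrt_two_mul_kinkW c x.2
      have hs : √2 ^ 2 = 2 := Real.sq_sqrt (by norm_num)
      have hT : 0 ≤ ∑ i : Fin n, g i.castSucc x ^ 2 := Finset.sum_nonneg fun i _ => sq_nonneg _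
      have e1 : ∑ i, (φ x * g2 i i x + g i x * g i x) = φ x * (∑ i, g2 i i x)
          + (∑ i : Fin n, g i.castSucc x ^ 2) + g (Fin.last n) x ^ 2 := by
        rw [Finset.sum_add_distrib, ← Finset.mul_sum, Fin.sum_univ_castSucc (fun i => g i x * g i x)]
        simp_rw [sq]
        ring
      simp only [Pi.add_apply]
      rw [e1]
      set S := ∑ i, g2 i i x
      set T := ∑ i : Fin n, g i.castSucc x ^ 2
      set p := φ x
      set v := kinkV c x.2
      set w := kinkW c x.2
      set y := g (Fin.last n) x
      have e2 : 320 * (y + √2 * v * p) ^ 2 = 320 * y ^ 2 + 640 * √2 * v * p * y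
          + 640 * v ^ 2 * p ^ 2 := by
        linear_combination 320 * v ^ 2 * p ^ 2 * hs
      have e3 : 320 * (√2 * (2 * v * p * y + w * p ^ 2)) = 640 * √2 * v * p * y
          + 320 * (1 - v ^ 2) * p ^ 2 := by
        linear_combination 320 * p ^ 2 * hw
      rw [e2, e3]
      have hS : S = (3 * v ^ 2 - 1) * p - r x := by rw [hx]; ring
      rw [hS]
      nlinarith [sq_nonneg (p - 320 * r x)])
  have key' : ∫ x, (8 * (∑ i : Fin n, g i.castSucc x ^ 2)
      + 320 * (g (Fin.last n) x + √2 * kinkV c x.2 * φ x) ^ 2)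
      ≤ 1 / 2 * (∫ x, φ x ^ 2) + 51200 * ∫ x, r x ^ 2 := by
    refine key.trans (le_of_eq ?_)
    rw [← integral_const_mul, ← integral_const_mul,
      ← integral_add (iφ.const_mul _) (ir.const_mul _)]
    rfl
  linarith

/-- Elliptic regularity by hand: ∫ |∇φ|² = -∫ φ Δφ and ∫ |∇²φ|² = ∫ (Δφ)², while Δφ = (3v² - 1) φ -
r is bounded by φ and r. The L² bound on φ is `h1_estimate`. -/
lemma HasGrad.h2_estimate (hn : n ≤ 4) (c : ℝ) (h : HasGrad φ g)
    (h2 : ∀ i, HasGrad (g i) (g2 i)) (hsym : ∀ i j, g2 i j =ᵐ[volume] g2 j i) (hrm : MemLp r 2)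
    (hr : ∀ᵐ x, r x = -∑ i, g2 i i x + (3 * kinkV c x.2 ^ 2 - 1) * φ x) :
    ∫ x, (φ x ^ 2 + ∑ i, g i x ^ 2 + ∑ i, ∑ j, g2 i j x ^ 2)
      ≤ 1400000 * (∫ x, r x ^ 2) + 500 * (∫ x, kinkW c x.2 * φ x) ^ 2 := by
  have h1 := h.h1_estimate hn c h2 hrm hr
  have hZ2 : NullInt fun x => ∑ i, (φ x * g2 i i x + g i x * g i x) :=
    NullInt.sum fun i _ => h.nullInt_mul (h2 i) i
  have hZ3 : NullInt fun x => ∑ i, ∑ j, (g2 i j x * g2 j i x - g2 i i x * g2 j j x) :=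
    NullInt.sum fun i _ => NullInt.sum fun j _ => (h2 i).nullInt_swap (h2 j) j i
  have iφ := h.memLp.integrable_sq
  have ir := hrm.integrable_sq
  have ip : Integrable fun x => φ x ^ 2 + ∑ i, g i x ^ 2 + ∑ i, ∑ j, g2 i j x ^ 2 :=
    (iφ.add (integrable_sum_sq h.grad_memLp)).add
      (integrable_finsetSum _ fun i _ => integrable_sum_sq (h2 i).grad_memLp)
  have hsym' : ∀ᵐ x, ∀ i j, g2 i j x = g2 j i x :=
    ae_all_iff.2 fun i => ae_all_iff.2 fun j => hsym i j
  have key := (hZ2.add hZ3).integral_le ip ((iφ.const_mul (27 / 2)).add (ir.const_mul 3)) (by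
    filter_upwards [hr, hsym'] with x hx hs
    have e1 : ∑ i, (φ x * g2 i i x + g i x * g i x) = φ x * (∑ i, g2 i i x)
        + ∑ i, g i x ^ 2 := by
      rw [Finset.sum_add_distrib, ← Finset.mul_sum]
      simp_rw [sq]
    have e2 : ∑ i, ∑ j, (g2 i j x * g2 j i x - g2 i i x * g2 j j x)
        = (∑ i, ∑ j, g2 i j x ^ 2) - (∑ i, g2 i i x) ^ 2 := by
      simp_rw [Finset.sum_sub_distrib]
      rw [sq (∑ i, g2 i i x), Finset.sum_mul_sum]
      congr 1
      refine Finset.sum_congr rfl fun i _ => Finset.sum_congr rfl fun j _ => ?_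
      rw [hs j i, sq]
    simp only [Pi.add_apply]
    rw [e1, e2]
    have hv := kinkV_sq_lt_one c x.2
    have hv0 := sq_nonneg (kinkV c x.2)
    set S := ∑ i, g2 i i x
    set p := φ x
    set v := kinkV c x.2
    have hS : S = (3 * v ^ 2 - 1) * p - r x := by rw [hx]; ring
    have h4 : ((3 * v ^ 2 - 1) * p) ^ 2 ≤ 4 * p ^ 2 := by
      rw [mul_pow]
      refine mul_le_mul_of_nonneg_right ?_ (sq_nonneg _)
      nlinarith
    have h5 : S ^ 2 ≤ 8 * p ^ 2 + 2 * r x ^ 2 := by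
      rw [hS]
      nlinarith [sq_nonneg ((3 * v ^ 2 - 1) * p + r x)]
    nlinarith [sq_nonneg (p + S)])
  have key' : ∫ x, (φ x ^ 2 + ∑ i, g i x ^ 2 + ∑ i, ∑ j, g2 i j x ^ 2)
      ≤ 27 / 2 * (∫ x, φ x ^ 2) + 3 * ∫ x, r x ^ 2 := by
    refine key.trans (le_of_eq ?_)
    rw [← integral_const_mul, ← integral_const_mul,
      ← integral_add (iφ.const_mul _) (ir.const_mul _)]
    rfl
  have h0 : 0 ≤ ∫ x, r x ^ 2 := integral_nonneg fun x => sq_nonneg _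
  nlinarith [sq_nonneg (∫ x, kinkW c x.2 * φ x)]

end Coercive

/-! ### The linearized operator -/

/-- The weak derivatives of `f ∈ H³(S)` up to order three. -/
structure IsJet (f : Strip n → ℝ) (F : Fin (n + 1) → Strip n → ℝ)
    (F2 : Fin (n + 1) → Fin (n + 1) → Strip n → ℝ)
    (F3 : Fin (n + 1) → Fin (n + 1) → Fin (n + 1) → Strip n → ℝ) : Prop where
  grad : HasGrad f F
  grad1 : ∀ i, HasGrad (F i) (F2 i)
  grad2 : ∀ i j, HasGrad (F2 i j) (F3 i j)
  symm_right : ∀ i j k, F3 i j k =ᵐ[volume] F3 i k j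
  symm_left : ∀ i j k, F3 i j k =ᵐ[volume] F3 j i k

lemma MemSobolev.isJet {f : Strip n → ℝ} (h : MemSobolev 3 f) :
    IsJet f (fun i => Strip.weakDeriv i f) (fun i j => Strip.weakDeriv j (Strip.weakDeriv i f))
      (fun i j k => Strip.weakDeriv k (Strip.weakDeriv j (Strip.weakDeriv i f))) where
  grad := h.hasGrad
  grad1 i := (h.weakDeriv i).hasGrad
  grad2 i j := ((h.weakDeriv i).weakDeriv j).hasGrad
  symm_right i j k := (h.weakDeriv i).weakDeriv_comm k j
  symm_left i j k := ((((h.weakDeriv j).weakDeriv i).hasWeakDeriv k).congr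
    (h.weakDeriv_comm i j) (ae_eq_refl _)).weakDeriv_ae

section Linear

variable {f : Strip n → ℝ} {F : Fin (n + 1) → Strip n → ℝ}
  {F2 : Fin (n + 1) → Fin (n + 1) → Strip n → ℝ}
  {F3 : Fin (n + 1) → Fin (n + 1) → Fin (n + 1) → Strip n → ℝ}

/-- The linearized operator `-Δ + (3 v_c² - 1)` applied to a function with Hessian `F2`. -/
def linOp (c : ℝ) (f : Strip n → ℝ) (F2 : Fin (n + 1) → Fin (n + 1) → Strip n → ℝ)
    (x : Strip n) : ℝ := -∑ j, F2 j j x + (3 * kinkV c x.2 ^ 2 - 1) * f x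

/-- The gradient of `linOp`. -/
def gradLinOp (c : ℝ) (f : Strip n → ℝ) (F : Fin (n + 1) → Strip n → ℝ)
    (F3 : Fin (n + 1) → Fin (n + 1) → Fin (n + 1) → Strip n → ℝ) (i : Fin (n + 1))
    (x : Strip n) : ℝ :=
  -∑ j, F3 j j i x + (lastInd i * (6 * kinkV c x.2 * kinkW c x.2) * f x
    + (3 * kinkV c x.2 ^ 2 - 1) * F i x)

lemma HasGrad.well_mul {f : Strip n → ℝ} {g : Fin (n + 1) → Strip n → ℝ} (h : HasGrad f g)
    (c : ℝ) : HasGrad (fun x => (3 * kinkV c x.2 ^ 2 - 1) * f x)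
      (fun i x => lastInd i * (6 * kinkV c x.2 * kinkW c x.2) * f x
        + (3 * kinkV c x.2 ^ 2 - 1) * g i x) := by
  refine h.profile_mul (η := fun z => 3 * kinkV c z ^ 2 - 1)
    (η' := fun z => 6 * kinkV c z * kinkW c z) (M := 2) (M' := 6 * 1 * 1)
    ((contDiff_const.mul ((contDiff_kinkV c).pow 2)).sub contDiff_const) (fun z => ?_)
    (fun z => ?_) (fun z => ?_)
  · refine HasDerivAt.congr_deriv ((((hasDerivAt_kinkV c z).fun_pow 2).const_mul 3).sub_const 1) ?_
    push_cast
    ring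
  · have h1 := kinkV_sq_lt_one c z
    have h2 := sq_nonneg (kinkV c z)
    exact abs_le.2 ⟨by linarith, by linarith⟩
  · rw [abs_mul, abs_mul, abs_of_nonneg (by norm_num : (0 : ℝ) ≤ 6)]
    gcongr
    exacts [abs_kinkV_le_one c z, abs_kinkW_le_one c z]

lemma IsJet.hasGrad_linOp (h : IsJet f F F2 F3) (c : ℝ) :
    HasGrad (linOp c f F2) (gradLinOp c f F F3) := by
  have h1 := (HasGrad.sum (s := Finset.univ) fun j _ => h.grad2 j j).const_mul (-1)
  refine (h1.add (h.grad.well_mul c)).congr (Eventually.of_forall fun x => ?_)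
    fun i => Eventually.of_forall fun x => ?_
  · simp only [linOp]; ring
  · simp only [gradLinOp]; ring

/-- The linearized operator commutes with derivatives up to a lower order term. -/
lemma IsJet.gradLinOp_ae (h : IsJet f F F2 F3) (c : ℝ) (i : Fin (n + 1)) :
    ∀ᵐ x, gradLinOp c f F F3 i x - lastInd i * (6 * kinkV c x.2 * kinkW c x.2) * f x
      = -∑ j, F3 i j j x + (3 * kinkV c x.2 ^ 2 - 1) * F i x := by
  -- Two adjacent transpositions of the derivatives move the index i to the front.
  have hs : ∀ᵐ x, ∀ j, F3 j j i x = F3 i j j x := ae_all_iff.2 fun j =>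
    (h.symm_right j j i).trans (h.symm_left j i j)
  filter_upwards [hs] with x hx
  simp only [gradLinOp, hx]
  ring

/-- L is symmetric and Lw = 0; this is translation invariance of the equation for the kink. -/
lemma IsJet.integral_kinkW_mul_linOp (h : IsJet f F F2 F3) (c : ℝ) :
    ∫ x, kinkW c x.2 * linOp c f F2 x = 0 := by
  have hw := hasGrad_kinkW (n := n) c
  have hZ1 : NullInt fun x => ∑ j, (kinkW c x.2 * F2 j j x
      + lastInd j * (-(√2 * kinkV c x.2 * kinkW c x.2)) * F j x) :=
    NullInt.sum fun j _ => hw.nullInt_mul (h.grad1 j) j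
  have hZ2 := ((hw.kinkV_mul c).const_mul (-√2)).nullInt_mul h.grad (Fin.last n)
  refine (((hZ1.const_mul (-1)).add hZ2).congr (Eventually.of_forall fun x => ?_)).2
  have e1 : ∑ j, (kinkW c x.2 * F2 j j x
      + lastInd j * (-(√2 * kinkV c x.2 * kinkW c x.2)) * F j x)
      = kinkW c x.2 * (∑ j, F2 j j x) - √2 * kinkV c x.2 * kinkW c x.2 * F (Fin.last n) x := by
    rw [Finset.sum_add_distrib, ← Finset.mul_sum,
      Fin.sum_univ_castSucc (fun j => lastInd j * (-(√2 * kinkV c x.2 * kinkW c x.2)) * F j x)]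
    simp
    ring
  simp only [linOp, lastInd_last, e1]
  have hws := sqrt_two_mul_kinkW c x.2
  have hs : √2 ^ 2 = 2 := Real.sq_sqrt (by norm_num)
  linear_combination (kinkW c x.2 * f x) * hws - kinkV c x.2 ^ 2 * kinkW c x.2 * f x * hs

end Linear

end Strip

namespace Strip

variable {n : ℕ}

/-! ### The linear estimate -/

/-- The case a = 0, b = 1. It is applied both to f and to q = Lf, and stands in for an L² bound that
first derivatives cannot give on the unbounded strip. -/
lemma HasGrad.weighted_poincare {f : Strip n → ℝ} {g : Fin (n + 1) → Strip n → ℝ}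
    (h : HasGrad f g) (hn : n ≤ 4) (c : ℝ) (h0 : ∫ x, kinkW c x.2 * f x = 0) :
    ∫ x, kinkW c x.2 * f x ^ 2 ≤ 320 * ∫ x, ∑ i, g i x ^ 2 := by
  have key := h.poincare hn c (a := 0) (b := 1) (by norm_num) (by norm_num) le_rfl
  simp only [pow_one, h0, Nat.cast_zero, zero_mul, add_zero, ne_eq, OfNat.ofNat_ne_zero,
    not_false_eq_true, zero_pow, mul_zero] at key
  refine key.trans ?_
  rw [← integral_const_mul]
  have iw : ∀ i, Integrable fun x => kinkW c x.2 * g i x ^ 2 := fun i => by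
    simpa using integrable_kinkW_pow_mul_sq (h.grad_memLp i) c 1
  refine integral_mono (((integrable_finsetSum _ fun i _ => iw _).const_mul 8).add
    ((iw _).const_mul 320)) ((integrable_sum_sq h.grad_memLp).const_mul 320) fun x => ?_
  beta_reduce
  have hw : ∀ i, kinkW c x.2 * g i x ^ 2 ≤ g i x ^ 2 := fun i =>
    mul_le_of_le_one_left (sq_nonneg _) (kinkW_le_one c _)
  have hs : ∑ i : Fin n, kinkW c x.2 * g i.castSucc x ^ 2 ≤ ∑ i : Fin n, g i.castSucc x ^ 2 :=
    Finset.sum_le_sum fun i _ => hw _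
  have h0 : 0 ≤ ∑ i : Fin n, g i.castSucc x ^ 2 := Finset.sum_nonneg fun i _ => sq_nonneg _
  rw [Fin.sum_univ_castSucc (fun i => g i x ^ 2)]
  linarith [hw (Fin.last n)]

section Linear

variable {f : Strip n → ℝ} {F : Fin (n + 1) → Strip n → ℝ}
  {F2 : Fin (n + 1) → Fin (n + 1) → Strip n → ℝ}
  {F3 : Fin (n + 1) → Fin (n + 1) → Fin (n + 1) → Strip n → ℝ}

lemma HasGrad.integral_kinkW_mul_tangential (h : HasGrad f F) (c : ℝ) (i : Fin n) :
    ∫ x, kinkW c x.2 * F i.castSucc x = 0 := by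
  have := (hasGrad_kinkW (n := n) c).nullInt_mul h i.castSucc
  simpa using this.2

/-- Weighted bound for `∂_z f + √2 v f`, on which the dual factorization of the linearized
operator is coercive. -/
lemma IsJet.integral_kinkW_mul_factor_sq (h : IsJet f F F2 F3) (hn : n ≤ 4) (c : ℝ) :
    ∫ x, kinkW c x.2 * (F (Fin.last n) x + √2 * kinkV c x.2 * f x) ^ 2
      ≤ 1282 * ∫ x, ∑ i, gradLinOp c f F F3 i x ^ 2 := by
  have hq := h.hasGrad_linOp c
  have hwq := hq.weighted_poincare hn c (h.integral_kinkW_mul_linOp c)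
  have hg : HasGrad (fun x => F (Fin.last n) x + √2 * kinkV c x.2 * f x)
      (fun j x => F2 (Fin.last n) j x + √2 * (lastInd j * (kinkW c x.2 * f x)
        + kinkV c x.2 * F j x)) :=
    ((h.grad1 (Fin.last n)).add ((h.grad.kinkV_mul c).const_mul √2)).congr
      (Eventually.of_forall fun x => by ring) fun i => Eventually.of_forall fun x => by ring
  have hG : ∀ j, HasGrad (fun x => F2 (Fin.last n) j x + √2 * (lastInd j * (kinkW c x.2 * f x)
        + kinkV c x.2 * F j x)) _ := fun j =>
    (h.grad2 (Fin.last n) j).add ((((h.grad.kinkW_mul c).const_mul (lastInd j)).add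
      ((h.grad1 j).kinkV_mul c)).const_mul √2)
  -- The null term is the divergence of w g ∇g for g = ∂_z f + √2 v f, that is, the equation for g
  -- tested with w g.
  have hZ := NullInt.sum (s := Finset.univ) fun j _ => (hg.kinkW_mul c).nullInt_mul (hG j) j
  have iq : Integrable fun x => kinkW c x.2 * linOp c f F2 x ^ 2 := by
    simpa using integrable_kinkW_pow_mul_sq hq.memLp c 1
  have ig : Integrable fun x => kinkW c x.2
      * (F (Fin.last n) x + √2 * kinkV c x.2 * f x) ^ 2 := by
    simpa using integrable_kinkW_pow_mul_sq hg.memLp c 1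
  have iQ := integrable_sum_sq hq.grad_memLp
  have key := (hZ.const_mul 2).integral_le ig ((iQ.const_mul 2).add (iq.const_mul 4)) (by
    filter_upwards [h.gradLinOp_ae c (Fin.last n)] with x hx
    have hQ : gradLinOp c f F F3 (Fin.last n) x ^ 2 ≤ ∑ i, gradLinOp c f F F3 i x ^ 2 :=
      Finset.single_le_sum (f := fun i => gradLinOp c f F F3 i x ^ 2) (fun i _ => sq_nonneg _)
        (Finset.mem_univ _)
    set G1 : Fin (n + 1) → ℝ := fun j => F2 (Fin.last n) j x
      + √2 * (lastInd j * (kinkW c x.2 * f x) + kinkV c x.2 * F j x) with hG1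
    have hG1s : G1 (Fin.last n) ^ 2 ≤ ∑ j, G1 j ^ 2 :=
      Finset.single_le_sum (f := fun j => G1 j ^ 2) (fun i _ => sq_nonneg _) (Finset.mem_univ _)
    have hwp := kinkW_pos c x.2
    have hw1 := kinkW_le_one c x.2
    have hws := sqrt_two_mul_kinkW c x.2
    have hv := kinkV_sq_lt_one c x.2
    have hs : √2 ^ 2 = 2 := Real.sq_sqrt (by norm_num)
    simp only [Pi.add_apply]
    have e : ∀ j, (kinkW c x.2 * (F (Fin.last n) x + √2 * kinkV c x.2 * f x)
          * (F3 (Fin.last n) j j x + √2 * (lastInd j * (lastInd j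
            * (-(√2 * kinkV c x.2 * kinkW c x.2)) * f x + kinkW c x.2 * F j x)
            + (lastInd j * kinkW c x.2 * F j x + kinkV c x.2 * F2 j j x)))
        + (lastInd j * (-(√2 * kinkV c x.2 * kinkW c x.2))
            * (F (Fin.last n) x + √2 * kinkV c x.2 * f x)
          + kinkW c x.2 * (F2 (Fin.last n) j x
            + √2 * (lastInd j * (kinkW c x.2 * f x) + kinkV c x.2 * F j x)))
          * (F2 (Fin.last n) j x
            + √2 * (lastInd j * (kinkW c x.2 * f x) + kinkV c x.2 * F j x)))
        = kinkW c x.2 * (F (Fin.last n) x + √2 * kinkV c x.2 * f x)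
            * (F3 (Fin.last n) j j x + √2 * kinkV c x.2 * F2 j j x)
          + lastInd j * (kinkW c x.2 * (F (Fin.last n) x + √2 * kinkV c x.2 * f x)
            * √2 * (2 * kinkW c x.2 * F j x
              - lastInd j * (√2 * kinkV c x.2 * kinkW c x.2) * f x - kinkV c x.2 * G1 j))
          + kinkW c x.2 * G1 j ^ 2 := fun j => by
      simp only [hG1]
      ring
    simp only [e]
    rw [Finset.sum_add_distrib, Finset.sum_add_distrib, ← Finset.mul_sum, ← Finset.mul_sum,
      Finset.sum_add_distrib, ← Finset.mul_sum,
      Fin.sum_univ_castSucc (fun j => lastInd j * _)]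
    simp only [lastInd_castSucc, lastInd_last, zero_mul, Finset.sum_const_zero, zero_add, one_mul]
    simp only [lastInd_last, one_mul] at hx
    have hq' : linOp c f F2 x = -∑ j, F2 j j x + (3 * kinkV c x.2 ^ 2 - 1) * f x := rfl
    set q := linOp c f F2 x
    set R := gradLinOp c f F F3 (Fin.last n) x
    set S3 := ∑ j, F3 (Fin.last n) j j x
    set S2 := ∑ j, F2 j j x
    set T := ∑ j, G1 j ^ 2
    set SQ := ∑ i, gradLinOp c f F F3 i x ^ 2
    set y := F (Fin.last n) x
    set p := f x
    set t := G1 (Fin.last n)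
    set v := kinkV c x.2
    set w := kinkW c x.2
    set s := √2
    clear_value q R S3 S2 T SQ y p t v w s
    set g := y + s * v * p with hgd
    -- This is the equation Δg = (1 + v²) g - (∂_z q + √2 v q), with the remaining term coming from
    -- ∂_z w. The term 1 + v² leaves room to absorb that remainder, since √2 v g t ≤ v² g²/2 + t².
    have e1 : w * g * (S3 + s * v * S2) + w * g * s * (2 * w * y - s * v * w * p - v * t)
        = -(w * g * (R + s * v * q)) + w * (1 + v ^ 2) * g ^ 2 - s * v * w * g * t := by
      have : S3 + s * v * S2 + s * (2 * w * y - s * v * w * p) + (R + s * v * q)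
          = (1 + v ^ 2) * g := by
        rw [hgd]
        linear_combination s * v * hq' + hx + (2 * y + 2 * s * v * p) * hws - 3 * v * w * p * hs
      linear_combination w * g * this
    have e2 : w * (s * v * g * t) ≤ w * (v ^ 2 * g ^ 2 / 2 + t ^ 2) := by
      refine mul_le_mul_of_nonneg_left ?_ hwp.le
      have h1 := sq_nonneg (s * v * g - 2 * t)
      have h2 : (s * v * g - 2 * t) ^ 2 = 2 * (v ^ 2 * g ^ 2) - 4 * (s * v * g * t) + 4 * t ^ 2 := by
        linear_combination v ^ 2 * g ^ 2 * hs
      linarith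
    have e3 : w * t ^ 2 ≤ w * T := mul_le_mul_of_nonneg_left hG1s hwp.le
    have e4 : w * (g * (R + s * v * q)) ≤ w * (g ^ 2 / 2 + (R + s * v * q) ^ 2 / 2) :=
      mul_le_mul_of_nonneg_left (by linarith [sq_nonneg (g - (R + s * v * q))]) hwp.le
    have e5 : w * (R + s * v * q) ^ 2 ≤ w * (2 * R ^ 2 + 4 * q ^ 2) := by
      refine mul_le_mul_of_nonneg_left ?_ hwp.le
      have h1 := sq_nonneg (R - s * v * q)
      have h2 : (s * v * q) ^ 2 ≤ 2 * q ^ 2 := by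
        have : (s * v * q) ^ 2 = 2 * (v ^ 2 * q ^ 2) := by linear_combination v ^ 2 * q ^ 2 * hs
        rw [this]
        have := mul_le_of_le_one_left (sq_nonneg q) hv.le
        linarith
      nlinarith
    have e6 : w * R ^ 2 ≤ R ^ 2 := mul_le_of_le_one_left (sq_nonneg _) hw1
    have e7 : 0 ≤ w * (v ^ 2 * g ^ 2) := by positivity
    nlinarith)
  have key' : ∫ x, kinkW c x.2 * (F (Fin.last n) x + √2 * kinkV c x.2 * f x) ^ 2
      ≤ 2 * (∫ x, ∑ i, gradLinOp c f F F3 i x ^ 2)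
        + 4 * ∫ x, kinkW c x.2 * linOp c f F2 x ^ 2 := by
    refine key.trans (le_of_eq ?_)
    rw [← integral_const_mul, ← integral_const_mul,
      ← integral_add (iQ.const_mul _) (iq.const_mul _)]
    rfl
  linarith

/-- Tangential derivatives commute with L, as v depends on z only, and are orthogonal to w. Hence
`h2_estimate` has no projection term. -/
lemma IsJet.tangential_estimate (h : IsJet f F F2 F3) (hn : n ≤ 4) (c : ℝ) (i : Fin n) :
    ∫ x, (F i.castSucc x ^ 2 + ∑ j, F2 i.castSucc j x ^ 2 + ∑ j, ∑ k, F3 i.castSucc j k x ^ 2)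
      ≤ 1400000 * ∫ x, gradLinOp c f F F3 i.castSucc x ^ 2 := by
  have := (h.grad1 i.castSucc).h2_estimate hn c (h.grad2 i.castSucc)
    (h.symm_right i.castSucc) ((h.hasGrad_linOp c).grad_memLp i.castSucc)
    ((h.gradLinOp_ae c i.castSucc).mono fun x hx => by simpa using hx)
  rw [h.grad.integral_kinkW_mul_tangential c i] at this
  linarith

lemma IsJet.tangential_sq_estimate (h : IsJet f F F2 F3) (hn : n ≤ 4) (c : ℝ) (i : Fin n) :
    ∫ x, F i.castSucc x ^ 2 ≤ 102400 * ∫ x, gradLinOp c f F F3 i.castSucc x ^ 2 := by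
  have := (h.grad1 i.castSucc).h1_estimate hn c (h.grad2 i.castSucc)
    ((h.hasGrad_linOp c).grad_memLp i.castSucc)
    ((h.gradLinOp_ae c i.castSucc).mono fun x hx => by simpa using hx)
  rw [h.grad.integral_kinkW_mul_tangential c i] at this
  linarith

lemma integral_sum_univ_castSucc {g : Fin (n + 1) → Strip n → ℝ} (hg : ∀ i, Integrable (g i)) :
    ∫ x, ∑ i, g i x = (∑ i : Fin n, ∫ x, g i.castSucc x) + ∫ x, g (Fin.last n) x := by
  rw [integral_finsetSum _ fun i _ => hg i, Fin.sum_univ_castSucc]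

/-- The decisive weighted bound: the case a = b = 1 of the Poincaré inequality, with tangential
derivatives and the factor ∂_z f + √2 v f already controlled by ∇Lf. -/
lemma IsJet.integral_kinkW_mul_sq (h : IsJet f F F2 F3) (hn : n ≤ 4) (c : ℝ)
    (h0 : ∫ x, kinkW c x.2 * f x = 0) :
    ∫ x, kinkW c x.2 * f x ^ 2 ≤ 1300000 * ∫ x, ∑ i, gradLinOp c f F F3 i x ^ 2 := by
  have key := h.grad.poincare hn c (a := 1) (b := 1) (by norm_num) le_rfl le_rfl
  simp only [pow_one, h0, Nat.cast_one, one_mul, ne_eq, OfNat.ofNat_ne_zero,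
    not_false_eq_true, zero_pow, mul_zero, add_zero] at key
  have iw : ∀ i, Integrable fun x => kinkW c x.2 * F i x ^ 2 := fun i => by
    simpa using integrable_kinkW_pow_mul_sq (h.grad.grad_memLp i) c 1
  have ig : Integrable fun x => kinkW c x.2
      * (F (Fin.last n) x + √2 * kinkV c x.2 * f x) ^ 2 := by
    simpa using integrable_kinkW_pow_mul_sq
      ((h.grad.grad_memLp _).add (memLp_sqrt_two_kinkV_mul h.grad.memLp c)) c 1
  rw [integral_add ((integrable_finsetSum _ fun i _ => iw _).const_mul 8) (ig.const_mul 320),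
    integral_const_mul, integral_const_mul, integral_finsetSum _ fun i _ => iw _] at key
  have h1 := h.integral_kinkW_mul_factor_sq hn c
  have h2 : ∑ i : Fin n, ∫ x, kinkW c x.2 * F i.castSucc x ^ 2
      ≤ 102400 * ∑ i : Fin n, ∫ x, gradLinOp c f F F3 i.castSucc x ^ 2 := by
    rw [Finset.mul_sum]
    refine Finset.sum_le_sum fun i _ => le_trans ?_ (h.tangential_sq_estimate hn c i)
    exact integral_mono (iw _) (h.grad.grad_memLp _).integrable_sq fun x =>
      mul_le_of_le_one_left (sq_nonneg _) (kinkW_le_one c _)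
  have h3 := integral_sum_univ_castSucc
    fun i => ((h.hasGrad_linOp c).grad_memLp i).integrable_sq
  have h4 : 0 ≤ ∫ x, gradLinOp c f F F3 (Fin.last n) x ^ 2 := integral_nonneg fun x => sq_nonneg _
  have h5 : 0 ≤ ∑ i : Fin n, ∫ x, gradLinOp c f F F3 i.castSucc x ^ 2 :=
    Finset.sum_nonneg fun i _ => integral_nonneg fun x => sq_nonneg _
  linarith

/-- Integration by parts gives ∫ w ∂_z f = √2 ∫ v w f. Then Cauchy-Schwarz for the density w, of
mass 2, applies. -/
lemma HasGrad.sq_integral_kinkW_mul_last (h : HasGrad f F) (c : ℝ) :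
    (∫ x, kinkW c x.2 * F (Fin.last n) x) ^ 2 ≤ 4 * ∫ x, kinkW c x.2 * f x ^ 2 := by
  have hZ := (hasGrad_kinkW (n := n) c).nullInt_mul h (Fin.last n)
  have iV := memLp_sqrt_two_kinkV_mul h.memLp c
  have i1 := (memLp_kinkW (n := n) c).integrable_mul_two (h.grad_memLp (Fin.last n))
  have i2 := (memLp_kinkW (n := n) c).integrable_mul_two iV
  have e : ∫ x, kinkW c x.2 * F (Fin.last n) x = ∫ x, kinkW c x.2 * (√2 * kinkV c x.2 * f x) := by
    rw [← sub_eq_zero, ← integral_sub i1 i2, ← hZ.2]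
    congr 1
    ext x
    simp only [lastInd_last]
    ring
  have iw : Integrable fun x : Strip n => kinkW c x.2 := integrable_profile (integrable_kinkW c)
  have iwv : Integrable fun x => kinkW c x.2 * (√2 * kinkV c x.2 * f x) ^ 2 := by
    simpa using integrable_kinkW_pow_mul_sq iV c 1
  have iwf : Integrable fun x => kinkW c x.2 * f x ^ 2 := by
    simpa using integrable_kinkW_pow_mul_sq h.memLp c 1
  rw [e]
  refine (sq_integral_mul_le (fun x => (kinkW_pos c _).le) iw iwv i2).trans ?_
  rw [integral_profile (integrable_kinkW c), integral_kinkW]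
  have : ∫ x, kinkW c x.2 * (√2 * kinkV c x.2 * f x) ^ 2 ≤ ∫ x, 2 * (kinkW c x.2 * f x ^ 2) := by
    refine integral_mono iwv (iwf.const_mul 2) fun x => ?_
    have hs : √2 ^ 2 = 2 := Real.sq_sqrt (by norm_num)
    have hv := kinkV_sq_lt_one c x.2
    have hw := kinkW_pos c x.2
    have e : kinkW c x.2 * (√2 * kinkV c x.2 * f x) ^ 2
        = kinkV c x.2 ^ 2 * (2 * (kinkW c x.2 * f x ^ 2)) := by
      linear_combination kinkW c x.2 * kinkV c x.2 ^ 2 * f x ^ 2 * hs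
    simp only [e]
    exact mul_le_of_le_one_left (by positivity) hv.le
  rw [integral_const_mul] at this
  linarith

/-- Here L ∂_z f = ∂_z Lf - 6 v w f, and ∂_z f need not be orthogonal to w. Both defects are bounded
by ∫ w f², hence by `integral_kinkW_mul_sq`. -/
lemma IsJet.last_estimate (h : IsJet f F F2 F3) (hn : n ≤ 4) (c : ℝ)
    (h0 : ∫ x, kinkW c x.2 * f x = 0) :
    ∫ x, (F (Fin.last n) x ^ 2 + ∑ j, F2 (Fin.last n) j x ^ 2
        + ∑ j, ∑ k, F3 (Fin.last n) j k x ^ 2)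
      ≤ 10 ^ 15 * ∫ x, ∑ i, gradLinOp c f F F3 i x ^ 2 := by
  have hQ := (h.hasGrad_linOp c).grad_memLp
  have hvw : MemLp (fun x => 6 * kinkV c x.2 * kinkW c x.2 * f x) 2 := by
    refine memLp_bdd_mul (M := 6 * 1 * 1) h.grad.memLp
      (aesm_profile (n := n) (η := fun z => 6 * kinkV c z * kinkW c z)
        ((continuous_const.mul (continuous_kinkV c)).mul (continuous_kinkW c)))
      (Eventually.of_forall fun x => ?_)
    rw [abs_mul, abs_mul, abs_of_nonneg (by norm_num : (0 : ℝ) ≤ 6)]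
    gcongr
    exacts [abs_kinkV_le_one c _, abs_kinkW_le_one c _]
  have hr : MemLp (fun x => gradLinOp c f F F3 (Fin.last n) x
      - 6 * kinkV c x.2 * kinkW c x.2 * f x) 2 := (hQ _).sub hvw
  have key := (h.grad1 (Fin.last n)).h2_estimate hn c (h.grad2 (Fin.last n))
    (h.symm_right (Fin.last n)) hr
    ((h.gradLinOp_ae c (Fin.last n)).mono fun x hx => by simpa using hx)
  have h1 := h.grad.sq_integral_kinkW_mul_last c
  have h2 := h.integral_kinkW_mul_sq hn c h0
  have iwf : Integrable fun x => kinkW c x.2 * f x ^ 2 := by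
    simpa using integrable_kinkW_pow_mul_sq h.grad.memLp c 1
  have iQ := integrable_sum_sq hQ
  have h3 : ∫ x, (gradLinOp c f F F3 (Fin.last n) x - 6 * kinkV c x.2 * kinkW c x.2 * f x) ^ 2
      ≤ ∫ x, (2 * (∑ i, gradLinOp c f F F3 i x ^ 2) + 72 * (kinkW c x.2 * f x ^ 2)) := by
    refine integral_mono hr.integrable_sq ((iQ.const_mul 2).add (iwf.const_mul 72)) fun x => ?_
    have hQ : gradLinOp c f F F3 (Fin.last n) x ^ 2 ≤ ∑ i, gradLinOp c f F F3 i x ^ 2 :=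
      Finset.single_le_sum (f := fun i => gradLinOp c f F F3 i x ^ 2) (fun i _ => sq_nonneg _)
        (Finset.mem_univ _)
    have hv := kinkV_sq_lt_one c x.2
    have hw := kinkW_pos c x.2
    have hw1 := kinkW_le_one c x.2
    beta_reduce
    set R := gradLinOp c f F F3 (Fin.last n) x
    have e1 : kinkV c x.2 ^ 2 * kinkW c x.2 * (kinkW c x.2 * f x ^ 2) ≤ kinkW c x.2 * f x ^ 2 := by
      refine mul_le_of_le_one_left (by positivity) ?_
      nlinarith
    nlinarith [sq_nonneg (R + 6 * kinkV c x.2 * kinkW c x.2 * f x)]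
  rw [integral_add (iQ.const_mul 2) (iwf.const_mul 72), integral_const_mul,
    integral_const_mul] at h3
  have h4 : 0 ≤ ∫ x, ∑ i, gradLinOp c f F F3 i x ^ 2 :=
    integral_nonneg fun x => Finset.sum_nonneg fun i _ => sq_nonneg _
  linarith

/-- The dissipation of the linearized evolution controls all derivatives up to order three. -/
lemma IsJet.linear_estimate (h : IsJet f F F2 F3) (hn : n ≤ 4) (c : ℝ)
    (h0 : ∫ x, kinkW c x.2 * f x = 0) :
    ∫ x, ∑ i, (F i x ^ 2 + ∑ j, F2 i j x ^ 2 + ∑ j, ∑ k, F3 i j k x ^ 2)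
      ≤ 10 ^ 16 * ∫ x, ∑ i, gradLinOp c f F F3 i x ^ 2 := by
  have hi : ∀ i, Integrable fun x => F i x ^ 2 + ∑ j, F2 i j x ^ 2 + ∑ j, ∑ k, F3 i j k x ^ 2 :=
    fun i => ((h.grad.grad_memLp i).integrable_sq.add
      (integrable_sum_sq (h.grad1 i).grad_memLp)).add
      (integrable_finsetSum _ fun j _ => integrable_sum_sq (h.grad2 i j).grad_memLp)
  rw [integral_sum_univ_castSucc hi]
  have h1 := h.last_estimate hn c h0
  have h2 := Finset.sum_le_sum fun i (_ : i ∈ Finset.univ) => h.tangential_estimate hn c i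
  rw [← Finset.mul_sum] at h2
  have h3 := integral_sum_univ_castSucc
    fun i => ((h.hasGrad_linOp c).grad_memLp i).integrable_sq
  have h4 : 0 ≤ ∫ x, gradLinOp c f F F3 (Fin.last n) x ^ 2 := integral_nonneg fun x => sq_nonneg _
  have h5 : 0 ≤ ∑ i : Fin n, ∫ x, gradLinOp c f F F3 i.castSucc x ^ 2 :=
    Finset.sum_nonneg fun i _ => integral_nonneg fun x => sq_nonneg _
  linarith

end Linear

end Strip

/-! ### Orthogonality for the closest kink -/

lemma Real.tanh_sub (x y : ℝ) :
    Real.tanh (x - y) = (Real.tanh x - Real.tanh y) / (1 - Real.tanh x * Real.tanh y) := by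
  have hx := (Real.cosh_pos x).ne'
  have hy := (Real.cosh_pos y).ne'
  have hxy := (Real.cosh_pos (x - y)).ne'
  rw [Real.cosh_sub] at hxy
  have h1 : 1 - Real.tanh x * Real.tanh y
      = (Real.cosh x * Real.cosh y - Real.sinh x * Real.sinh y) / (Real.cosh x * Real.cosh y) := by
    rw [Real.tanh_eq_sinh_div_cosh, Real.tanh_eq_sinh_div_cosh]
    field_simp
  rw [h1, Real.tanh_eq_sinh_div_cosh (x - y), Real.sinh_sub, Real.cosh_sub,
    Real.tanh_eq_sinh_div_cosh, Real.tanh_eq_sinh_div_cosh]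
  field_simp

lemma one_sub_kinkV_mul_ge {τ : ℝ} (hτ : |τ| ≤ 1 / 2) (c z : ℝ) :
    1 / 2 ≤ 1 - kinkV c z * τ := by
  have h : |kinkV c z * τ| ≤ 1 * (1 / 2) := by
    rw [abs_mul]
    exact mul_le_mul (abs_kinkV_le_one c z) hτ (abs_nonneg _) zero_le_one
  linarith [(abs_le.1 h).2]

/-- The shift √2 artanh τ turns the subtraction formula for tanh into an exact rational expression
in τ, so no differentiation under the integral is needed later. -/
lemma exists_kinkV_shift {τ : ℝ} (hτ : |τ| ≤ 1 / 2) (c : ℝ) :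
    ∃ c', ∀ z, kinkV c' z - kinkV c z = -(√2 * τ / (1 - kinkV c z * τ)) * kinkW c z := by
  refine ⟨c + √2 * Real.artanh τ, fun z => ?_⟩
  have hm : τ ∈ Set.Ioo (-1 : ℝ) 1 := by
    have := abs_le.1 hτ
    exact ⟨by linarith, by linarith⟩
  have hp := one_sub_kinkV_mul_ge hτ c z
  have hne : 1 - kinkV c z * τ ≠ 0 := by linarith
  have e : kinkV (c + √2 * Real.artanh τ) z = (kinkV c z - τ) / (1 - kinkV c z * τ) := by
    have : (z - (c + √2 * Real.artanh τ)) / √2 = (z - c) / √2 - Real.artanh τ := by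
      field_simp
      ring
    rw [kinkV, this, Real.tanh_sub, Real.tanh_artanh hm]
    rfl
  rw [e, div_sub' hne, neg_mul, div_mul_eq_mul_div, ← neg_div]
  congr 1
  linear_combination τ * sqrt_two_mul_kinkW c z

/-- If M ≠ 0, then τ = -M/(2(|M| + |B| + 1)) is admissible and makes the linear term dominate with
negative sign. -/
lemma eq_zero_of_forall_mul_add_sq_nonneg {M B : ℝ}
    (h : ∀ τ : ℝ, |τ| ≤ 1 / 2 → 0 ≤ τ * M + τ ^ 2 * B) : M = 0 := by
  by_contra hM
  have hM' := abs_pos.2 hM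
  have hD : 0 < 2 * (|M| + |B| + 1) := by positivity
  have key := h (-(M / (2 * (|M| + |B| + 1)))) (by
    rw [abs_neg, abs_div, abs_of_pos hD, div_le_div_iff₀ hD two_pos]
    nlinarith [abs_nonneg B])
  have h2 : -(M / (2 * (|M| + |B| + 1))) * M + (-(M / (2 * (|M| + |B| + 1)))) ^ 2 * B
      = M ^ 2 * (B - 2 * (|M| + |B| + 1)) / (2 * (|M| + |B| + 1)) ^ 2 := by
    field_simp
    ring
  rw [h2] at key
  have h3 : M ^ 2 * (B - 2 * (|M| + |B| + 1)) < 0 :=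
    mul_neg_of_pos_of_neg (by positivity) (by nlinarith [le_abs_self B, abs_nonneg B])
  exact absurd key (not_le.2 (div_neg_of_neg_of_pos h3 (by positivity)))

namespace Strip

variable {n : ℕ}

/-- First-order optimality: the squared distance to the shifted kink is ‖f‖² + 2√2 τ ∫ w f + O(τ²),
so the coefficient of τ must vanish. -/
lemma IsClosestKink.integral_kinkW_mul_eq_zero {u : Strip n → ℝ} {c : ℝ}
    (h : IsClosestKink u c) (hf : MemLp (u - kink n c) 2) :
    ∫ x, kinkW c x.2 * (u - kink n c) x = 0 := by
  set f := u - kink n c with hfd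
  have iwf := (memLp_kinkW (n := n) c).integrable_mul_two hf
  have iw2 := (memLp_kinkW (n := n) c).integrable_sq
  refine eq_zero_of_forall_mul_add_sq_nonneg
    (B := ∫ x, (2 * |kinkW c x.2 * f x| + 4 * kinkW c x.2 ^ 2)) fun τ hτ => ?_
  obtain ⟨c', hc'⟩ := exists_kinkV_shift hτ c
  have hη : Continuous fun z => √2 * τ / (1 - kinkV c z * τ) :=
    continuous_const.div (continuous_const.sub ((continuous_kinkV c).mul continuous_const))
      fun z => by linarith [one_sub_kinkV_mul_ge hτ c z]
  have hM : ∀ z, |√2 * τ / (1 - kinkV c z * τ)| ≤ √2 * |τ| / (1 / 2) := fun z => by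
    have hp := one_sub_kinkV_mul_ge hτ c z
    rw [abs_div, abs_mul, abs_of_nonneg (Real.sqrt_nonneg 2),
      abs_of_nonneg (by linarith : (0 : ℝ) ≤ 1 - kinkV c z * τ)]
    gcongr
  have hh := memLp_profile_kinkW (n := n) hη c hM
  have e : u - kink n c' = fun x => f x + √2 * τ / (1 - kinkV c x.2 * τ) * kinkW c x.2 := by
    ext x
    have := hc' x.2
    simp only [hfd, Pi.sub_apply]
    change u x - kinkV c' x.2 = u x - kinkV c x.2 + _
    linarith
  have hg : MemLp (fun x => f x + √2 * τ / (1 - kinkV c x.2 * τ) * kinkW c x.2) 2 := hf.add hh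
  have h1 := h c'
  rw [e, hf.eLpNorm_two_eq, hg.eLpNorm_two_eq, ENNReal.ofReal_le_ofReal_iff (Real.sqrt_nonneg _),
    Real.sqrt_le_sqrt_iff (integral_nonneg fun x => sq_nonneg _)] at h1
  have iA : Integrable fun x => 2 * |kinkW c x.2 * f x| + 4 * kinkW c x.2 ^ 2 :=
    (iwf.abs.const_mul 2).add (iw2.const_mul 4)
  have h2 : ∫ x, (f x + √2 * τ / (1 - kinkV c x.2 * τ) * kinkW c x.2) ^ 2
      ≤ ∫ x, (f x ^ 2 + (2 * √2 * τ * (kinkW c x.2 * f x)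
        + 2 * √2 * τ ^ 2 * (2 * |kinkW c x.2 * f x| + 4 * kinkW c x.2 ^ 2))) := by
    refine integral_mono hg.integrable_sq (hf.integrable_sq.add
      ((iwf.const_mul (2 * √2 * τ)).add (iA.const_mul (2 * √2 * τ ^ 2)))) fun x => ?_
    beta_reduce
    have hp := one_sub_kinkV_mul_ge hτ c x.2
    have hs : √2 ^ 2 = 2 := Real.sq_sqrt (by norm_num)
    have hs1 : 1 ≤ √2 := Real.one_le_sqrt.2 (by norm_num)
    have hv := abs_kinkV_le_one c x.2
    set D := 1 - kinkV c x.2 * τ with hD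
    have hD0 : D ≠ 0 := by linarith
    set w := kinkW c x.2
    have e1 : (f x + √2 * τ / D * w) ^ 2 = f x ^ 2 + 2 * √2 * τ * (w * f x)
        + 2 * √2 * τ ^ 2 * (kinkV c x.2 / D * (w * f x)) + 2 * τ ^ 2 * (w ^ 2 * (1 / D) ^ 2) := by
      -- This isolates the term linear in τ. The correction carries τ² and is bounded using 1/D ≤ 2.
      have : (1 : ℝ) / D = 1 + τ * (kinkV c x.2 / D) := by
        field_simp
        rw [hD]; ring
      have e2 : √2 * τ / D = √2 * τ * (1 / D) := by ring
      rw [e2]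
      have e3 : (f x + √2 * τ * (1 / D) * w) ^ 2 = f x ^ 2 + 2 * √2 * τ * (w * f x) * (1 / D)
        + 2 * τ ^ 2 * (w ^ 2 * (1 / D) ^ 2) := by
        linear_combination τ ^ 2 * (1 / D) ^ 2 * w ^ 2 * hs
      rw [e3]
      linear_combination 2 * √2 * τ * (w * f x) * this
    have hD2 : 0 ≤ 1 / D ∧ 1 / D ≤ 2 := by
      refine ⟨by positivity, ?_⟩
      rw [div_le_iff₀ (by linarith)]
      linarith
    have e4 : kinkV c x.2 / D * (w * f x) ≤ 2 * |w * f x| := by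
      refine (le_abs_self _).trans ?_
      rw [abs_mul]
      refine mul_le_mul_of_nonneg_right ?_ (abs_nonneg _)
      rw [div_eq_mul_one_div, abs_mul, abs_of_nonneg hD2.1]
      nlinarith [abs_nonneg (kinkV c x.2)]
    have e5 : w ^ 2 * (1 / D) ^ 2 ≤ √2 * (4 * w ^ 2) := by
      have : (1 / D) ^ 2 ≤ 4 := by nlinarith
      nlinarith [sq_nonneg w, mul_le_mul_of_nonneg_left this (sq_nonneg w)]
    rw [e1]
    have e6 := mul_le_mul_of_nonneg_left e4 (by positivity : (0 : ℝ) ≤ 2 * √2 * τ ^ 2)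
    have e7 := mul_le_mul_of_nonneg_left e5 (by positivity : (0 : ℝ) ≤ 2 * τ ^ 2)
    linarith
  have iB : Integrable fun x => 2 * √2 * τ * (kinkW c x.2 * f x)
      + 2 * √2 * τ ^ 2 * (2 * |kinkW c x.2 * f x| + 4 * kinkW c x.2 ^ 2) :=
    (iwf.const_mul (2 * √2 * τ)).add (iA.const_mul (2 * √2 * τ ^ 2))
  rw [integral_add hf.integrable_sq iB,
    integral_add (iwf.const_mul (2 * √2 * τ)) (iA.const_mul (2 * √2 * τ ^ 2)),
    integral_const_mul, integral_const_mul] at h2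
  have h3 := h1.trans h2
  have h4 : 0 ≤ (2 * √2) * (τ * (∫ x, kinkW c x.2 * f x)
      + τ ^ 2 * ∫ x, (2 * |kinkW c x.2 * f x| + 4 * kinkW c x.2 ^ 2)) := by
    linarith
  exact nonneg_of_mul_nonneg_right h4 (by positivity)

end Strip

namespace Strip

variable {n : ℕ}

/-! ### The energy gap -/

/-- The energy density of `v_c + f` relative to `v_c`, up to a null term. -/
def excess (c : ℝ) (f : Strip n → ℝ) (F : Fin (n + 1) → Strip n → ℝ) (x : Strip n) : ℝ :=
  1 / 2 * (∑ i, F i x ^ 2) + 1 / 2 * ((3 * kinkV c x.2 ^ 2 - 1) * f x ^ 2)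
    + (kinkV c x.2 * f x + f x ^ 2 / 4) * f x ^ 2

section Excess

variable {f : Strip n → ℝ} {F : Fin (n + 1) → Strip n → ℝ} {δ : ℝ}

lemma integrable_bdd_mul_sq {η : Strip n → ℝ} {M : ℝ} (hf : MemLp f 2)
    (hη : AEStronglyMeasurable η volume) (hM : ∀ᵐ x, |η x| ≤ M) :
    Integrable fun x => η x * f x ^ 2 :=
  ((memLp_bdd_mul hf hη hM).integrable_mul_two hf).congr
    (Eventually.of_forall fun x => by simp only; ring)

lemma integrable_well_mul_sq (hf : MemLp f 2) (c : ℝ) :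
    Integrable fun x => (3 * kinkV c x.2 ^ 2 - 1) * f x ^ 2 := by
  refine integrable_bdd_mul_sq (M := 2) hf (aesm_profile (n := n)
    (η := fun z => 3 * kinkV c z ^ 2 - 1)
    ((continuous_const.mul ((continuous_kinkV c).pow 2)).sub continuous_const))
    (Eventually.of_forall fun x => ?_)
  have h1 := kinkV_sq_lt_one c x.2
  have h2 := sq_nonneg (kinkV c x.2)
  exact abs_le.2 ⟨by linarith, by linarith⟩

lemma abs_kinkV_mul_add_sq_le {s : ℝ} (c z : ℝ) (hs : |s| ≤ δ) (hδ : δ ≤ 1) :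
    |kinkV c z * s + s ^ 2 / 4| ≤ 2 * δ := by
  have h1 : |kinkV c z * s| ≤ 1 * δ := by
    rw [abs_mul]
    exact mul_le_mul (abs_kinkV_le_one c z) hs (abs_nonneg _) zero_le_one
  have h2 : |s ^ 2 / 4| ≤ δ := by
    rw [abs_of_nonneg (by positivity), ← sq_abs]
    nlinarith [abs_nonneg s]
  linarith [abs_add_le (kinkV c z * s) (s ^ 2 / 4)]

lemma integrable_cubic (hf : MemLp f 2) (c : ℝ) (hδ : ∀ᵐ x, |f x| ≤ δ) (hδ1 : δ ≤ 1) :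
    Integrable fun x => (kinkV c x.2 * f x + f x ^ 2 / 4) * f x ^ 2 := by
  refine integrable_bdd_mul_sq (M := 2 * δ) hf
    (((aesm_profile (continuous_kinkV c)).mul hf.1).add ?_) ?_
  · simpa only [div_eq_mul_inv, Pi.pow_apply] using (hf.1.pow 2).mul_const (4 : ℝ)⁻¹
  · filter_upwards [hδ] with x hx using abs_kinkV_mul_add_sq_le c x.2 hx hδ1

lemma HasGrad.integrable_excess (h : HasGrad f F) (c : ℝ) (hδ : ∀ᵐ x, |f x| ≤ δ)
    (hδ1 : δ ≤ 1) : Integrable (excess c f F) :=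
  (((integrable_sum_sq h.grad_memLp).const_mul _).add
    ((integrable_well_mul_sq h.memLp c).const_mul _)).add (integrable_cubic h.memLp c hδ hδ1)

lemma HasGrad.integral_excess_le (h : HasGrad f F) (c : ℝ) (hδ : ∀ᵐ x, |f x| ≤ δ)
    (hδ1 : δ ≤ 1) : ∫ x, excess c f F x ≤ 3 * ∫ x, (f x ^ 2 + ∑ i, F i x ^ 2) := by
  rw [← integral_const_mul]
  refine integral_mono_ae (h.integrable_excess c hδ hδ1)
    ((h.memLp.integrable_sq.add (integrable_sum_sq h.grad_memLp)).const_mul 3) ?_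
  filter_upwards [hδ] with x hx
  have h1 := (abs_le.1 (abs_kinkV_mul_add_sq_le c x.2 hx hδ1)).2
  have h2 := kinkV_sq_lt_one c x.2
  have h3 : 0 ≤ ∑ i, F i x ^ 2 := Finset.sum_nonneg fun i _ => sq_nonneg _
  have h4 := mul_le_mul_of_nonneg_right h1 (sq_nonneg (f x))
  unfold excess
  nlinarith [sq_nonneg (f x)]

/-- The spectral gap bounds ∫ f² by 320 times the quadratic form. The cubic and quartic terms cost
at most 2δ ≤ 1/5000 of ∫ f², less than the available 1/640. The gradient is recovered from 3v² - 1 ≥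
-1. -/
lemma HasGrad.le_integral_excess (h : HasGrad f F) (hn : n ≤ 4) (c : ℝ)
    (h0 : ∫ x, kinkW c x.2 * f x = 0) (hδ : ∀ᵐ x, |f x| ≤ δ) (hδ1 : δ ≤ 1 / 10000) :
    ∫ x, (f x ^ 2 + ∑ i, F i x ^ 2) ≤ 3000 * ∫ x, excess c f F x := by
  have hδ2 : δ ≤ 1 := by linarith
  obtain ⟨Z, hZ, hZe, hP⟩ := h.integral_sq_le hn c
  have iS := integrable_sum_sq h.grad_memLp
  have iw := integrable_well_mul_sq h.memLp c
  have iφ := h.memLp.integrable_sq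
  have iE := h.integrable_excess c hδ hδ2
  have ip : Integrable fun x => 8 * (∑ i : Fin n, F i.castSucc x ^ 2)
      + 320 * (F (Fin.last n) x + √2 * kinkV c x.2 * f x) ^ 2 :=
    ((integrable_sum_sq fun i : Fin n => h.grad_memLp i.castSucc).const_mul 8).add
      (((h.grad_memLp _).add (memLp_sqrt_two_kinkV_mul h.memLp c)).integrable_sq.const_mul 320)
  have key := (hZ.const_mul 320).integral_le ip
    ((iS.const_mul 320).add (iw.const_mul 320)) (Eventually.of_forall fun x => by
      rw [hZe]
      have hw := sqrt_two_mul_kinkW c x.2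
      have hs : √2 ^ 2 = 2 := Real.sq_sqrt (by norm_num)
      have hT : 0 ≤ ∑ i : Fin n, F i.castSucc x ^ 2 := Finset.sum_nonneg fun i _ => sq_nonneg _
      simp only [Pi.add_apply]
      rw [Fin.sum_univ_castSucc (fun i => F i x ^ 2)]
      have e : (F (Fin.last n) x + √2 * kinkV c x.2 * f x) ^ 2 = F (Fin.last n) x ^ 2
          + (3 * kinkV c x.2 ^ 2 - 1) * f x ^ 2 + √2 * (2 * kinkV c x.2 * f x * F (Fin.last n) x
            + kinkW c x.2 * f x ^ 2) := by
        linear_combination kinkV c x.2 ^ 2 * f x ^ 2 * hs - f x ^ 2 * hw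
      rw [e]
      linarith)
  have key' : ∫ x, (8 * (∑ i : Fin n, F i.castSucc x ^ 2)
      + 320 * (F (Fin.last n) x + √2 * kinkV c x.2 * f x) ^ 2)
      ≤ 320 * (∫ x, ∑ i, F i x ^ 2) + 320 * ∫ x, (3 * kinkV c x.2 ^ 2 - 1) * f x ^ 2 := by
    refine key.trans (le_of_eq ?_)
    rw [← integral_const_mul, ← integral_const_mul,
      ← integral_add (iS.const_mul _) (iw.const_mul _)]
    rfl
  have h1 : - ∫ x, (3 * kinkV c x.2 ^ 2 - 1) * f x ^ 2 ≤ ∫ x, f x ^ 2 := by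
    rw [← integral_neg]
    refine integral_mono iw.neg iφ fun x => ?_
    beta_reduce
    nlinarith [sq_nonneg (f x), sq_nonneg (kinkV c x.2 * f x)]
  have h2 : 1 / 2 * (∫ x, ∑ i, F i x ^ 2) + 1 / 2 * (∫ x, (3 * kinkV c x.2 ^ 2 - 1) * f x ^ 2)
      - 1 / 5000 * (∫ x, f x ^ 2) ≤ ∫ x, excess c f F x := by
    have i1 : Integrable fun x => 1 / 2 * (∑ i, F i x ^ 2)
        + 1 / 2 * ((3 * kinkV c x.2 ^ 2 - 1) * f x ^ 2) := (iS.const_mul _).add (iw.const_mul _)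
    rw [← integral_const_mul, ← integral_const_mul, ← integral_const_mul,
      ← integral_add (iS.const_mul _) (iw.const_mul _), ← integral_sub i1 (iφ.const_mul _)]
    refine integral_mono_ae (i1.sub (iφ.const_mul _)) iE ?_
    filter_upwards [hδ] with x hx
    have h1 := (abs_le.1 (abs_kinkV_mul_add_sq_le c x.2 hx hδ2)).1
    have h4 := mul_le_mul_of_nonneg_right h1 (sq_nonneg (f x))
    have h5 := mul_le_mul_of_nonneg_right hδ1 (sq_nonneg (f x))
    simp only [excess]
    linarith
  have h3 : 0 ≤ ∫ x, f x ^ 2 := integral_nonneg fun x => sq_nonneg _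
  rw [h0] at hP
  rw [integral_add iφ iS]
  linarith

end Excess

lemma kinkEnergy_eq : kinkEnergy = 2 * √2 / 3 := by
  have e : ∀ s ∈ Set.uIcc (-1 : ℝ) 1, √(2 * doubleWell s) = √2 / 2 * (1 - s ^ 2) := by
    intro s hs
    rw [Set.uIcc_of_le (by norm_num)] at hs
    have h1 : 0 ≤ 1 - s ^ 2 := by nlinarith [hs.1, hs.2]
    have h2 : √2 ^ 2 = 2 := Real.sq_sqrt (by norm_num)
    rw [Real.sqrt_eq_iff_mul_self_eq (by unfold doubleWell; positivity) (by positivity),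
      doubleWell]
    linear_combination -(1 - s ^ 2) ^ 2 / 4 * h2
  rw [kinkEnergy, intervalIntegral.integral_congr e]
  simp
  ring

lemma hasWeakDeriv_kink (n : ℕ) (c : ℝ) (i : Fin (n + 1)) :
    HasWeakDeriv i (kink n c) (fun x => lastInd i * kinkW c x.2) :=
  ((isSmooth_comp_snd (n := n) (contDiff_kinkV c)).hasWeakDeriv i).congr (ae_eq_refl _)
    (Eventually.of_forall fun x => pderiv_profile (hasDerivAt_kinkV c) i x)

lemma HasGrad.hasWeakDeriv_of_sub_kink {u : Strip n → ℝ} {c : ℝ}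
    {F : Fin (n + 1) → Strip n → ℝ} (h : HasGrad (u - kink n c) F) (i : Fin (n + 1)) :
    HasWeakDeriv i u (fun x => lastInd i * kinkW c x.2 + F i x) :=
  ((hasWeakDeriv_kink n c i).add (h.weak i)).congr
    (Eventually.of_forall fun x => by simp) (ae_eq_refl _)

lemma gradSq_one (f : Strip n → ℝ) (x : Strip n) :
    gradSq 1 f x = ∑ i, weakDeriv i f x ^ 2 := rfl

/-- The energy density is w² + excess + ∂_z (w f). The first term integrates to m₀, because G(v) =
w²/2, and the last one to zero. -/
lemma HasGrad.energyGap_eq {u : Strip n → ℝ} {c δ : ℝ} {F : Fin (n + 1) → Strip n → ℝ}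
    (h : HasGrad (u - kink n c) F) (hδ : ∀ᵐ x, |(u - kink n c) x| ≤ δ) (hδ1 : δ ≤ 1) :
    energyGap u = ((∫ x, excess c (u - kink n c) F x : ℝ) : EReal) := by
  have hd := h.hasWeakDeriv_of_sub_kink
  set f := u - kink n c with hf
  have hZ := (hasGrad_kinkW (n := n) c).nullInt_mul h (Fin.last n)
  have iE := h.integrable_excess c hδ hδ1
  have iw2 := (memLp_kinkW (n := n) c).integrable_sq
  have iT : Integrable fun x => kinkW c x.2 ^ 2 + (excess c f F x
      + (kinkW c x.2 * F (Fin.last n) x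
        + lastInd (Fin.last n) * (-(√2 * kinkV c x.2 * kinkW c x.2)) * f x)) :=
    iw2.add (iE.add hZ.1)
  have hae : ∀ᵐ x, 1 / 2 * gradSq 1 u x + doubleWell (u x) = kinkW c x.2 ^ 2 + (excess c f F x
      + (kinkW c x.2 * F (Fin.last n) x
        + lastInd (Fin.last n) * (-(√2 * kinkV c x.2 * kinkW c x.2)) * f x)) := by
    have hall : ∀ᵐ x, ∀ i, weakDeriv i u x = lastInd i * kinkW c x.2 + F i x :=
      ae_all_iff.2 fun i => (hd i).weakDeriv_ae
    filter_upwards [hall] with x hx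
    have hu : u x = kinkV c x.2 + f x := by
      simp only [hf, Pi.sub_apply, kink, kinkV]; ring
    rw [gradSq_one]
    simp only [hx]
    have hs : √2 ^ 2 = 2 := Real.sq_sqrt (by norm_num)
    have hw := sqrt_two_mul_kinkW c x.2
    rw [hu]
    simp only [excess, doubleWell, Fin.sum_univ_castSucc, lastInd_last, lastInd_castSucc, zero_mul,
      zero_add, one_mul]
    set T := ∑ i : Fin n, F i.castSucc x ^ 2
    set v := kinkV c x.2
    set w := kinkW c x.2
    have hw2 : 2 * w ^ 2 = (1 - v ^ 2) ^ 2 := by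
      rw [← hw]
      linear_combination -w ^ 2 * hs
    linear_combination (-1 / 4) * hw2 + v * f x * hw
  have hnn : ∀ᵐ x, 0 ≤ kinkW c x.2 ^ 2 + (excess c f F x
      + (kinkW c x.2 * F (Fin.last n) x
        + lastInd (Fin.last n) * (-(√2 * kinkV c x.2 * kinkW c x.2)) * f x)) := by
    filter_upwards [hae] with x hx
    rw [← hx, gradSq_one, doubleWell]
    positivity
  have hI : ∫ x, (kinkW c x.2 ^ 2 + (excess c f F x + (kinkW c x.2 * F (Fin.last n) x
      + lastInd (Fin.last n) * (-(√2 * kinkV c x.2 * kinkW c x.2)) * f x)))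
      = 2 * √2 / 3 + ∫ x, excess c f F x := by
    have iT' : Integrable fun x => excess c f F x + (kinkW c x.2 * F (Fin.last n) x
        + lastInd (Fin.last n) * (-(√2 * kinkV c x.2 * kinkW c x.2)) * f x) := iE.add hZ.1
    rw [integral_add iw2 iT', integral_add iE hZ.1, hZ.2, add_zero,
      integral_profile (η := fun z => kinkW c z ^ 2) (integrable_kinkW_pow c one_le_two),
      integral_kinkW_sq]
  have hE : energy u = ENNReal.ofReal (2 * √2 / 3 + ∫ x, excess c f F x) := by
    rw [energy, if_pos fun i => (hd i).weakDiff,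
      lintegral_congr_ae (hae.mono fun x hx => by rw [hx]),
      ← ofReal_integral_eq_lintegral_ofReal iT hnn, hI]
  have hpos : 0 ≤ 2 * √2 / 3 + ∫ x, excess c f F x := hI ▸ integral_nonneg_of_ae hnn
  rw [energyGap, hE, kinkEnergy_eq, EReal.coe_ennreal_ofReal, max_eq_left hpos, ← EReal.coe_sub]
  congr 1
  ring

end Strip

namespace Strip

variable {n : ℕ}

/-! ### The dissipation -/

lemma HasGrad.mul_of_bdd {a b : Strip n → ℝ} {ga gb : Fin (n + 1) → Strip n → ℝ} {A B : ℝ}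
    (ha : HasGrad a ga) (hb : HasGrad b gb) (hA : ∀ᵐ x, |a x| ≤ A) (hB : ∀ᵐ x, |b x| ≤ B) :
    HasGrad (fun x => a x * b x) (fun i x => ga i x * b x + a x * gb i x) where
  memLp := memLp_bdd_mul hb.memLp ha.memLp.1 hA
  grad_memLp i := by
    have h1 := memLp_bdd_mul (ha.grad_memLp i) hb.memLp.1 hB
    have h2 := memLp_bdd_mul (hb.grad_memLp i) ha.memLp.1 hA
    refine (h1.add h2).ae_eq (Eventually.of_forall fun x => ?_)
    simp only [Pi.add_apply]
    ring
  weak i := ha.hasWeakDeriv_mul hb i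

/-- The gradient of the nonlinear part `3 v f² + f³` of the first variation at `v + f`. -/
def gradNonlin (c : ℝ) (f : Strip n → ℝ) (F : Fin (n + 1) → Strip n → ℝ) (i : Fin (n + 1))
    (x : Strip n) : ℝ :=
  3 * lastInd i * kinkW c x.2 * f x ^ 2 + (6 * kinkV c x.2 * f x + 3 * f x ^ 2) * F i x

section Nonlinear

variable {f : Strip n → ℝ} {F : Fin (n + 1) → Strip n → ℝ}
  {F2 : Fin (n + 1) → Fin (n + 1) → Strip n → ℝ}
  {F3 : Fin (n + 1) → Fin (n + 1) → Fin (n + 1) → Strip n → ℝ} {δ : ℝ}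

lemma HasGrad.hasGrad_nonlin (h : HasGrad f F) (c : ℝ) (hδ : ∀ᵐ x, |f x| ≤ δ) :
    HasGrad (fun x => 3 * kinkV c x.2 * f x ^ 2 + f x ^ 3) (gradNonlin c f F) := by
  have h2 := h.mul_of_bdd h hδ hδ
  have hδ2 : ∀ᵐ x, |f x * f x| ≤ δ * δ := by
    filter_upwards [hδ] with x hx
    rw [abs_mul]
    exact mul_le_mul hx hx (abs_nonneg _) ((abs_nonneg _).trans hx)
  refine (((h2.kinkV_mul c).const_mul 3).add (h2.mul_of_bdd h hδ2 hδ)).congr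
    (Eventually.of_forall fun x => ?_) fun i => Eventually.of_forall fun x => ?_
  · ring
  · simp only [gradNonlin]
    ring

/-- The only term without a derivative of f carries the weight w, so `weighted_poincare` bounds it
by ∇f. Each term is quadratic in f and yields a factor δ². -/
lemma HasGrad.integral_gradNonlin_sq_le (h : HasGrad f F) (hn : n ≤ 4) (c : ℝ)
    (h0 : ∫ x, kinkW c x.2 * f x = 0) (hδ : ∀ᵐ x, |f x| ≤ δ) (hδ1 : δ ≤ 1) :
    ∫ x, ∑ i, gradNonlin c f F i x ^ 2 ≤ 6000 * δ ^ 2 * ∫ x, ∑ i, F i x ^ 2 := by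
  have hw := h.weighted_poincare hn c h0
  have iw : Integrable fun x => kinkW c x.2 * f x ^ 2 := by
    simpa using integrable_kinkW_pow_mul_sq h.memLp c 1
  have iS := integrable_sum_sq h.grad_memLp
  have key : ∫ x, ∑ i, gradNonlin c f F i x ^ 2
      ≤ ∫ x, (18 * δ ^ 2 * (kinkW c x.2 * f x ^ 2) + 162 * δ ^ 2 * ∑ i, F i x ^ 2) := by
    refine integral_mono_ae (integrable_sum_sq (h.hasGrad_nonlin c hδ).grad_memLp)
      ((iw.const_mul _).add (iS.const_mul _)) ?_
    filter_upwards [hδ] with x hx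
    have hwp := kinkW_pos c x.2
    have hw1 := kinkW_le_one c x.2
    have hδ0 := (abs_nonneg _).trans hx
    have hf2 : f x ^ 2 ≤ δ ^ 2 := sq_le_sq' (abs_le.1 hx).1 (abs_le.1 hx).2
    have ha : (6 * kinkV c x.2 * f x + 3 * f x ^ 2) ^ 2 ≤ 81 * δ ^ 2 := by
      have h1 : |6 * kinkV c x.2 * f x + 3 * f x ^ 2| ≤ 9 * δ := by
        have h3 : |6 * kinkV c x.2 * f x| ≤ 6 * δ := by
          rw [abs_mul, abs_mul, abs_of_nonneg (by norm_num : (0 : ℝ) ≤ 6)]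
          have := mul_le_mul (abs_kinkV_le_one c x.2) hx (abs_nonneg _) zero_le_one
          linarith
        have h4 : |3 * f x ^ 2| ≤ 3 * δ := by
          rw [abs_of_nonneg (by positivity)]
          nlinarith
        linarith [abs_add_le (6 * kinkV c x.2 * f x) (3 * f x ^ 2)]
      have := sq_le_sq' (abs_le.1 h1).1 (abs_le.1 h1).2
      linarith
    have hb : (3 * kinkW c x.2 * f x ^ 2) ^ 2 ≤ 9 * δ ^ 2 * (kinkW c x.2 * f x ^ 2) := by
      have h1 : kinkW c x.2 * f x ^ 2 ≤ δ ^ 2 := by nlinarith [sq_nonneg (f x)]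
      have := mul_le_mul_of_nonneg_right h1 (by positivity : 0 ≤ kinkW c x.2 * f x ^ 2)
      linarith
    have e : ∀ i, gradNonlin c f F i x ^ 2
        ≤ lastInd i * (18 * δ ^ 2 * (kinkW c x.2 * f x ^ 2)) + 162 * δ ^ 2 * F i x ^ 2 := by
      intro i
      have h1 : gradNonlin c f F i x ^ 2 ≤ 2 * (lastInd i * (3 * kinkW c x.2 * f x ^ 2)) ^ 2
          + 2 * ((6 * kinkV c x.2 * f x + 3 * f x ^ 2) * F i x) ^ 2 := by
        unfold gradNonlin
        linarith [sq_nonneg (lastInd i * (3 * kinkW c x.2 * f x ^ 2)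
          - (6 * kinkV c x.2 * f x + 3 * f x ^ 2) * F i x)]
      have h2 : (lastInd i : ℝ) ^ 2 = lastInd i := by unfold lastInd; split_ifs <;> simp
      have h3 : (0 : ℝ) ≤ lastInd i := by unfold lastInd; split_ifs <;> simp
      rw [mul_pow, h2, mul_pow] at h1
      linarith [mul_le_mul_of_nonneg_left hb h3, mul_le_mul_of_nonneg_right ha (sq_nonneg (F i x))]
    refine (Finset.sum_le_sum fun i _ => e i).trans (le_of_eq ?_)
    rw [Finset.sum_add_distrib, ← Finset.mul_sum, ← Finset.sum_mul, Fin.sum_univ_castSucc]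
    simp
  rw [integral_add (iw.const_mul _) (iS.const_mul _), integral_const_mul, integral_const_mul] at key
  have h1 := mul_le_mul_of_nonneg_left hw (by positivity : 0 ≤ 18 * δ ^ 2)
  have h2 : 0 ≤ δ ^ 2 * ∫ x, ∑ i, F i x ^ 2 :=
    mul_nonneg (sq_nonneg _) (integral_nonneg fun x => Finset.sum_nonneg fun i _ => sq_nonneg _)
  linarith

lemma IsJet.integrable_derivs (h : IsJet f F F2 F3) :
    Integrable fun x => ∑ i, (F i x ^ 2 + ∑ j, F2 i j x ^ 2 + ∑ j, ∑ k, F3 i j k x ^ 2) :=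
  integrable_finsetSum _ fun i _ => ((h.grad.grad_memLp i).integrable_sq.add
    (integrable_sum_sq (h.grad1 i).grad_memLp)).add
    (integrable_finsetSum _ fun j _ => integrable_sum_sq (h.grad2 i j).grad_memLp)

lemma IsJet.integral_sum_sq_le_derivs (h : IsJet f F F2 F3) : ∫ x, ∑ i, F i x ^ 2
    ≤ ∫ x, ∑ i, (F i x ^ 2 + ∑ j, F2 i j x ^ 2 + ∑ j, ∑ k, F3 i j k x ^ 2) := by
  refine integral_mono (integrable_sum_sq h.grad.grad_memLp) h.integrable_derivs fun x =>
    Finset.sum_le_sum fun i _ => ?_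
  have h1 : 0 ≤ ∑ j, F2 i j x ^ 2 := Finset.sum_nonneg fun j _ => sq_nonneg _
  have h2 : 0 ≤ ∑ j, ∑ k, F3 i j k x ^ 2 :=
    Finset.sum_nonneg fun j _ => Finset.sum_nonneg fun k _ => sq_nonneg _
  linarith

/-- The zeroth-order term 6 v w f again carries w and is bounded through ∫ w f². The factor 5 below
is the largest value of n + 1. -/
lemma IsJet.integral_gradLinOp_sq_le (h : IsJet f F F2 F3) (hn : n ≤ 4) (c : ℝ)
    (h0 : ∫ x, kinkW c x.2 * f x = 0) :
    ∫ x, ∑ i, gradLinOp c f F F3 i x ^ 2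
      ≤ 40000 * ∫ x, ∑ i, (F i x ^ 2 + ∑ j, F2 i j x ^ 2 + ∑ j, ∑ k, F3 i j k x ^ 2) := by
  have hw := h.grad.weighted_poincare hn c h0
  have iw : Integrable fun x => kinkW c x.2 * f x ^ 2 := by
    simpa using integrable_kinkW_pow_mul_sq h.grad.memLp c 1
  have key : ∫ x, ∑ i, gradLinOp c f F F3 i x ^ 2
      ≤ ∫ x, (15 * (∑ i, (F i x ^ 2 + ∑ j, F2 i j x ^ 2 + ∑ j, ∑ k, F3 i j k x ^ 2))
        + 108 * (kinkW c x.2 * f x ^ 2)) := by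
    refine integral_mono (integrable_sum_sq (h.hasGrad_linOp c).grad_memLp)
      ((h.integrable_derivs.const_mul _).add (iw.const_mul _)) fun x => ?_
    have hwp := kinkW_pos c x.2
    have hw1 := kinkW_le_one c x.2
    have hv := kinkV_sq_lt_one c x.2
    have hv0 := sq_nonneg (kinkV c x.2)
    have hb : (6 * kinkV c x.2 * kinkW c x.2 * f x) ^ 2 ≤ 36 * (kinkW c x.2 * f x ^ 2) := by
      have e1 : kinkV c x.2 ^ 2 * kinkW c x.2 * (kinkW c x.2 * f x ^ 2)
          ≤ kinkW c x.2 * f x ^ 2 := by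
        refine mul_le_of_le_one_left (by positivity) ?_
        nlinarith
      linarith
    have ha : (3 * kinkV c x.2 ^ 2 - 1) ^ 2 ≤ 4 := by nlinarith
    have e : ∀ i, gradLinOp c f F F3 i x ^ 2 ≤ 15 * (∑ j, F3 j j i x ^ 2)
        + 108 * (lastInd i * (kinkW c x.2 * f x ^ 2)) + 12 * F i x ^ 2 := by
      intro i
      have hcs : (∑ j, F3 j j i x) ^ 2 ≤ 5 * ∑ j, F3 j j i x ^ 2 := by
        have := sq_sum_le_card_mul_sum_sq (s := Finset.univ) (f := fun j => F3 j j i x)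
        have hn' : ((n : ℝ) + 1) ≤ 5 := by
          have : (n : ℝ) ≤ 4 := by exact_mod_cast hn
          linarith
        have hs : 0 ≤ ∑ j, F3 j j i x ^ 2 := Finset.sum_nonneg fun j _ => sq_nonneg _
        simp only [Finset.card_univ, Fintype.card_fin, Nat.cast_add, Nat.cast_one] at this
        nlinarith
      have h2 : (lastInd i : ℝ) ^ 2 = lastInd i := by unfold lastInd; split_ifs <;> simp
      have h3 : (0 : ℝ) ≤ lastInd i := by unfold lastInd; split_ifs <;> simp
      have h1 : ∀ p q r : ℝ, (-p + (q + r)) ^ 2 ≤ 3 * p ^ 2 + 3 * q ^ 2 + 3 * r ^ 2 :=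
        fun p q r => by nlinarith [sq_nonneg (p + q), sq_nonneg (p + r), sq_nonneg (q - r)]
      have h4 := h1 (∑ j, F3 j j i x) (lastInd i * (6 * kinkV c x.2 * kinkW c x.2) * f x)
        ((3 * kinkV c x.2 ^ 2 - 1) * F i x)
      have h5 : (lastInd i * (6 * kinkV c x.2 * kinkW c x.2) * f x) ^ 2
          = lastInd i * (6 * kinkV c x.2 * kinkW c x.2 * f x) ^ 2 := by
        linear_combination (6 * kinkV c x.2 * kinkW c x.2 * f x) ^ 2 * h2
      rw [h5, mul_pow (3 * kinkV c x.2 ^ 2 - 1)] at h4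
      unfold gradLinOp
      linarith [mul_le_mul_of_nonneg_left hb h3,
        mul_le_mul_of_nonneg_right ha (sq_nonneg (F i x))]
    refine (Finset.sum_le_sum fun i _ => e i).trans ?_
    rw [Finset.sum_add_distrib, Finset.sum_add_distrib, ← Finset.mul_sum, ← Finset.mul_sum,
      ← Finset.mul_sum, ← Finset.sum_mul, Fin.sum_univ_castSucc (fun i => lastInd i),
      Finset.sum_add_distrib, Finset.sum_add_distrib]
    simp only [lastInd_castSucc, lastInd_last, Finset.sum_const_zero, zero_add, one_mul]
    have h6 : ∑ i, ∑ j, F3 j j i x ^ 2 ≤ ∑ i, ∑ j, ∑ k, F3 i j k x ^ 2 := by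
      rw [Finset.sum_comm]
      exact Finset.sum_le_sum fun j _ => Finset.single_le_sum (f := fun l => ∑ k, F3 j l k x ^ 2)
        (fun l _ => Finset.sum_nonneg fun k _ => sq_nonneg _) (Finset.mem_univ j)
    have h7 : 0 ≤ ∑ i, F i x ^ 2 := Finset.sum_nonneg fun i _ => sq_nonneg _
    have h8 : 0 ≤ ∑ i, ∑ j, F2 i j x ^ 2 :=
      Finset.sum_nonneg fun j _ => Finset.sum_nonneg fun k _ => sq_nonneg _
    linarith
  rw [integral_add (h.integrable_derivs.const_mul _) (iw.const_mul _), integral_const_mul,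
    integral_const_mul] at key
  have h1 := h.integral_sum_sq_le_derivs
  have h2 : 0 ≤ ∫ x, ∑ i, F i x ^ 2 :=
    integral_nonneg fun x => Finset.sum_nonneg fun i _ => sq_nonneg _
  linarith

lemma integral_sum_sq_add_le {ι : Type*} [Fintype ι] {a b : ι → Strip n → ℝ}
    (ha : ∀ i, MemLp (a i) 2) (hb : ∀ i, MemLp (b i) 2) :
    ∫ x, ∑ i, (a i x + b i x) ^ 2
      ≤ 2 * (∫ x, ∑ i, a i x ^ 2) + 2 * ∫ x, ∑ i, b i x ^ 2 := by
  have iA := integrable_sum_sq ha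
  have iB := integrable_sum_sq hb
  rw [← integral_const_mul, ← integral_const_mul, ← integral_add (iA.const_mul _) (iB.const_mul _)]
  refine integral_mono (integrable_sum_sq fun i => (ha i).add (hb i))
    ((iA.const_mul _).add (iB.const_mul _)) fun x => ?_
  simp only [Finset.mul_sum, ← Finset.sum_add_distrib]
  exact Finset.sum_le_sum fun i _ => by nlinarith [sq_nonneg (a i x - b i x)]

/-- Absorption: the nonlinear part contributes at most 10¹⁶ · 2 · 6000 δ² times the left-hand side,
about 0.012 when δ ≤ 10⁻¹¹. -/
lemma IsJet.nonlinear_estimate (h : IsJet f F F2 F3) (hn : n ≤ 4) (c : ℝ)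
    (h0 : ∫ x, kinkW c x.2 * f x = 0) (hδ : ∀ᵐ x, |f x| ≤ δ) (hδ0 : 0 ≤ δ)
    (hδ1 : δ ≤ 1 / 10 ^ 11) :
    ∫ x, ∑ i, (F i x ^ 2 + ∑ j, F2 i j x ^ 2 + ∑ j, ∑ k, F3 i j k x ^ 2)
      ≤ 10 ^ 17 * ∫ x, ∑ i, (gradLinOp c f F F3 i x + gradNonlin c f F i x) ^ 2 := by
  have hQ := (h.hasGrad_linOp c).grad_memLp
  have hN := (h.grad.hasGrad_nonlin c hδ).grad_memLp
  have h1 := h.linear_estimate hn c h0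
  have h2 := h.grad.integral_gradNonlin_sq_le hn c h0 hδ (hδ1.trans (by norm_num))
  have h3 := integral_sum_sq_add_le (fun i => (hQ i).add (hN i)) fun i => (hN i).const_mul (-1)
  have e1 : ∀ i x, (gradLinOp c f F F3 i + gradNonlin c f F i) x + -1 * gradNonlin c f F i x
      = gradLinOp c f F F3 i x := fun i x => by simp
  have e2 : ∀ i x, (-1 * gradNonlin c f F i x) ^ 2 = gradNonlin c f F i x ^ 2 :=
    fun i x => by ring
  simp only [e1, e2] at h3
  simp only [Pi.add_apply] at h3
  have h4 := h.integral_sum_sq_le_derivs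
  have h5 : 0 ≤ ∫ x, ∑ i, F i x ^ 2 :=
    integral_nonneg fun x => Finset.sum_nonneg fun i _ => sq_nonneg _
  have h6 : δ ^ 2 ≤ 1 / 10 ^ 22 := by
    have := pow_le_pow_left₀ hδ0 hδ1 2
    exact this.trans (by norm_num)
  have h7 := mul_le_mul_of_nonneg_right h6 h5
  linarith

lemma IsJet.nonlinear_estimate_le (h : IsJet f F F2 F3) (hn : n ≤ 4) (c : ℝ)
    (h0 : ∫ x, kinkW c x.2 * f x = 0) (hδ : ∀ᵐ x, |f x| ≤ δ) (hδ0 : 0 ≤ δ) (hδ1 : δ ≤ 1) :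
    ∫ x, ∑ i, (gradLinOp c f F F3 i x + gradNonlin c f F i x) ^ 2
      ≤ 100000 * ∫ x, ∑ i, (F i x ^ 2 + ∑ j, F2 i j x ^ 2 + ∑ j, ∑ k, F3 i j k x ^ 2) := by
  have h1 := h.integral_gradLinOp_sq_le hn c h0
  have h2 := h.grad.integral_gradNonlin_sq_le hn c h0 hδ hδ1
  have h3 := integral_sum_sq_add_le (h.hasGrad_linOp c).grad_memLp
    (h.grad.hasGrad_nonlin c hδ).grad_memLp
  have h4 := h.integral_sum_sq_le_derivs
  have h5 : 0 ≤ ∫ x, ∑ i, F i x ^ 2 :=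
    integral_nonneg fun x => Finset.sum_nonneg fun i _ => sq_nonneg _
  have h6 : δ ^ 2 ≤ 1 := pow_le_one₀ hδ0 hδ1
  have h7 := mul_le_mul_of_nonneg_right h6 h5
  linarith

end Nonlinear

lemma deriv_doubleWell (s : ℝ) : deriv doubleWell s = s ^ 3 - s := by
  have h := ((((hasDerivAt_id s).pow 2).const_sub 1).pow 2).div_const 4
  refine (HasDerivAt.congr_deriv (f := doubleWell) h ?_).deriv
  simp
  ring

/-! ### The dissipation of u in terms of the derivatives of f. -/

section Dissipation

variable {u : Strip n → ℝ} {c δ : ℝ} {F : Fin (n + 1) → Strip n → ℝ}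
  {F2 : Fin (n + 1) → Fin (n + 1) → Strip n → ℝ}
  {F3 : Fin (n + 1) → Fin (n + 1) → Fin (n + 1) → Strip n → ℝ}

lemma IsJet.hasWeakDeriv_weakDeriv (h : IsJet (u - kink n c) F F2 F3) (i : Fin (n + 1)) :
    HasWeakDeriv i (weakDeriv i u)
      (fun x => lastInd i * (-(√2 * kinkV c x.2 * kinkW c x.2)) + F2 i i x) := by
  have h1 : HasGrad (fun x => lastInd i * kinkW c x.2 + F i x) _ :=
    ((hasGrad_kinkW (n := n) c).const_mul (lastInd i)).add (h.grad1 i)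
  refine (h1.weak i).congr (h.grad.hasWeakDeriv_of_sub_kink i).weakDeriv_ae.symm
    (Eventually.of_forall fun x => ?_)
  -- Differentiating twice in direction i produces the indicator squared.
  have h2 : (lastInd i : ℝ) ^ 2 = lastInd i := by unfold lastInd; split_ifs <;> simp
  linear_combination (-(√2 * kinkV c x.2 * kinkW c x.2)) * h2

/-- The kink equation cancels the contribution of v itself, so Δu - G'(u) = -(Lf + 3v f² + f³) lies
in H¹, although u need not be in L². -/
lemma IsJet.hasGrad_potential (h : IsJet (u - kink n c) F F2 F3)
    (hδ : ∀ᵐ x, |(u - kink n c) x| ≤ δ) :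
    HasGrad (potential u) (fun i x => -1 * (gradLinOp c (u - kink n c) F F3 i x
      + gradNonlin c (u - kink n c) F i x)) := by
  refine (((h.hasGrad_linOp c).add (h.grad.hasGrad_nonlin c hδ)).const_mul (-1)).congr ?_
    fun i => ae_eq_refl _
  have hall : ∀ᵐ x, ∀ i, weakDeriv i (weakDeriv i u) x
      = lastInd i * (-(√2 * kinkV c x.2 * kinkW c x.2)) + F2 i i x :=
    ae_all_iff.2 fun i => (h.hasWeakDeriv_weakDeriv i).weakDeriv_ae
  filter_upwards [hall] with x hx
  have hw := sqrt_two_mul_kinkW c x.2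
  have hu : u x = kinkV c x.2 + (u - kink n c) x := by
    simp only [Pi.sub_apply, kink, kinkV]; ring
  have hsum : ∑ i : Fin (n + 1), (lastInd i : ℝ) = 1 := by
    rw [Fin.sum_univ_castSucc]; simp
  simp only [potential, laplacian, hx, deriv_doubleWell, linOp]
  rw [Finset.sum_add_distrib, ← Finset.sum_mul, hsum]
  generalize hfx : (u - kink n c) x = p at hu
  rw [hu]
  linear_combination kinkV c x.2 * hw

lemma IsJet.dissipation_eq (h : IsJet (u - kink n c) F F2 F3)
    (hδ : ∀ᵐ x, |(u - kink n c) x| ≤ δ) :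
    dissipation u = ENNReal.ofReal (∫ x, ∑ i, (gradLinOp c (u - kink n c) F F3 i x
      + gradNonlin c (u - kink n c) F i x) ^ 2) := by
  have hp := h.hasGrad_potential hδ
  have hall : ∀ᵐ x, ∀ i, weakDeriv i (potential u) x = -1 * (gradLinOp c (u - kink n c) F F3 i x
      + gradNonlin c (u - kink n c) F i x) := ae_all_iff.2 fun i => (hp.weak i).weakDeriv_ae
  rw [dissipation, if_pos fun i => ⟨(h.grad.hasWeakDeriv_of_sub_kink i).weakDiff,
    (h.hasWeakDeriv_weakDeriv i).weakDiff, (hp.weak i).weakDiff⟩,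
    ofReal_integral_eq_lintegral_ofReal]
  · refine lintegral_congr_ae (hall.mono fun x hx => ?_)
    simp only [gradSq_one, hx]
    congr 1
    exact Finset.sum_congr rfl fun i _ => by ring
  · refine (integrable_sum_sq hp.grad_memLp).congr (Eventually.of_forall fun x => ?_)
    exact Finset.sum_congr rfl fun i _ => by ring
  · exact Eventually.of_forall fun x => Finset.sum_nonneg fun i _ => sq_nonneg _

end Dissipation

end Strip

/-! ### Sup norm and Sobolev norms as real quantities, and the conclusion. -/

namespace Strip

variable {n : ℕ}

lemma ae_abs_le_of_eLpNorm_le {f : Strip n → ℝ} {δ : ℝ} (hδ : 0 ≤ δ)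
    (h : eLpNorm f ⊤ volume ≤ ENNReal.ofReal δ) : ∀ᵐ x, |f x| ≤ δ := by
  rw [eLpNorm_exponent_top] at h
  filter_upwards [ae_le_eLpNormEssSup (f := f) (μ := volume)] with x hx
  have := hx.trans h
  rwa [← ofReal_norm, ENNReal.ofReal_le_ofReal_iff hδ, Real.norm_eq_abs] at this

lemma HasGrad.lintegral_sobolev_eq {f : Strip n → ℝ} (h : HasGrad f fun i => weakDeriv i f) :
    ∫⁻ x, ENNReal.ofReal (gradSq 0 f x + gradSq 1 f x)
      = ENNReal.ofReal (∫ x, (f x ^ 2 + ∑ i, weakDeriv i f x ^ 2)) :=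
  (ofReal_integral_eq_lintegral_ofReal
    (h.memLp.integrable_sq.add (integrable_sum_sq h.grad_memLp))
    (Eventually.of_forall fun _ => add_nonneg (sq_nonneg _)
      (Finset.sum_nonneg fun _ _ => sq_nonneg _))).symm

lemma MemSobolev.lintegral_derivs_eq {f : Strip n → ℝ} (h : MemSobolev 3 f) :
    ∫⁻ x, ENNReal.ofReal (gradSq 1 f x + gradSq 2 f x + gradSq 3 f x)
      = ENNReal.ofReal (∫ x, ∑ i, (Strip.weakDeriv i f x ^ 2
        + ∑ j, Strip.weakDeriv j (Strip.weakDeriv i f) x ^ 2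
        + ∑ j, ∑ k, Strip.weakDeriv k (Strip.weakDeriv j (Strip.weakDeriv i f)) x ^ 2)) := by
  rw [ofReal_integral_eq_lintegral_ofReal h.isJet.integrable_derivs
    (Eventually.of_forall fun x => by positivity)]
  refine lintegral_congr fun x => ?_
  simp only [Finset.sum_add_distrib]
  rfl

end Strip

end

theorem proposition3p1 :
    ∃ (δ : ℝ) (C : ℝ≥0), 0 < δ ∧ 0 < C ∧
      ∀ n : ℕ, n + 1 ≤ 5 → ∀ (u : Strip n → ℝ) (c : ℝ),
        Strip.IsClosestKink u c →
        Strip.MemSobolev 3 (u - Strip.kink n c) →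
        eLpNorm (u - Strip.kink n c) ∞ volume ≤ ENNReal.ofReal δ →
        (Strip.energyGap u ≤
            ((C * ∫⁻ x, ENNReal.ofReal (Strip.gradSq 0 (u - Strip.kink n c) x
              + Strip.gradSq 1 (u - Strip.kink n c) x) : ℝ≥0∞) : EReal) ∧
          ((∫⁻ x, ENNReal.ofReal (Strip.gradSq 0 (u - Strip.kink n c) x
              + Strip.gradSq 1 (u - Strip.kink n c) x) : ℝ≥0∞) : EReal) ≤
            ((C : ℝ) : EReal) * Strip.energyGap u) ∧
        (Strip.dissipation u ≤
            C * ∫⁻ x, ENNReal.ofReal (Strip.gradSq 1 (u - Strip.kink n c) x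
              + Strip.gradSq 2 (u - Strip.kink n c) x
              + Strip.gradSq 3 (u - Strip.kink n c) x) ∧
          ∫⁻ x, ENNReal.ofReal (Strip.gradSq 1 (u - Strip.kink n c) x
              + Strip.gradSq 2 (u - Strip.kink n c) x
              + Strip.gradSq 3 (u - Strip.kink n c) x) ≤
            C * Strip.dissipation u) := by

  have cR : (((10 : ℝ≥0) ^ 17 : ℝ≥0) : ℝ) = 10 ^ 17 := by norm_num
  have cE : (((10 : ℝ≥0) ^ 17 : ℝ≥0) : ℝ≥0∞) = ENNReal.ofReal (10 ^ 17) := by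
    rw [← cR, ENNReal.ofReal_coe_nnreal]
  -- Both constants are dictated by `nonlinear_estimate`; the other three bounds hold with room to
  -- spare.
  refine ⟨1 / 10 ^ 11, 10 ^ 17, by norm_num, by positivity, fun n hn u c hcl hS hsup => ?_⟩
  have hn : n ≤ 4 := by omega
  have hδ := Strip.ae_abs_le_of_eLpNorm_le (by norm_num) hsup
  have h0 := hcl.integral_kinkW_mul_eq_zero hS.memLp
  have hJ := hS.isJet
  have hG := hJ.grad
  rw [hG.lintegral_sobolev_eq, hS.lintegral_derivs_eq, hG.energyGap_eq hδ (by norm_num),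
    hJ.dissipation_eq hδ, cE, cR, ← ENNReal.ofReal_mul (by positivity),
    ← ENNReal.ofReal_mul (by positivity), ← ENNReal.ofReal_mul (by positivity),
    EReal.coe_ennreal_ofReal, EReal.coe_ennreal_ofReal, ← EReal.coe_mul, EReal.coe_le_coe_iff,
    EReal.coe_le_coe_iff]
  have hN : 0 ≤ ∫ x, ((u - Strip.kink n c) x ^ 2
      + ∑ i, Strip.weakDeriv i (u - Strip.kink n c) x ^ 2) :=
    MeasureTheory.integral_nonneg fun x => by positivity
  have h1 := hG.integral_excess_le c hδ (by norm_num)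
  have h2 := hG.le_integral_excess hn c h0 hδ (by norm_num)
  -- Casting `ENNReal.ofReal` to the extended reals yields a maximum with 0, so the lower bound also
  -- needs the gap to be nonnegative; this follows from `h2`.
  refine ⟨⟨(h1.trans ?_).trans (le_max_left _ _), max_le (h2.trans ?_) ?_⟩, ?_, ?_⟩
  · exact mul_le_mul_of_nonneg_right (by norm_num) hN
  · exact mul_le_mul_of_nonneg_right (by norm_num) (by linarith)
  · exact mul_nonneg (by positivity) (by linarith)
  · refine ENNReal.ofReal_le_ofReal ((hJ.nonlinear_estimate_le hn c h0 hδ (by norm_num)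
      (by norm_num)).trans (mul_le_mul_of_nonneg_right (by norm_num) ?_))
    exact MeasureTheory.integral_nonneg fun x => by positivity
  · exact ENNReal.ofReal_le_ofReal
      (hJ.nonlinear_estimate hn c h0 hδ (by norm_num) le_rfl)
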